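/- Let $d\ge 1$, let $\widehat f(\xi)=\int_{\mathbb R^d} f(x)e^{-2\pi i\langle x,\xi\rangle}\,dx$, and let $f^\vee$ denote the inverse Fourier transform. Fix a Schwartz function $\phi$ on $\mathbb R^d$ with $\operatorname{supp}\widehat\phi\subset\{1/2\le|\xi|\le 2\}$ and $\sum_{k\in\mathbb Z}\widehat{\phi_k}(\xi)=1$ for $\xi\neq0$, where $\phi_k=2^{kd}\phi(2^k\cdot)$, and put $\Pi_kf=\phi_k*f$. Fix also a smooth function $\varphi$ with $0\le\varphi\le1$, $\varphi=1$ on $\{1/2\le|\xi|\le2\}$ and $\operatorname{supp}\varphi\subset\{1/4\le|\xi|\le4\}$. For $0<p,q\le\infty$ and $f\in S'/\mathcal P$ (tempered distributions modulo polynomials) let $\|f\|_{\dot B_p^{0,q}}=\big\|\{\|\Pi_kf\|_{L^p}\}_{k\in\mathbb Z}\big\|_{\ell^q}$, and let $\dot B_p^{0,q}$ be the set of those $f$ for which this is finite. For $0<u\le\infty$, $s\in\mathbb R$, $t>0$ put $$\|F\|_{K_u^{s,t}}=\Big(\sum_{l=0}^\infty 2^{slt}\|F\|_{L^u(B_l)}^t\Big)^{1/t}$$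 (with the usual modification for $t=\infty$), where $B_0=\{|x|\le2\}$ and $B_l=\{2^l<|x|\le2^{l+1}\}$ for $l\ge1$. For $m\in L^\infty(\mathbb R^d)$ put $$\mathcal K_u^{s,t}[m]=\sup_{k\in\mathbb Z}\big\|(m(2^k\cdot)\varphi)^\vee\big\|_{K_u^{s,t}} .$$ For $m\in L^\infty$ the operator $T_mf=(m\widehat f)^\vee$ is understood on $S'/\mathcal P$ as $$T_mf=\sum_{k\in\mathbb Z}m_k^\vee*\Pi_kf,\qquad m_k=m\,\varphi(2^{-k}\cdot).$$ That is, $g=T_mf$ means that all these convolutions are defined everywhere and are integrable against every function in $S_\infty$ (the Schwartz functions all of whose moments vanish), and that for every $\psi\in S_\infty$ the series $\sum_k\int (m_k^\vee*\Pi_kf)\,\psi$ converges unconditionally to $\langle g,\psi\rangle$. **Theorem.** For every $m\in L^\infty$ and every Schwartz function $h$, the class of the tempered distribution $(m\widehat h)^\vee$ is $T_mh$ in this sense. Moreover, let $0<p,q\le\infty$ and $r=\min(1,p)$. 1. If $0<u\le r$, there is a finite constant $C$, depending only on $d,p,q,u$ and on the fixed functions $\phi,\varphi$, such that for all $m\in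 L^\infty$ with $\mathcal K_u^{0,r}[m]<\infty$ and all $f\in\dot B_p^{0,q}$, $T_mf$ exists in $S'/\mathcal P$ and $$\|T_mf\|_{\dot B_p^{0,q}}\le C\,\mathcal K_u^{0,r}[m]\,\|f\|_{\dot B_p^{0,q}} .$$ 2. If $r<u\le\infty$, there is a finite constant $C$, depending only on $d,p,q,u$ and on $\phi,\varphi$, such that for all $m\in L^\infty$ with $\mathcal K_u^{d/r-d/u,\,r}[m]<\infty$ and all $f\in\dot B_p^{0,q}$ (with $d/u=0$ if $u=\infty$), $T_mf$ exists in $S'/\mathcal P$ and $$\|T_mf\|_{\dot B_p^{0,q}}\le C\,\mathcal K_u^{d/r-d/u,\,r}[m]\,\|f\|_{\dot B_p^{0,q}} .$$ -/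

import Mathlib

open MeasureTheory Set
open scoped ENNReal NNReal SchwartzMap FourierTransform Convolution

noncomputable section

namespace BesovMultiplier

/-- Euclidean space `ℝ^d`. -/
abbrev E (d : ℕ) : Type := EuclideanSpace ℝ (Fin d)

/-! ### Tempered distributions modulo polynomials -/

/-- The monomial `x ↦ x^γ`, for a multi-index `γ`. -/
def monomial {d : ℕ} (γ : Fin d → ℕ) (x : E d) : ℂ := ∏ i, ((x i : ℝ) : ℂ) ^ γ i

theorem monomial_hasTemperateGrowth {d : ℕ} (γ : Fin d → ℕ) :
    (monomial γ).HasTemperateGrowth := by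
  classical
  have hc : ∀ i : Fin d, (fun x : E d => ((x i : ℝ) : ℂ)).HasTemperateGrowth := fun i =>
    (Complex.ofRealCLM.comp
      (EuclideanSpace.proj i : E d →L[ℝ] ℝ)).hasTemperateGrowth
  have key : ∀ s : Finset (Fin d),
      (fun x : E d => ∏ i ∈ s, ((x i : ℝ) : ℂ) ^ γ i).HasTemperateGrowth := by
    intro s
    induction s using Finset.induction_on with
    | empty => simp [Function.HasTemperateGrowth.const]
    | insert a s ha ih =>
      simp only [Finset.prod_insert ha]
      exact ((hc a).pow (γ a)).mul ih
  exact key Finset.univ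

/-- The tempered distribution given by integration against `x^γ`. -/
def monomialDist {d : ℕ} (γ : Fin d → ℕ) : 𝓢'(E d, ℂ) :=
  Function.HasTemperateGrowth.toTemperedDistribution volume (monomial_hasTemperateGrowth γ)

theorem monomialDist_apply {d : ℕ} (γ : Fin d → ℕ) (ψ : 𝓢(E d, ℂ)) :
    monomialDist γ ψ = ∫ x, monomial γ x * ψ x := by
  have h : monomialDist γ ψ = ∫ x, ψ x • monomial γ x := rfl
  rw [h]
  simp only [smul_eq_mul, mul_comm]

/-- The space `𝒫` of polynomials, as a subspace of the tempered distributions. -/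
def polynomials (d : ℕ) : Submodule ℂ 𝓢'(E d, ℂ) :=
  Submodule.span ℂ (Set.range (monomialDist (d := d)))

/-- `S'/𝒫`: tempered distributions modulo polynomials. -/
abbrev TemperedModPoly (d : ℕ) : Type := 𝓢'(E d, ℂ) ⧸ polynomials d

/-- The class in `S'/𝒫` of a tempered distribution. -/
def toModPoly {d : ℕ} (f : 𝓢'(E d, ℂ)) : TemperedModPoly d := Submodule.Quotient.mk f

/-- `S_∞`: the Schwartz functions all of whose moments vanish. -/
def SInfty (d : ℕ) : Submodule ℂ 𝓢(E d, ℂ) where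
  carrier := {ψ | ∀ γ : Fin d → ℕ, ∫ x, monomial γ x * ψ x = 0}
  add_mem' := by
    intro a b ha hb γ
    have ha' := ha γ
    have hb' := hb γ
    rw [← monomialDist_apply] at ha' hb' ⊢
    rw [map_add, ha', hb', add_zero]
  zero_mem' := by intro γ; simp
  smul_mem' := by
    intro c a ha γ
    have ha' := ha γ
    rw [← monomialDist_apply] at ha' ⊢
    rw [map_smul, ha', smul_zero]

theorem polynomials_apply_SInfty {d : ℕ} (ψ : SInfty d) {f : 𝓢'(E d, ℂ)}
    (hf : f ∈ polynomials d) : f (ψ : 𝓢(E d, ℂ)) = 0 := by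
  induction hf using Submodule.span_induction with
  | mem f hf =>
    obtain ⟨γ, rfl⟩ := hf
    rw [monomialDist_apply]
    exact ψ.2 γ
  | zero => rfl
  | add f g _ _ hf hg =>
    change f (ψ : 𝓢(E d, ℂ)) + g (ψ : 𝓢(E d, ℂ)) = 0
    rw [hf, hg, add_zero]
  | smul c f _ hf =>
    change c • f (ψ : 𝓢(E d, ℂ)) = 0
    rw [hf, smul_zero]

/-- The action of `f ∈ S'/𝒫` on `ψ ∈ S_∞`, induced by the action of `S'` on `S`. -/
def pairing {d : ℕ} (f : TemperedModPoly d) (ψ : SInfty d) : ℂ :=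
  (polynomials d).liftQ
    ({ toFun := fun T => T (ψ : 𝓢(E d, ℂ))
       map_add' := fun _ _ => rfl
       map_smul' := fun _ _ => rfl } : 𝓢'(E d, ℂ) →ₗ[ℂ] ℂ)
    (fun _ hT => polynomials_apply_SInfty ψ hT) f

@[simp]
theorem pairing_toModPoly {d : ℕ} (f : 𝓢'(E d, ℂ)) (ψ : SInfty d) :
    pairing (toModPoly f) ψ = f (ψ : 𝓢(E d, ℂ)) := rfl

/-! ### Littlewood-Paley decomposition and Besov norm -/

/-- A function `ϕ` generating a homogeneous dyadic resolution of unity: `ϕ` is a Schwartz function,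
its Fourier transform is supported in `{1/2 ≤ |ξ| ≤ 2}`, and `∑_k \hat{ϕ_k}(ξ) = 1` for `ξ ≠ 0`,
where `ϕ_k = 2^{kd} ϕ(2^k ·)`, that is `\hat{ϕ_k}(ξ) = \hat ϕ(2^{-k} ξ)`. -/
structure DyadicResolution (d : ℕ) where
  /-- the generating Schwartz function -/
  fn : 𝓢(E d, ℂ)
  tsupport_fourier : tsupport ⇑(𝓕 fn : 𝓢(E d, ℂ)) ⊆ {ξ | 1 / 2 ≤ ‖ξ‖ ∧ ‖ξ‖ ≤ 2}
  hasSum_one : ∀ ξ : E d, ξ ≠ 0 → HasSum (fun k : ℤ => 𝓕 fn ((2 : ℝ) ^ (-k) • ξ)) 1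

theorem reflectedDilation_antilipschitz {d : ℕ} (k : ℤ) (x : E d) :
    AntilipschitzWith (((2 : ℝ≥0) ^ k)⁻¹) (fun y : E d => (2 : ℝ) ^ k • (x - y)) := by
  refine AntilipschitzWith.of_le_mul_dist fun y z => ?_
  have h2 : (0 : ℝ) < 2 ^ k := by positivity
  rw [dist_eq_norm, dist_eq_norm, ← smul_sub, norm_smul, Real.norm_of_nonneg h2.le]
  have : x - y - (x - z) = -(y - z) := by abel
  rw [this, norm_neg]
  push_cast
  rw [← mul_assoc, inv_mul_cancel₀ h2.ne', one_mul]

/-- The Schwartz function `y ↦ ϕ_k(x - y) = 2^{kd} ϕ(2^k (x - y))`. -/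
def dyadicKernel {d : ℕ} (ϕ : 𝓢(E d, ℂ)) (k : ℤ) (x : E d) : 𝓢(E d, ℂ) :=
  ((2 : ℂ) ^ (k * d)) • SchwartzMap.compCLMOfAntilipschitz ℂ
    (g := fun y : E d => (2 : ℝ) ^ k • (x - y)) (by fun_prop)
    (reflectedDilation_antilipschitz k x) ϕ

theorem dyadicKernel_apply {d : ℕ} (ϕ : 𝓢(E d, ℂ)) (k : ℤ) (x y : E d) :
    dyadicKernel ϕ k x y = (2 : ℂ) ^ (k * d) * ϕ ((2 : ℝ) ^ k • (x - y)) := rfl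

theorem fourier_dyadicKernel {d : ℕ} (ϕ : 𝓢(E d, ℂ)) (k : ℤ) (x ξ : E d)
    (h : 𝓕 ϕ (-((2 : ℝ) ^ (-k) • ξ)) = 0) : 𝓕 (dyadicKernel ϕ k x) ξ = 0 := by
  have h2 : (0 : ℝ) < 2 ^ k := by positivity
  have h2' : (2 : ℝ) ^ k * (2 : ℝ) ^ (-k) = 1 := by rw [zpow_neg, mul_inv_cancel₀ h2.ne']
  rw [SchwartzMap.fourier_coe, Real.fourier_eq'] at h ⊢
  set G : E d → ℂ := fun w =>
    Complex.exp ((↑(-2 * Real.pi * inner ℝ w (-((2 : ℝ) ^ (-k) • ξ))) : ℂ) * Complex.I) • ϕ w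
    with hG
  set c : ℂ := (2 : ℂ) ^ (k * d) *
    Complex.exp ((↑(-2 * Real.pi * inner ℝ x ξ) : ℂ) * Complex.I) with hc
  have key : ∀ y : E d,
      Complex.exp ((↑(-2 * Real.pi * inner ℝ y ξ) : ℂ) * Complex.I) • dyadicKernel ϕ k x y =
        c * G ((2 : ℝ) ^ k • (x - y)) := by
    intro y
    have hin : inner ℝ ((2 : ℝ) ^ k • (x - y)) (-((2 : ℝ) ^ (-k) • ξ)) =
        inner ℝ y ξ - inner ℝ x ξ := by
      rw [inner_neg_right, real_inner_smul_left, real_inner_smul_right, ← mul_assoc, h2',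
        one_mul, inner_sub_left]
      ring
    have hexp : Complex.exp ((↑(-2 * Real.pi * inner ℝ y ξ) : ℂ) * Complex.I) =
        Complex.exp ((↑(-2 * Real.pi * inner ℝ x ξ) : ℂ) * Complex.I) *
        Complex.exp ((↑(-2 * Real.pi * (inner ℝ y ξ - inner ℝ x ξ)) : ℂ) * Complex.I) := by
      rw [← Complex.exp_add]
      congr 1
      push_cast
      ring
    simp only [hG, hc, dyadicKernel_apply, smul_eq_mul]
    rw [hin, hexp]
    ring
  simp_rw [key]
  rw [integral_const_mul, integral_sub_left_eq_self (fun z : E d => G ((2 : ℝ) ^ k • z)) volume x,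
    Measure.integral_comp_smul, h, smul_zero, mul_zero]

theorem mem_SInfty_of_fourier_eventuallyEq {d : ℕ} {ψ : 𝓢(E d, ℂ)}
    (hψ : ⇑(𝓕 ψ : 𝓢(E d, ℂ)) =ᶠ[nhds 0] 0) : ψ ∈ SInfty d := by
  classical
  have main : ∀ (n : ℕ) (γ : Fin d → ℕ), ∑ i, γ i = n → ∀ ψ : 𝓢(E d, ℂ),
      ⇑(𝓕 ψ : 𝓢(E d, ℂ)) =ᶠ[nhds 0] 0 → ∫ x, monomial γ x * ψ x = 0 := by
    intro n
    induction n with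
    | zero =>
      intro γ hγ ψ hψ
      have hz : ∀ i, γ i = 0 := by simpa using hγ
      have h0 : 𝓕 ψ 0 = 0 := hψ.self_of_nhds
      rw [SchwartzMap.fourier_coe, Real.fourier_eq'] at h0
      simpa [monomial, hz] using h0
    | succ n ih =>
      intro γ hγ ψ hψ
      obtain ⟨i, hi⟩ : ∃ i, γ i ≠ 0 := by
        by_contra hcon
        push Not at hcon
        simp [hcon] at hγ
      set e : E d := EuclideanSpace.single i (1 : ℝ) with he
      have hgrow : (fun x : E d => inner ℝ x e).HasTemperateGrowth := by fun_prop
      set χ : 𝓢(E d, ℂ) := SchwartzMap.smulLeftCLM ℂ (fun x : E d => inner ℝ x e) ψ with hχ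
      have hχ_apply : ∀ x : E d, χ x = ((x i : ℝ) : ℂ) * ψ x := by
        intro x
        rw [hχ, SchwartzMap.smulLeftCLM_apply_apply hgrow]
        simp [he, EuclideanSpace.inner_single_right]
      have hχF : ⇑(𝓕 χ : 𝓢(E d, ℂ)) =ᶠ[nhds 0] 0 := by
        have hl := SchwartzMap.lineDerivOp_fourier_eq ψ e
        have hsm : 𝓕 (-(2 * Real.pi * Complex.I) • χ) = -(2 * Real.pi * Complex.I) • 𝓕 χ :=
          FourierTransform.fourier_smul _ _
        rw [hsm] at hl
        filter_upwards [hψ.eventuallyEq_nhds] with ξ hξ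
        have hd : lineDeriv ℝ ⇑(𝓕 ψ : 𝓢(E d, ℂ)) ξ e = 0 := by
          rw [lineDeriv, Filter.EventuallyEq.deriv_eq (f := fun _ : ℝ => (0 : ℂ))]
          · simp
          · have hcont : Filter.Tendsto (fun t : ℝ => ξ + t • e) (nhds 0) (nhds ξ) := by
              have : Continuous fun t : ℝ => ξ + t • e := by fun_prop
              simpa using this.tendsto 0
            exact hcont.eventually hξ
        have hval := DFunLike.congr_fun hl ξ
        rw [SchwartzMap.lineDerivOp_apply, hd, smul_apply, smul_eq_mul] at hval
        have hne : -(2 * (Real.pi : ℂ) * Complex.I) ≠ 0 := by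
          simp [Real.pi_ne_zero, Complex.I_ne_zero]
        exact (mul_eq_zero.mp hval.symm).resolve_left hne
      set γ' : Fin d → ℕ := Function.update γ i (γ i - 1) with hγ'
      have hsum : ∑ j, γ' j = n := by
        rw [← Finset.add_sum_erase _ _ (Finset.mem_univ i)] at hγ ⊢
        have hcongr : ∑ j ∈ Finset.univ.erase i, γ' j = ∑ j ∈ Finset.univ.erase i, γ j :=
          Finset.sum_congr rfl fun j hj => by simp [hγ', Finset.ne_of_mem_erase hj]
        have hii : γ' i = γ i - 1 := by simp [hγ']
        omega
      have hprod : ∀ x : E d, monomial γ x = monomial γ' x * ((x i : ℝ) : ℂ) := by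
        intro x
        simp only [monomial]
        rw [← Finset.mul_prod_erase _ _ (Finset.mem_univ i),
          ← Finset.mul_prod_erase _ (fun j => ((x j : ℝ) : ℂ) ^ γ' j) (Finset.mem_univ i)]
        have hcongr : ∏ j ∈ Finset.univ.erase i, ((x j : ℝ) : ℂ) ^ γ' j =
            ∏ j ∈ Finset.univ.erase i, ((x j : ℝ) : ℂ) ^ γ j :=
          Finset.prod_congr rfl fun j hj => by simp [hγ', Finset.ne_of_mem_erase hj]
        have hii : γ i = γ' i + 1 := by
          simp only [hγ', Function.update_self]
          omega
        rw [hcongr, hii, pow_succ]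
        ring
      have := ih γ' hsum χ hχF
      rw [← this]
      congr 1
      ext x
      rw [hχ_apply, hprod]
      ring
  intro γ
  exact main _ γ rfl ψ hψ

theorem dyadicKernel_mem_SInfty {d : ℕ} (ϕ : DyadicResolution d) (k : ℤ) (x : E d) :
    dyadicKernel ϕ.fn k x ∈ SInfty d := by
  apply mem_SInfty_of_fourier_eventuallyEq
  have h2 : (0 : ℝ) < 2 ^ (-k) := by positivity
  have hc : Continuous fun ξ : E d => ‖(2 : ℝ) ^ (-k) • ξ‖ := by fun_prop
  have hlt : ∀ᶠ ξ : E d in nhds 0, ‖(2 : ℝ) ^ (-k) • ξ‖ < 1 / 2 :=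
    hc.continuousAt.eventually_lt_const (by simp)
  filter_upwards [hlt] with ξ hξ
  apply fourier_dyadicKernel
  by_contra hne
  have hmem := ϕ.tsupport_fourier (subset_tsupport _ (Function.mem_support.mpr hne))
  have h1 : 1 / 2 ≤ ‖-((2 : ℝ) ^ (-k) • ξ)‖ := hmem.1
  rw [norm_neg] at h1
  exact absurd hξ (not_lt.mpr h1)

/-- `Π_k f = ϕ_k * f`, the function `x ↦ ⟨f, ϕ_k(x - ·)⟩`, for `f ∈ S'/𝒫`. -/
def proj {d : ℕ} (ϕ : DyadicResolution d) (k : ℤ) (f : TemperedModPoly d) (x : E d) : ℂ :=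
  pairing f ⟨dyadicKernel ϕ.fn k x, dyadicKernel_mem_SInfty ϕ k x⟩

/-- The homogeneous Besov (quasi-)norm of order zero: the `ℓ^q(L^p)` (quasi-)norm of the sequence
`(Π_k f)_{k ∈ ℤ}`. -/
def besovNorm {d : ℕ} (ϕ : DyadicResolution d) (p q : ℝ≥0∞) (f : TemperedModPoly d) : ℝ≥0∞ :=
  eLpNorm (fun k : ℤ => eLpNorm (proj ϕ k f) p volume) q Measure.count

/-! ### Herz spaces -/

/-- `B_0 = {|x| ≤ 2}` and `B_l = {2^l < |x| ≤ 2^{l+1}}` for `l ≥ 1`. -/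
def herzShell (d : ℕ) (l : ℕ) : Set (E d) :=
  if l = 0 then {x | ‖x‖ ≤ 2} else {x | (2 : ℝ) ^ l < ‖x‖ ∧ ‖x‖ ≤ (2 : ℝ) ^ (l + 1)}

/-- The Herz (quasi-)norm `‖F‖_{K_u^{s,t}}`: the `ℓ^t` (quasi-)norm of
`(2^{sl} ‖F‖_{L^u(B_l)})_{l ≥ 0}`. -/
def herzNorm {d : ℕ} (u : ℝ≥0∞) (s : ℝ) (t : ℝ≥0∞) (F : E d → ℂ) : ℝ≥0∞ :=
  eLpNorm (fun l : ℕ => (2 : ℝ≥0∞) ^ (s * l) * eLpNorm F u (volume.restrict (herzShell d l))) t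
    Measure.count

/-- A smooth cutoff function `φ` with `0 ≤ φ ≤ 1`, `φ = 1` on `{1/2 ≤ |ξ| ≤ 2}` and
support in `{1/4 ≤ |ξ| ≤ 4}`. -/
structure AnnularCutoff (d : ℕ) where
  /-- the cutoff function -/
  fn : E d → ℝ
  contDiff : ContDiff ℝ ((⊤ : ℕ∞) : WithTop ℕ∞) fn
  nonneg : ∀ ξ, 0 ≤ fn ξ
  le_one : ∀ ξ, fn ξ ≤ 1
  eq_one : ∀ ξ, 1 / 2 ≤ ‖ξ‖ → ‖ξ‖ ≤ 2 → fn ξ = 1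
  tsupport_subset : tsupport fn ⊆ {ξ | 1 / 4 ≤ ‖ξ‖ ∧ ‖ξ‖ ≤ 4}

/-- `𝒦_u^{s,t}[m] = sup_k ‖(m(2^k ·) φ)^∨‖_{K_u^{s,t}}`. -/
def herzMultiplierNorm {d : ℕ} (φ : AnnularCutoff d) (u : ℝ≥0∞) (s : ℝ) (t : ℝ≥0∞)
    (m : E d → ℂ) : ℝ≥0∞ :=
  ⨆ k : ℤ, herzNorm u s t (𝓕⁻ (fun ξ : E d => m ((2 : ℝ) ^ k • ξ) * (φ.fn ξ : ℂ)))

/-! ### The multiplier operator on `S'/𝒫` -/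

/-- The kernel `m_k^∨`, where `m_k = m φ(2^{-k} ·)`. -/
def multiplierKernel {d : ℕ} (φ : AnnularCutoff d) (m : E d → ℂ) (k : ℤ) : E d → ℂ :=
  𝓕⁻ (fun ξ : E d => m ξ * (φ.fn ((2 : ℝ) ^ (-k) • ξ) : ℂ))

/-- The function `m_k^∨ * Π_k f`, which is the `k`-th Littlewood-Paley piece of
`T_m f = (m \hat f)^∨`, because `m_k = m` on the support of `\hat{ϕ_k}`. -/
def multiplierPiece {d : ℕ} (φ : AnnularCutoff d) (ϕ : DyadicResolution d) (m : E d → ℂ)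
    (f : TemperedModPoly d) (k : ℤ) : E d → ℂ :=
  multiplierKernel φ m k ⋆[ContinuousLinearMap.mul ℂ ℂ, volume] proj ϕ k f

/-- `g = T_m f` in `S'/𝒫`: the convolutions `m_k^∨ * Π_k f` are defined everywhere, they can be
integrated against the functions in `S_∞`, and `g = ∑_k m_k^∨ * Π_k f`, with (unconditional)
convergence in the duality with `S_∞`. -/
structure IsMultiplierImage {d : ℕ} (φ : AnnularCutoff d) (ϕ : DyadicResolution d) (m : E d → ℂ)
    (f g : TemperedModPoly d) : Prop where
  convolutionExists : ∀ k : ℤ, ConvolutionExists (multiplierKernel φ m k) (proj ϕ k f)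
    (ContinuousLinearMap.mul ℂ ℂ) volume
  integrable : ∀ (k : ℤ) (ψ : SInfty d),
    Integrable (fun x => multiplierPiece φ ϕ m f k x * (ψ : 𝓢(E d, ℂ)) x) volume
  hasSum : ∀ ψ : SInfty d,
    HasSum (fun k : ℤ => ∫ x, multiplierPiece φ ϕ m f k x * (ψ : 𝓢(E d, ℂ)) x) (pairing g ψ)

/-- `T_m h = (m \hat h)^∨` for a Schwartz function `h` and `m ∈ L^∞`, as a tempered distribution:
the inverse Fourier transform of the product of `\hat h` with the bounded function `m`. -/
def schwartzMultiplier {d : ℕ} {m : E d → ℂ} (hm : MemLp m ∞ volume) (h : 𝓢(E d, ℂ)) :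
    𝓢'(E d, ℂ) :=
  𝓕⁻ (TemperedDistribution.smulLeftCLM ℂ ⇑(𝓕 h : 𝓢(E d, ℂ))
    (Lp.toTemperedDistribution (hm.toLp m)))

end BesovMultiplier

end

open MeasureTheory Set
open scoped ENNReal NNReal SchwartzMap FourierTransform Convolution

noncomputable section

namespace BesovMultiplier

/-! Write κ_k = (m(2^k·)φ)^∨ (`unitKernel`) and r = min(1,p); then m_k^∨ is the dilate 2^{kd}
κ_k(2^k·). Everything rests on band limitation. Each κ_k, and each Π_k f after rescaling by 2^{-k},
has its spectrum in a fixed annulus, hence equals its convolution with a Schwartz function Φ whose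
Fourier transform is 1 there (`Reproduces`). Peetre's maximal function argument
(`rpow_le_of_le_lintegral`) turns this into |g(x)|^u ≤ A ∫ |g(z)|^u (1+|x-z|)^{-N} dz for 0 < u ≤ 1:
values are controlled by local averages even for small exponents.

The norm inequality has three ingredients. (a) The Herz norm of κ_k dominates its L^r norm. For u ≤
r the averaging inequality compares different shells with a loss 2^{-|l-j|}, and convolution with
this sequence is bounded on ℓ^{r/u} (`exists_lintegral_rpow_le_tsum_herzShell`). For u > r it is
Hölder on each shell, whose volume produces the weight 2^{ld(1/r-1/u)}
(`exists_eLpNorm_le_herzNorm_of_lt`). (b) For two functions band-limited at the same scale, the L^p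
norm of the convolution is at most a constant times the L^r norm of one and the L^p norm of the
other (`exists_eLpNorm_conv_dil_le`): Young's inequality if p ≥ 1, slow variation of averages if p <
1. (c) By disjointness of spectra, Π_j T_m f only sees the pieces k = j-1, j, j+1
(`IsMultiplierImage.proj_eq`), and ℓ^q is shift invariant.

For existence, Nikolskii's inequality gives |Π_k f| ≤ S 2^{kd/p}. The kernels have uniformly bounded
L^1 norms, so the pieces obey a bound of the same form. Tested against ψ ∈ S_∞, a low-frequency
piece gains 2^k from ∫ψ = 0 and a high-frequency piece gains 2^{-2nk} from dividing by |ξ|^{2n}. The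
sum is thus controlled by a continuous seminorm of ψ, and Hahn-Banach extends it from S_∞ to a
tempered distribution (`exists_hasSum_integral_mul`).

For Schwartz h the claim is termwise integration of the resolution of unity on the Fourier side
(`isMultiplierImage_schwartz`). -/

/-! ### Weighted inequalities for nonnegative functions -/

/-- The weight `1 + |x|`. -/
def wt {d : ℕ} (x : E d) : ℝ≥0∞ := 1 + ‖x‖ₑ

theorem one_le_wt {d : ℕ} (x : E d) : 1 ≤ wt x := le_self_add

@[simp]
theorem wt_zero {d : ℕ} : wt (0 : E d) = 1 := by simp [wt]

theorem wt_ne_zero {d : ℕ} (x : E d) : wt x ≠ 0 := (zero_lt_one.trans_le (one_le_wt x)).ne'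

theorem wt_ne_top {d : ℕ} (x : E d) : wt x ≠ ∞ := by simp [wt]

theorem wt_neg {d : ℕ} (x : E d) : wt (-x) = wt x := by simp [wt]

theorem wt_sub_comm {d : ℕ} (x y : E d) : wt (x - y) = wt (y - x) := by
  rw [← wt_neg, neg_sub]

theorem wt_add_le {d : ℕ} (x y : E d) : wt (x + y) ≤ wt x * wt y := by
  calc wt (x + y) ≤ 1 + (‖x‖ₑ + ‖y‖ₑ) := by unfold wt; gcongr; exact enorm_add_le x y
    _ ≤ 1 + (‖x‖ₑ + ‖y‖ₑ) + ‖x‖ₑ * ‖y‖ₑ := le_self_add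
    _ = wt x * wt y := by unfold wt; ring

theorem wt_sub_le {d : ℕ} (x y z : E d) : wt (x - z) ≤ wt (x - y) * wt (y - z) := by
  simpa using wt_add_le (x - y) (y - z)

theorem wt_le_mul_sub {d : ℕ} (x y : E d) : wt y ≤ wt x * wt (x - y) := by
  simpa [wt_sub_comm x y] using wt_add_le x (y - x)

theorem measurable_wt {d : ℕ} : Measurable (wt (d := d)) := by unfold wt; fun_prop

theorem wt_rpow_mul_rpow_neg {d : ℕ} (x : E d) (a : ℝ) : wt x ^ a * wt x ^ (-a) = 1 := by
  rw [← ENNReal.rpow_add _ _ (wt_ne_zero x) (wt_ne_top x), add_neg_cancel, ENNReal.rpow_zero]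

theorem wt_rpow_neg_le_one {d : ℕ} (x : E d) {a : ℝ} (ha : 0 ≤ a) : wt x ^ (-a) ≤ 1 := by
  rw [ENNReal.rpow_neg]
  exact ENNReal.inv_le_one.2 (by simpa using ENNReal.rpow_le_rpow (one_le_wt x) ha)

theorem wt_rpow_neg_sub_le {d : ℕ} (x y z : E d) {a : ℝ} (ha : 0 ≤ a) :
    wt (y - z) ^ (-a) ≤ wt (x - z) ^ (-a) * wt (x - y) ^ a := by
  have h := ENNReal.rpow_le_rpow (wt_sub_le x y z) ha
  rw [ENNReal.mul_rpow_of_nonneg _ _ ha] at h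
  calc wt (y - z) ^ (-a)
      = (wt (x - z) ^ a * wt (x - z) ^ (-a)) * wt (y - z) ^ (-a) := by
        rw [wt_rpow_mul_rpow_neg, one_mul]
    _ ≤ (wt (x - y) ^ a * wt (y - z) ^ a * wt (x - z) ^ (-a)) * wt (y - z) ^ (-a) := by gcongr
    _ = (wt (y - z) ^ a * wt (y - z) ^ (-a)) * (wt (x - z) ^ (-a) * wt (x - y) ^ a) := by ring
    _ = _ := by rw [wt_rpow_mul_rpow_neg, one_mul]

theorem ofReal_one_add_norm {d : ℕ} (x : E d) : ENNReal.ofReal (1 + ‖x‖) = wt x := by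
  rw [ENNReal.ofReal_add zero_le_one (norm_nonneg x), ENNReal.ofReal_one, ofReal_norm, wt]

theorem lintegral_wt_ne_top {d : ℕ} {N : ℝ} (hN : (d : ℝ) < N) :
    ∫⁻ x : E d, wt x ^ (-N) ≠ ∞ := by
  have h : Integrable (fun x : E d => (1 + ‖x‖) ^ (-N)) volume :=
    integrable_one_add_norm (by simpa using hN)
  convert h.lintegral_lt_top.ne with x
  rw [← ENNReal.ofReal_rpow_of_pos (by positivity), ofReal_one_add_norm]

theorem lintegral_wt_sub_left {d : ℕ} (N : ℝ) (x : E d) :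
    ∫⁻ z : E d, wt (x - z) ^ (-N) = ∫⁻ z : E d, wt z ^ (-N) :=
  lintegral_sub_left_eq_self (fun z : E d => wt z ^ (-N)) x

/-- Jensen's inequality with respect to a weight. -/
theorem lintegral_mul_rpow_le {α : Type*} [MeasurableSpace α] {μ : Measure α} {f w : α → ℝ≥0∞}
    (hf : AEMeasurable f μ) (hw : AEMeasurable w μ) {p : ℝ} (hp : 1 ≤ p) :
    (∫⁻ x, f x * w x ∂μ) ^ p ≤ (∫⁻ x, w x ∂μ) ^ (p - 1) * ∫⁻ x, f x ^ p * w x ∂μ := by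
  rcases hp.eq_or_lt with rfl | hp1
  · simp
  have hp0 : 0 < p := zero_lt_one.trans hp1
  have hq := Real.HolderConjugate.conjExponent hp1
  set q := p.conjExponent with hqdef
  have hq0 : 0 < q := hq.symm.pos
  have hpq : 1 / p + 1 / q = 1 := by simpa using hq.inv_add_inv_eq_one
  -- Hölder is applied with w = w^{1/p} w^{1/q}, the first factor being attached to f.
  have hsplit : ∀ x, f x * w x = ((fun x => f x * w x ^ (1 / p)) * fun x => w x ^ (1 / q)) x := by
    intro x
    simp only [Pi.mul_apply]
    rw [mul_assoc, ← ENNReal.rpow_add_of_nonneg _ _ (by positivity) (by positivity), hpq,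
      ENNReal.rpow_one]
  have hH := ENNReal.lintegral_mul_le_Lp_mul_Lq μ hq (f := fun x => f x * w x ^ (1 / p))
    (g := fun x => w x ^ (1 / q)) (by fun_prop) (by fun_prop)
  rw [lintegral_congr hsplit]
  refine (ENNReal.rpow_le_rpow hH hp0.le).trans ?_
  rw [ENNReal.mul_rpow_of_nonneg _ _ hp0.le, ← ENNReal.rpow_mul, ← ENNReal.rpow_mul,
    one_div_mul_cancel hp0.ne', ENNReal.rpow_one, mul_comm]
  have e1 : 1 / q * p = p - 1 := by
    have : 1 / q = 1 - 1 / p := by linarith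
    rw [this]
    field_simp
  rw [e1]
  refine mul_le_mul' (le_of_eq ?_) (le_of_eq ?_)
  · congr 1
    refine lintegral_congr fun x => ?_
    rw [← ENNReal.rpow_mul, one_div_mul_cancel hq0.ne', ENNReal.rpow_one]
  · refine lintegral_congr fun x => ?_
    rw [ENNReal.mul_rpow_of_nonneg _ _ hp0.le, ← ENNReal.rpow_mul, one_div_mul_cancel hp0.ne',
      ENNReal.rpow_one]

/-! ### Convolution inequalities, with large and small exponents. -/

theorem lintegral_lintegral_mul_sub {d : ℕ} {k g : E d → ℝ≥0∞} (hk : Measurable k)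
    (hg : Measurable g) :
    ∫⁻ x, ∫⁻ y, k (x - y) * g y = (∫⁻ x, k x) * ∫⁻ y, g y := by
  rw [lintegral_lintegral_swap (by fun_prop)]
  have : ∀ y, ∫⁻ x, k (x - y) * g y = (∫⁻ x, k x) * g y := by
    intro y
    rw [lintegral_mul_const _ (by fun_prop), lintegral_sub_right_eq_self]
  simp_rw [this]
  rw [lintegral_const_mul _ hg]

/-- Young's inequality for convolution with an integrable function. -/
theorem lintegral_lconv_rpow_le_of_one_le {d : ℕ} {k g : E d → ℝ≥0∞} (hk : Measurable k)
    (hg : Measurable g) {p : ℝ} (hp : 1 ≤ p) :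
    ∫⁻ x, (∫⁻ y, k (x - y) * g y) ^ p ≤ (∫⁻ x, k x) ^ p * ∫⁻ y, g y ^ p := by
  calc ∫⁻ x, (∫⁻ y, k (x - y) * g y) ^ p
      ≤ ∫⁻ x, (∫⁻ y, k y) ^ (p - 1) * ∫⁻ y, k (x - y) * g y ^ p := by
        refine lintegral_mono fun x => ?_
        have := lintegral_mul_rpow_le (μ := (volume : Measure (E d))) (f := g)
          (w := fun y => k (x - y)) (by fun_prop) (by fun_prop) hp
        rw [lintegral_sub_left_eq_self] at this
        simpa only [mul_comm] using this
    _ = (∫⁻ y, k y) ^ (p - 1) * ((∫⁻ x, k x) * ∫⁻ y, g y ^ p) := by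
        rw [lintegral_const_mul _ (Measurable.lintegral_prod_right'
          (f := fun q : E d × E d => k (q.1 - q.2) * g q.2 ^ p) (by fun_prop)),
          lintegral_lintegral_mul_sub (g := fun y => g y ^ p) hk (by fun_prop)]
    _ = _ := by
        rw [← mul_assoc]
        congr 1
        nth_rewrite 2 [← ENNReal.rpow_one (∫⁻ y, k y)]
        rw [← ENNReal.rpow_add_of_nonneg _ _ (by linarith) zero_le_one, sub_add_cancel]

/-- A function of moderate growth that is dominated by its convolution with a decaying kernel
satisfies the corresponding inequality for its small powers. -/
theorem rpow_le_of_le_lintegral {d : ℕ} {f : E d → ℝ≥0∞} (hf : Measurable f) {A B : ℝ≥0∞}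
    (hB : B ≠ ∞) {a u : ℝ} (ha : 0 ≤ a) (hu : 0 < u) (hu1 : u ≤ 1)
    (h : ∀ x, f x ≤ ∫⁻ z, f z * (A * wt (x - z) ^ (-a))) (hgrowth : ∀ x, f x ≤ B * wt x ^ a)
    (x : E d) : f x ^ u ≤ A * ∫⁻ z, f z ^ u * wt (x - z) ^ (-(a * u)) := by
  -- M is Peetre's maximal function of f at x.
  set M : ℝ≥0∞ := ⨆ y, f y * wt (x - y) ^ (-a) with hM
  have hle : ∀ y, f y ≤ M * wt (x - y) ^ a := by
    intro y
    have h1 : f y * wt (x - y) ^ (-a) ≤ M := le_iSup (fun y => f y * wt (x - y) ^ (-a)) y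
    calc f y = f y * wt (x - y) ^ (-a) * wt (x - y) ^ a := by
          rw [mul_assoc, mul_comm (wt _ ^ (-a)), wt_rpow_mul_rpow_neg, mul_one]
      _ ≤ _ := by gcongr
  -- The growth bound serves only to make M finite; B does not enter the final estimate.
  have hMtop : M ≠ ∞ := by
    refine ne_top_of_le_ne_top (b := B * wt x ^ a)
      (ENNReal.mul_ne_top hB (ENNReal.rpow_ne_top_of_nonneg ha (wt_ne_top x))) ?_
    refine iSup_le fun y => ?_
    calc f y * wt (x - y) ^ (-a) ≤ B * (wt x * wt (x - y)) ^ a * wt (x - y) ^ (-a) := by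
          gcongr
          refine (hgrowth y).trans ?_
          gcongr
          exact wt_le_mul_sub x y
      _ = B * wt x ^ a := by
          rw [ENNReal.mul_rpow_of_nonneg _ _ ha, ← mul_assoc, mul_assoc,
            wt_rpow_mul_rpow_neg, mul_one]
  set W := ∫⁻ z, f z ^ u * wt (x - z) ^ (-(a * u)) with hW
  have hfx : f x ≤ M := by simpa using hle x
  -- Inside the integral f = f^u f^{1-u}, and f^{1-u} is bounded through M. Since M is finite, a
  -- factor M^{1-u} can be cancelled at the end (the case M = 0 being trivial), which leaves M^u ≤ A
  -- W.
  have hkey : M ≤ A * W * M ^ (1 - u) := by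
    refine iSup_le fun y => ?_
    calc f y * wt (x - y) ^ (-a)
        ≤ (∫⁻ z, f z * (A * wt (y - z) ^ (-a))) * wt (x - y) ^ (-a) := by gcongr; exact h y
      _ = ∫⁻ z, f z * (A * wt (y - z) ^ (-a)) * wt (x - y) ^ (-a) := by
          rw [lintegral_mul_const]
          have := measurable_wt (d := d)
          fun_prop
      _ ≤ ∫⁻ z, A * M ^ (1 - u) * (f z ^ u * wt (x - z) ^ (-(a * u))) := by
          refine lintegral_mono fun z => ?_
          have e1 : f z = f z ^ u * f z ^ (1 - u) := by
            rw [← ENNReal.rpow_add_of_nonneg _ _ hu.le (by linarith), add_sub_cancel,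
              ENNReal.rpow_one]
          have e2 : f z ^ (1 - u) ≤ M ^ (1 - u) * wt (x - z) ^ (a * (1 - u)) := by
            rw [ENNReal.rpow_mul, ← ENNReal.mul_rpow_of_nonneg _ _ (by linarith)]
            exact ENNReal.rpow_le_rpow (hle z) (by linarith)
          have e3 : wt (y - z) ^ (-a) * wt (x - y) ^ (-a) ≤ wt (x - z) ^ (-a) := by
            calc wt (y - z) ^ (-a) * wt (x - y) ^ (-a)
                ≤ wt (x - z) ^ (-a) * wt (x - y) ^ a * wt (x - y) ^ (-a) := by
                  gcongr; exact wt_rpow_neg_sub_le x y z ha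
              _ = _ := by rw [mul_assoc, wt_rpow_mul_rpow_neg, mul_one]
          calc f z * (A * wt (y - z) ^ (-a)) * wt (x - y) ^ (-a)
              = f z ^ u * f z ^ (1 - u) * A * (wt (y - z) ^ (-a) * wt (x - y) ^ (-a)) := by
                rw [← e1]; ring
            _ ≤ f z ^ u * (M ^ (1 - u) * wt (x - z) ^ (a * (1 - u))) * A *
                  wt (x - z) ^ (-a) := by gcongr
            _ = A * M ^ (1 - u) *
                  (f z ^ u * (wt (x - z) ^ (a * (1 - u)) * wt (x - z) ^ (-a))) := by ring
            _ = _ := by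
                rw [← ENNReal.rpow_add _ _ (wt_ne_zero _) (wt_ne_top _)]
                congr 4
                ring
      _ = A * W * M ^ (1 - u) := by
          rw [lintegral_const_mul]
          · ring
          · have := measurable_wt (d := d)
            fun_prop
  rcases eq_or_ne M 0 with h0 | h0
  · have : f x = 0 := by simpa [h0] using hfx
    rw [this, ENNReal.zero_rpow_of_pos hu]
    exact zero_le
  have h1 : M ^ (1 - u) ≠ 0 := by simp [ENNReal.rpow_eq_zero_iff, h0, hMtop]
  have h2 : M ^ (1 - u) ≠ ∞ := ENNReal.rpow_ne_top_of_nonneg (by linarith) hMtop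
  refine (ENNReal.rpow_le_rpow hfx hu.le).trans ?_
  have h3 : M ^ u * M ^ (1 - u) ≤ A * W * M ^ (1 - u) := by
    rw [← ENNReal.rpow_add_of_nonneg _ _ hu.le (by linarith), add_sub_cancel, ENNReal.rpow_one]
    exact hkey
  exact (ENNReal.mul_le_mul_iff_left h1 h2).1 h3

/-- Convolution inequality in `L^p`, `p < 1`, for functions whose `p`-th powers are controlled by
their local averages. -/
theorem exists_lintegral_lconv_rpow_le {d : ℕ} {p N : ℝ} (hp : 0 < p) (hp1 : p ≤ 1)
    (hN : (d : ℝ) < N) {A : ℝ≥0∞} (hA : A ≠ ∞) :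
    ∃ C : ℝ≥0∞, C ≠ ∞ ∧ ∀ k g : E d → ℝ≥0∞, Measurable k → Measurable g →
      (∀ x, k x ^ p ≤ A * ∫⁻ z, k z ^ p * wt (x - z) ^ (-N)) →
      (∀ x, g x ^ p ≤ A * ∫⁻ z, g z ^ p * wt (x - z) ^ (-N)) →
      ∫⁻ x, (∫⁻ y, k (x - y) * g y) ^ p ≤ C * (∫⁻ x, k x ^ p) * ∫⁻ x, g x ^ p := by
  have hN0 : 0 ≤ N := (Nat.cast_nonneg d).trans hN.le
  have hwt := measurable_wt (d := d)
  set c : ℝ≥0∞ := ∫⁻ z : E d, wt z ^ (-N) with hc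
  have hctop : c ≠ ∞ := lintegral_wt_ne_top hN
  set b : ℝ≥0∞ := volume (Metric.ball (0 : E d) 1) with hb
  have hb0 : b ≠ 0 := (Metric.measure_ball_pos volume _ one_pos).ne'
  have hbtop : b ≠ ∞ := measure_ball_lt_top.ne
  -- One factor 2^N for each of the two averages when its centre moves by less than 1, divided by
  -- the volume of the unit ball over which the mean is taken.
  set D : ℝ≥0∞ := (2 ^ N * 2 ^ N) / b with hD
  have hDtop : D ≠ ∞ := ENNReal.div_ne_top
    (ENNReal.mul_ne_top (by simp) (by simp)) hb0
  refine ⟨(A * A * D) ^ (1 - p) * (A * A) ^ p * (c * c), ?_, ?_⟩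
  · refine ENNReal.mul_ne_top (ENNReal.mul_ne_top ?_ ?_) (ENNReal.mul_ne_top hctop hctop)
    · exact ENNReal.rpow_ne_top_of_nonneg (by linarith)
        (ENNReal.mul_ne_top (ENNReal.mul_ne_top hA hA) hDtop)
    · exact ENNReal.rpow_ne_top_of_nonneg hp.le (ENNReal.mul_ne_top hA hA)
  intro k g hk hg hkA hgA
  set W : (E d → ℝ≥0∞) → E d → ℝ≥0∞ := fun f x => ∫⁻ z, f z ^ p * wt (x - z) ^ (-N) with hW
  have hWmeas : ∀ f : E d → ℝ≥0∞, Measurable f → Measurable (W f) := by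
    intro f hf
    exact Measurable.lintegral_prod_right' (f := fun q : E d × E d =>
      f q.2 ^ p * wt (q.1 - q.2) ^ (-N)) (by fun_prop)
  have hWint : ∀ f : E d → ℝ≥0∞, Measurable f → ∫⁻ x, W f x = c * ∫⁻ x, f x ^ p := by
    intro f hf
    simp only [hW]
    simp_rw [mul_comm (f _ ^ p)]
    exact lintegral_lintegral_mul_sub (k := fun z => wt z ^ (-N)) (g := fun z => f z ^ p)
      (by fun_prop) (by fun_prop)
  -- Averages vary slowly, so the product V of two of them is bounded pointwise by a multiple of its
  -- own integral. This replaces the missing embedding of L^p into L^1 for p < 1.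
  have hWnear : ∀ (f : E d → ℝ≥0∞), Measurable f → ∀ x y, ‖x - y‖ < 1 →
      W f x ≤ 2 ^ N * W f y := by
    intro f hf x y hxy
    simp only [hW]
    rw [← lintegral_const_mul _ (by fun_prop)]
    refine lintegral_mono fun z => ?_
    have h2 : wt (y - x) ≤ 2 := by
      have : ‖y - x‖ₑ ≤ 1 := by
        rw [← ofReal_norm, norm_sub_rev]
        exact ENNReal.ofReal_le_one.2 hxy.le
      unfold wt
      calc 1 + ‖y - x‖ₑ ≤ 1 + 1 := by gcongr
        _ = 2 := one_add_one_eq_two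
    calc f z ^ p * wt (x - z) ^ (-N)
        ≤ f z ^ p * (wt (y - z) ^ (-N) * wt (y - x) ^ N) := by
          gcongr; exact wt_rpow_neg_sub_le y x z hN0
      _ ≤ f z ^ p * (wt (y - z) ^ (-N) * 2 ^ N) := by gcongr
      _ = _ := by ring
  have hpt : ∀ x, (∫⁻ y, k (x - y) * g y) ^ p ≤
      (A * A * D) ^ (1 - p) * (A * A) ^ p * ∫⁻ y, W k (x - y) * W g y := by
    intro x
    set V : E d → ℝ≥0∞ := fun y => W k (x - y) * W g y with hV
    have hVmeas : Measurable V := by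
      have := hWmeas k hk
      have := hWmeas g hg
      fun_prop
    set S := ∫⁻ y, V y with hS
    have hVS : ∀ y, V y ≤ D * S := by
      intro y
      have h1 : V y * b ≤ (2 ^ N * 2 ^ N) * S := by
        calc V y * b = ∫⁻ _ in Metric.ball y 1, V y := by
              rw [setLIntegral_const, hb, Measure.addHaar_ball_center volume y]
          _ ≤ ∫⁻ z in Metric.ball y 1, 2 ^ N * 2 ^ N * V z := by
              refine setLIntegral_mono (by fun_prop) fun z hz => ?_
              have hz' : ‖z - y‖ < 1 := by simpa [dist_eq_norm] using hz
              have e1 := hWnear k hk (x - y) (x - z) (by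
                rwa [show x - y - (x - z) = z - y by abel])
              have e2 := hWnear g hg y z (by rwa [norm_sub_rev])
              calc V y ≤ (2 ^ N * W k (x - z)) * (2 ^ N * W g z) := mul_le_mul' e1 e2
                _ = _ := by simp only [hV]; ring
          _ ≤ ∫⁻ z, 2 ^ N * 2 ^ N * V z := setLIntegral_le_lintegral _ _
          _ = _ := lintegral_const_mul _ hVmeas
      calc V y ≤ (2 ^ N * 2 ^ N * S) / b := (ENNReal.le_div_iff_mul_le (.inl hb0) (.inl hbtop)).2 h1
        _ = D * S := by rw [hD, ENNReal.div_eq_inv_mul, ENNReal.div_eq_inv_mul]; ring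
    set h : E d → ℝ≥0∞ := fun y => k (x - y) * g y with hh
    have hhV : ∀ y, h y ^ p ≤ A * A * V y := by
      intro y
      calc h y ^ p = k (x - y) ^ p * g y ^ p := ENNReal.mul_rpow_of_nonneg _ _ hp.le
        _ ≤ (A * W k (x - y)) * (A * W g y) := mul_le_mul' (hkA _) (hgA _)
        _ = _ := by simp only [hV]; ring
    -- Here h = (h^p)^{(1-p)/p} h^p: the first factor is bounded by the supremum of V, the second is
    -- integrated. After taking the p-th power the two contributions of S combine to S^{1-p} S^p =
    -- S.
    have hint : ∫⁻ y, h y ≤ (A * A * D * S) ^ ((1 - p) / p) * (A * A * S) := by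
      calc ∫⁻ y, h y ≤ ∫⁻ y, (A * A * D * S) ^ ((1 - p) / p) * (A * A * V y) := by
            refine lintegral_mono fun y => ?_
            have e1 : h y = (h y ^ p) ^ ((1 - p) / p) * h y ^ p := by
              rw [← ENNReal.rpow_mul, ← ENNReal.rpow_add_of_nonneg _ _ _ hp.le]
              · rw [mul_div_cancel₀ _ hp.ne', sub_add_cancel, ENNReal.rpow_one]
              · rw [mul_div_cancel₀ _ hp.ne']; linarith
            rw [e1]
            have hexp : 0 ≤ (1 - p) / p := div_nonneg (by linarith) hp.le
            refine mul_le_mul' (ENNReal.rpow_le_rpow ((hhV y).trans ?_) hexp) (hhV y)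
            calc A * A * V y ≤ A * A * (D * S) := by gcongr; exact hVS y
              _ = _ := by ring
        _ = _ := by
            rw [lintegral_const_mul _ (by fun_prop), lintegral_const_mul _ hVmeas]
    calc (∫⁻ y, h y) ^ p ≤ ((A * A * D * S) ^ ((1 - p) / p) * (A * A * S)) ^ p :=
          ENNReal.rpow_le_rpow hint hp.le
      _ = (A * A * D * S) ^ (1 - p) * (A * A * S) ^ p := by
          rw [ENNReal.mul_rpow_of_nonneg _ _ hp.le, ← ENNReal.rpow_mul, div_mul_cancel₀ _ hp.ne']
      _ = (A * A * D) ^ (1 - p) * (A * A) ^ p * (S ^ (1 - p) * S ^ p) := by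
          rw [ENNReal.mul_rpow_of_nonneg _ _ (by linarith : 0 ≤ 1 - p),
            ENNReal.mul_rpow_of_nonneg _ S hp.le]
          ring
      _ = _ := by
          rw [← ENNReal.rpow_add_of_nonneg _ _ (by linarith) hp.le, sub_add_cancel,
            ENNReal.rpow_one]
  calc ∫⁻ x, (∫⁻ y, k (x - y) * g y) ^ p
      ≤ ∫⁻ x, (A * A * D) ^ (1 - p) * (A * A) ^ p * ∫⁻ y, W k (x - y) * W g y :=
        lintegral_mono hpt
    _ = (A * A * D) ^ (1 - p) * (A * A) ^ p * ((c * ∫⁻ x, k x ^ p) * (c * ∫⁻ x, g x ^ p)) := by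
        have hk' := hWmeas k hk
        have hg' := hWmeas g hg
        rw [lintegral_const_mul _ (Measurable.lintegral_prod_right'
          (f := fun q : E d × E d => W k (q.1 - q.2) * W g q.2) (by fun_prop)),
          lintegral_lintegral_mul_sub hk' hg', hWint k hk, hWint g hg]
    _ = _ := by ring

/-! ### Herz norms dominate Lebesgue norms -/

theorem iUnion_herzShell (d : ℕ) : ⋃ l, herzShell d l = univ := by
  refine eq_univ_of_forall fun x => ?_
  rw [mem_iUnion]
  rcases le_or_gt ‖x‖ 2 with h | h
  · exact ⟨0, by simpa [herzShell] using h⟩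
  have hex : ∃ n : ℕ, ‖x‖ ≤ 2 ^ n :=
    (pow_unbounded_of_one_lt ‖x‖ one_lt_two).imp fun _ hn => hn.le
  classical
  set n := Nat.find hex with hn
  have h1 : ‖x‖ ≤ 2 ^ n := Nat.find_spec hex
  have h2 : 2 ≤ n := by
    by_contra hcon
    have : n ≤ 1 := by omega
    have : (2 : ℝ) ^ n ≤ 2 ^ 1 := pow_le_pow_right₀ one_le_two this
    linarith
  have h3 : ¬ ‖x‖ ≤ 2 ^ (n - 1) := Nat.find_min hex (by omega)
  refine ⟨n - 1, ?_⟩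
  have h4 : n - 1 ≠ 0 := by omega
  rw [herzShell, if_neg h4]
  exact ⟨not_le.1 h3, by rwa [Nat.sub_add_cancel (by omega)]⟩

theorem wt_le_of_mem_herzShell {d l : ℕ} {x : E d} (hx : x ∈ herzShell d l) :
    wt x ≤ 4 * 2 ^ l := by
  rw [← ofReal_one_add_norm]
  have h : 1 + ‖x‖ ≤ 4 * 2 ^ l := by
    unfold herzShell at hx
    split_ifs at hx with h0
    · subst h0
      have : ‖x‖ ≤ 2 := hx
      norm_num
      linarith
    · have h1 : ‖x‖ ≤ 2 ^ (l + 1) := hx.2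
      have h2 : (1 : ℝ) ≤ 2 ^ l := one_le_pow₀ one_le_two
      rw [pow_succ] at h1
      linarith
  refine (ENNReal.ofReal_le_ofReal h).trans (le_of_eq ?_)
  rw [ENNReal.ofReal_mul (by norm_num), ENNReal.ofReal_pow (by norm_num)]
  norm_num

theorem le_wt_of_mem_herzShell {d l : ℕ} {x : E d} (hx : x ∈ herzShell d l) :
    2 ^ l ≤ wt x := by
  rw [← ofReal_one_add_norm]
  have h : (2 : ℝ) ^ l ≤ 1 + ‖x‖ := by
    unfold herzShell at hx
    split_ifs at hx with h0
    · subst h0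
      simp
    · have h1 : (2 : ℝ) ^ l < ‖x‖ := hx.1
      linarith
  refine le_trans (le_of_eq ?_) (ENNReal.ofReal_le_ofReal h)
  rw [ENNReal.ofReal_pow (by norm_num)]
  norm_num

/-- The weight is submultiplicative and comparable to 2^l on the l-th shell, so for j ≤ l one has
2^l ≤ wt x ≤ wt y · wt (x - y) ≤ 4 · 2^j · wt (x - y). -/
theorem inv_wt_sub_le {d l j : ℕ} {x y : E d} (hx : x ∈ herzShell d l) (hy : y ∈ herzShell d j) :
    (wt (x - y))⁻¹ ≤ 4 * 2⁻¹ ^ ((l : ℤ) - j).natAbs := by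
  have key : ∀ {l j : ℕ} {x y : E d}, x ∈ herzShell d l → y ∈ herzShell d j → j ≤ l →
      (wt (x - y))⁻¹ ≤ 4 * 2⁻¹ ^ (l - j) := by
    intro l j x y hx hy hjl
    have h1 : (2 : ℝ≥0∞) ^ j * 2 ^ (l - j) ≤ 2 ^ j * (4 * wt (x - y)) := by
      rw [← pow_add, Nat.add_sub_cancel' hjl]
      calc (2 : ℝ≥0∞) ^ l ≤ wt x := le_wt_of_mem_herzShell hx
        _ ≤ wt y * wt (y - x) := wt_le_mul_sub y x
        _ ≤ 4 * 2 ^ j * wt (x - y) := by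
          rw [wt_sub_comm]; gcongr; exact wt_le_of_mem_herzShell hy
        _ = _ := by ring
    have h2 : (2 : ℝ≥0∞) ^ (l - j) ≤ 4 * wt (x - y) :=
      (ENNReal.mul_le_mul_iff_right (by simp) (by simp)).1 h1
    rw [ENNReal.inv_le_iff_inv_le, ENNReal.mul_inv (by simp) (by simp), ENNReal.inv_pow, inv_inv]
    rw [ENNReal.inv_mul_le_iff (by simp) (by simp)]
    exact h2
  rcases le_total j l with h | h
  · have e : ((l : ℤ) - j).natAbs = l - j := by omega
    rw [e]
    exact key hx hy h
  · have e : ((l : ℤ) - j).natAbs = j - l := by omega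
    rw [e, wt_sub_comm]
    exact key hy hx h

theorem tsum_int_inv_two_pow_ne_top : ∑' n : ℤ, (2⁻¹ : ℝ≥0∞) ^ n.natAbs ≠ ∞ := by
  have h : Summable fun n : ℤ => (2⁻¹ : ℝ≥0) ^ n.natAbs := by
    rw [← NNReal.summable_coe]
    have : Summable fun n : ℕ => (2⁻¹ : ℝ) ^ n :=
      summable_geometric_of_lt_one (by norm_num) (by norm_num)
    refine Summable.of_nat_of_neg ?_ ?_ <;> simpa using this
  have := ENNReal.tsum_coe_ne_top_iff_summable.2 h
  simpa only [ENNReal.coe_pow, ENNReal.coe_inv_two] using this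

theorem lintegral_le_tsum_herzShell {d : ℕ} (f : E d → ℝ≥0∞) :
    ∫⁻ x, f x ≤ ∑' l, ∫⁻ x in herzShell d l, f x := by
  rw [← setLIntegral_univ, ← iUnion_herzShell d]
  exact lintegral_iUnion_le _ _

/-- Put s = r/u and let a_j be the integral of k^u over shell j. The averaging hypothesis gives k^u
≤ 4A b_l on shell l, where b_l = Σ_j 2^{-|l-j|} a_j; decay of order N ≥ 1 is enough for this.
Writing k^r = (k^u)^{s-1} k^u gives ∫_{B_l} k^r ≤ (4A)^{s-1} b_l^s, and convolution with the
summable sequence 2^{-|n|} is bounded on ℓ^s. -/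
theorem exists_lintegral_rpow_le_tsum_herzShell {d : ℕ} {u r N : ℝ} (hu : 0 < u) (hur : u ≤ r)
    (hN : 1 ≤ N) {A : ℝ≥0∞} (hA : A ≠ ∞) :
    ∃ C : ℝ≥0∞, C ≠ ∞ ∧ ∀ k : E d → ℝ≥0∞, Measurable k →
      (∀ x, k x ^ u ≤ A * ∫⁻ z, k z ^ u * wt (x - z) ^ (-N)) →
      ∫⁻ x, k x ^ r ≤ C * ∑' l, (∫⁻ x in herzShell d l, k x ^ u) ^ (r / u) := by
  set s := r / u with hs
  have hs1 : 1 ≤ s := (one_le_div hu).2 hur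
  set c : ℕ → ℕ → ℝ≥0∞ := fun l j => 2⁻¹ ^ ((l : ℤ) - j).natAbs with hc
  set c0 : ℝ≥0∞ := ∑' n : ℤ, (2⁻¹ : ℝ≥0∞) ^ n.natAbs with hc0
  have hc0top : c0 ≠ ∞ := tsum_int_inv_two_pow_ne_top
  have hcl : ∀ l, ∑' j, c l j ≤ c0 := fun l =>
    ENNReal.tsum_comp_le_tsum_of_injective (f := fun j : ℕ => (l : ℤ) - j)
      (fun a b h => by simpa using h) (fun n : ℤ => (2⁻¹ : ℝ≥0∞) ^ n.natAbs)
  have hcj : ∀ j, ∑' l, c l j ≤ c0 := fun j =>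
    ENNReal.tsum_comp_le_tsum_of_injective (f := fun l : ℕ => (l : ℤ) - j)
      (fun a b h => by simpa using h) (fun n : ℤ => (2⁻¹ : ℝ≥0∞) ^ n.natAbs)
  -- The first factor comes from (k^u)^{s-1}; then c0^{s-1} comes from Jensen in j, and the last c0
  -- from summing the kernel over l.
  refine ⟨(A * 4) ^ (s - 1) * (c0 ^ (s - 1) * c0), ?_, ?_⟩
  · refine ENNReal.mul_ne_top ?_ (ENNReal.mul_ne_top ?_ hc0top)
    · exact ENNReal.rpow_ne_top_of_nonneg (by linarith) (ENNReal.mul_ne_top hA (by simp))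
    · exact ENNReal.rpow_ne_top_of_nonneg (by linarith) hc0top
  intro k hk hkA
  set a : ℕ → ℝ≥0∞ := fun l => ∫⁻ x in herzShell d l, k x ^ u with ha
  set b : ℕ → ℝ≥0∞ := fun l => ∑' j, a j * c l j with hb
  have hab : ∀ l, a l ≤ b l := by
    intro l
    have : a l * c l l ≤ b l := ENNReal.le_tsum l
    simpa [hc] using this
  have hpt : ∀ l, ∀ x ∈ herzShell d l, k x ^ u ≤ A * 4 * b l := by
    intro l x hx
    refine (hkA x).trans ?_
    rw [mul_assoc]
    gcongr
    refine (lintegral_le_tsum_herzShell _).trans ?_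
    rw [hb, ← ENNReal.tsum_mul_left]
    refine ENNReal.tsum_le_tsum fun j => ?_
    calc ∫⁻ z in herzShell d j, k z ^ u * wt (x - z) ^ (-N)
        ≤ ∫⁻ z in herzShell d j, k z ^ u * (4 * c l j) := by
          refine setLIntegral_mono (by fun_prop) fun z hz => ?_
          gcongr
          calc wt (x - z) ^ (-N) ≤ wt (x - z) ^ (-1 : ℝ) :=
                ENNReal.rpow_le_rpow_of_exponent_le (one_le_wt _) (by linarith)
            _ = (wt (x - z))⁻¹ := ENNReal.rpow_neg_one _
            _ ≤ _ := inv_wt_sub_le hx hz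
      _ = _ := by rw [lintegral_mul_const _ (by fun_prop)]; ring
  have hshell : ∀ l, ∫⁻ x in herzShell d l, k x ^ r ≤ (A * 4) ^ (s - 1) * b l ^ s := by
    intro l
    calc ∫⁻ x in herzShell d l, k x ^ r
        ≤ ∫⁻ x in herzShell d l, (A * 4 * b l) ^ (s - 1) * k x ^ u := by
          refine setLIntegral_mono (by fun_prop) fun x hx => ?_
          have e : k x ^ r = (k x ^ u) ^ (s - 1) * k x ^ u := by
            rw [← ENNReal.rpow_mul, ← ENNReal.rpow_add_of_nonneg _ _ _ hu.le]
            · congr 1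
              rw [hs]
              field_simp
              ring
            · exact mul_nonneg hu.le (by linarith)
          rw [e]
          gcongr
          exact hpt l x hx
      _ = (A * 4 * b l) ^ (s - 1) * a l := lintegral_const_mul _ (by fun_prop)
      _ ≤ (A * 4 * b l) ^ (s - 1) * b l := by gcongr; exact hab l
      _ = (A * 4) ^ (s - 1) * b l ^ s := by
          rw [ENNReal.mul_rpow_of_nonneg _ _ (by linarith : 0 ≤ s - 1), mul_assoc]
          congr 1
          nth_rewrite 2 [← ENNReal.rpow_one (b l)]
          rw [← ENNReal.rpow_add_of_nonneg _ _ (by linarith) zero_le_one, sub_add_cancel]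
  calc ∫⁻ x, k x ^ r ≤ ∑' l, ∫⁻ x in herzShell d l, k x ^ r := lintegral_le_tsum_herzShell _
    _ ≤ ∑' l, (A * 4) ^ (s - 1) * (c0 ^ (s - 1) * ∑' j, a j ^ s * c l j) := by
        refine ENNReal.tsum_le_tsum fun l => (hshell l).trans ?_
        gcongr
        have h := lintegral_mul_rpow_le (μ := (Measure.count : Measure ℕ)) (f := a) (w := c l)
          (by fun_prop) (by fun_prop) hs1
        simp only [lintegral_count] at h
        refine h.trans ?_
        gcongr
        exact hcl l
    _ = (A * 4) ^ (s - 1) * (c0 ^ (s - 1) * ∑' j, a j ^ s * ∑' l, c l j) := by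
        rw [ENNReal.tsum_mul_left, ENNReal.tsum_mul_left, ENNReal.tsum_comm]
        simp_rw [ENNReal.tsum_mul_left]
    _ ≤ (A * 4) ^ (s - 1) * (c0 ^ (s - 1) * ∑' j, a j ^ s * c0) := by
        gcongr with j
        exact hcj j
    _ = _ := by rw [ENNReal.tsum_mul_right]; ring

theorem herzNorm_rpow {d : ℕ} {u t : ℝ≥0∞} (ht0 : t ≠ 0) (ht : t ≠ ∞) (s : ℝ) (F : E d → ℂ) :
    herzNorm u s t F ^ t.toReal = ∑' l : ℕ,
      ((2 : ℝ≥0∞) ^ (s * l) * eLpNorm F u (volume.restrict (herzShell d l))) ^ t.toReal := by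
  have htr : 0 < t.toReal := ENNReal.toReal_pos ht0 ht
  rw [herzNorm, eLpNorm_eq_lintegral_rpow_enorm_toReal ht0 ht, ← ENNReal.rpow_mul,
    one_div_mul_cancel htr.ne', ENNReal.rpow_one, lintegral_count]
  rfl

theorem eLpNorm_rpow_eq_lintegral {α F : Type*} [MeasurableSpace α] [NormedAddCommGroup F]
    {μ : Measure α} {p : ℝ≥0∞} (hp0 : p ≠ 0) (hp : p ≠ ∞) (f : α → F) :
    eLpNorm f p μ ^ p.toReal = ∫⁻ x, ‖f x‖ₑ ^ p.toReal ∂μ := by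
  have hpr : 0 < p.toReal := ENNReal.toReal_pos hp0 hp
  rw [eLpNorm_eq_lintegral_rpow_enorm_toReal hp0 hp, ← ENNReal.rpow_mul,
    one_div_mul_cancel hpr.ne', ENNReal.rpow_one]

theorem le_mul_of_rpow_le {x y C : ℝ≥0∞} {t : ℝ} (ht : 0 < t) (h : x ^ t ≤ C * y ^ t) :
    x ≤ C ^ t⁻¹ * y := by
  have := ENNReal.rpow_le_rpow h (inv_nonneg.2 ht.le)
  rwa [ENNReal.mul_rpow_of_nonneg _ _ (inv_nonneg.2 ht.le), ← ENNReal.rpow_mul, ← ENNReal.rpow_mul,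
    mul_inv_cancel₀ ht.ne', ENNReal.rpow_one, ENNReal.rpow_one] at this

theorem exists_eLpNorm_le_herzNorm_of_le {d : ℕ} {r u : ℝ≥0∞} (hu : u ≠ 0) (hur : u ≤ r)
    (hr : r ≠ ∞) {N : ℝ} (hN : 1 ≤ N) {A : ℝ≥0∞} (hA : A ≠ ∞) :
    ∃ C : ℝ≥0∞, C ≠ ∞ ∧ ∀ F : E d → ℂ, Measurable F →
      (∀ x, ‖F x‖ₑ ^ u.toReal ≤ A * ∫⁻ z, ‖F z‖ₑ ^ u.toReal * wt (x - z) ^ (-N)) →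
      eLpNorm F r volume ≤ C * herzNorm u 0 r F := by
  have hut : u ≠ ∞ := ne_top_of_le_ne_top hr hur
  have hr0 : r ≠ 0 := fun h => hu (le_zero_iff.1 (h ▸ hur))
  have hur' : u.toReal ≤ r.toReal := ENNReal.toReal_mono hr hur
  have hu' : 0 < u.toReal := ENNReal.toReal_pos hu hut
  obtain ⟨C, hC, h⟩ := exists_lintegral_rpow_le_tsum_herzShell (d := d) hu' hur' hN hA
  refine ⟨C ^ r.toReal⁻¹, ENNReal.rpow_ne_top_of_nonneg (by positivity) hC, fun F hF hFA => ?_⟩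
  refine le_mul_of_rpow_le (hu'.trans_le hur') ?_
  rw [eLpNorm_rpow_eq_lintegral hr0 hr, herzNorm_rpow hr0 hr]
  refine (h (fun x => ‖F x‖ₑ) (by fun_prop) hFA).trans (le_of_eq ?_)
  congr 1
  refine tsum_congr fun l => ?_
  rw [zero_mul, ENNReal.rpow_zero, one_mul, ← eLpNorm_rpow_eq_lintegral hu hut,
    ← ENNReal.rpow_mul, mul_div_cancel₀ _ hu'.ne']

theorem volume_herzShell_le (d l : ℕ) :
    volume (herzShell d l) ≤ 2 ^ ((d : ℝ) * l) * (2 ^ d * volume (Metric.closedBall (0 : E d) 1)) := by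
  have hsub : herzShell d l ⊆ Metric.closedBall (0 : E d) (2 ^ (l + 1)) := by
    intro x hx
    rw [mem_closedBall_zero_iff]
    unfold herzShell at hx
    split_ifs at hx with h0
    · subst h0
      simpa using hx
    · exact hx.2
  refine (measure_mono hsub).trans (le_of_eq ?_)
  rw [Measure.addHaar_closedBall' _ _ (by positivity)]
  simp only [finrank_euclideanSpace, Fintype.card_fin]
  rw [← mul_assoc]
  congr 1
  rw [ENNReal.ofReal_pow (by positivity), ENNReal.ofReal_pow (by norm_num), ENNReal.ofReal_ofNat,
    pow_succ, mul_pow, ← pow_mul, mul_comm l d, ← Nat.cast_mul, ENNReal.rpow_natCast]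

/-- Hölder on shell l costs |B_l|^{1/r-1/u}, which is at most a constant times 2^{ld(1/r-1/u)},
exactly the Herz weight. No band limitation is needed here. -/
theorem exists_eLpNorm_le_herzNorm_of_lt {d : ℕ} {r u : ℝ≥0∞} (hr0 : r ≠ 0) (hr : r ≠ ∞)
    (hru : r < u) :
    ∃ C : ℝ≥0∞, C ≠ ∞ ∧ ∀ F : E d → ℂ, AEStronglyMeasurable F volume →
      eLpNorm F r volume ≤ C * herzNorm u (d * (r⁻¹).toReal - d * (u⁻¹).toReal) r F := by
  have hr' : 0 < r.toReal := ENNReal.toReal_pos hr0 hr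
  -- If u = ∞ then `u.toReal = 0` and `1 / 0 = 0`, so e = 1/r as it should be.
  set e : ℝ := 1 / r.toReal - 1 / u.toReal with he
  have he' : (d : ℝ) * (r⁻¹).toReal - d * (u⁻¹).toReal = d * e := by
    rw [ENNReal.toReal_inv, ENNReal.toReal_inv, he]
    ring
  have he0 : 0 ≤ e := by
    rcases eq_or_ne u ∞ with rfl | hu
    · simp [he]
    · rw [he, sub_nonneg]
      exact one_div_le_one_div_of_le hr' (ENNReal.toReal_mono hu hru.le)
  set v : ℝ≥0∞ := 2 ^ d * volume (Metric.closedBall (0 : E d) 1) with hv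
  have hvtop : v ≠ ∞ := ENNReal.mul_ne_top (by simp) measure_closedBall_lt_top.ne
  have hvr : v ^ e ≠ ∞ := ENNReal.rpow_ne_top_of_nonneg he0 hvtop
  -- This is just v^e, in the shape that `le_mul_of_rpow_le` produces.
  refine ⟨((v ^ e) ^ r.toReal) ^ r.toReal⁻¹, ?_, fun F hF => ?_⟩
  · rwa [← ENNReal.rpow_mul, mul_inv_cancel₀ hr'.ne', ENNReal.rpow_one]
  rw [he']
  refine le_mul_of_rpow_le hr' ?_
  rw [eLpNorm_rpow_eq_lintegral hr0 hr, herzNorm_rpow hr0 hr, ← ENNReal.tsum_mul_left]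
  refine (lintegral_le_tsum_herzShell _).trans (ENNReal.tsum_le_tsum fun l => ?_)
  rw [← eLpNorm_rpow_eq_lintegral hr0 hr, ← ENNReal.mul_rpow_of_nonneg _ _ hr'.le]
  gcongr
  refine (eLpNorm_le_eLpNorm_mul_rpow_measure_univ hru.le hF.restrict).trans ?_
  rw [Measure.restrict_apply_univ]
  calc eLpNorm F u (volume.restrict (herzShell d l)) * volume (herzShell d l) ^ e
      ≤ eLpNorm F u (volume.restrict (herzShell d l)) * (2 ^ ((d : ℝ) * l) * v) ^ e := by
        gcongr
        exact volume_herzShell_le d l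
    _ = _ := by
        rw [ENNReal.mul_rpow_of_nonneg _ _ he0, ← ENNReal.rpow_mul,
          show (d : ℝ) * l * e = d * e * l by ring]
        ring

/-! ### Fourier transforms, dilations and convolutions -/

theorem continuous_neg_innerₗ (d : ℕ) :
    Continuous fun p : E d × E d => (-innerₗ (E d)) p.1 p.2 := by
  have : (fun p : E d × E d => (-innerₗ (E d)) p.1 p.2) = fun p => -inner ℝ p.1 p.2 := rfl
  rw [this]
  fun_prop

theorem continuous_fourierInv {d : ℕ} {f : E d → ℂ} (hf : Integrable f) : Continuous (𝓕⁻ f) :=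
  VectorFourier.fourierIntegral_continuous Real.continuous_fourierChar (continuous_neg_innerₗ d) hf

theorem norm_fourierInv_le {d : ℕ} (f : E d → ℂ) (x : E d) : ‖𝓕⁻ f x‖ ≤ ∫ v, ‖f v‖ :=
  VectorFourier.norm_fourierIntegral_le_integral_norm _ _ _ _ _

theorem integral_fourierInv_mul_eq {d : ℕ} {f g : E d → ℂ} (hf : Integrable f)
    (hg : Integrable g) : ∫ x, 𝓕⁻ f x * g x = ∫ x, f x * 𝓕⁻ g x := by
  have h := VectorFourier.integral_fourierIntegral_smul_eq_flip (e := Real.fourierChar)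
    (μ := volume) (ν := volume) (L := -innerₗ (E d)) Real.continuous_fourierChar
    (continuous_neg_innerₗ d) hf hg
  have hflip : (-innerₗ (E d)).flip = -innerₗ (E d) := by
    ext x y
    simp [real_inner_comm]
  rw [hflip] at h
  exact h

theorem integral_comp_zpow_smul {d : ℕ} (k : ℤ) (F : E d → ℂ) :
    (2 : ℂ) ^ (k * d) * ∫ x, F ((2 : ℝ) ^ k • x) = ∫ x, F x := by
  have h2 : (0 : ℝ) < ((2 : ℝ) ^ k) ^ d := by positivity
  rw [Measure.integral_comp_smul]
  simp only [finrank_euclideanSpace, Fintype.card_fin]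
  rw [abs_of_pos (inv_pos.2 h2), Complex.real_smul, ← mul_assoc]
  have : (2 : ℂ) ^ (k * d) * ((((2 : ℝ) ^ k) ^ d)⁻¹ : ℝ) = 1 := by
    push_cast
    rw [zpow_mul, zpow_natCast]
    exact mul_inv_cancel₀ (pow_ne_zero _ (zpow_ne_zero _ two_ne_zero))
  rw [this, one_mul]

/-- The dilate `2^{kd} F(2^k ·)`. -/
def dil {d : ℕ} (k : ℤ) (F : E d → ℂ) (x : E d) : ℂ := (2 : ℂ) ^ (k * d) * F ((2 : ℝ) ^ k • x)

theorem dyadicKernel_eq_dil {d : ℕ} (g : 𝓢(E d, ℂ)) (k : ℤ) (x y : E d) :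
    dyadicKernel g k x y = dil k g (x - y) := rfl

theorem continuous_dil {d : ℕ} (k : ℤ) {F : E d → ℂ} (hF : Continuous F) :
    Continuous (dil k F) := by
  unfold dil
  fun_prop

theorem integrable_comp_zpow_smul {d : ℕ} (k : ℤ) {F : E d → ℂ} (hF : Integrable F) :
    Integrable fun x => F ((2 : ℝ) ^ k • x) :=
  hF.comp_smul (by positivity)

theorem integrable_dil {d : ℕ} (k : ℤ) {F : E d → ℂ} (hF : Integrable F) :
    Integrable (dil k F) :=
  (integrable_comp_zpow_smul k hF).const_mul _

/-- The reflection y ↦ x - y inside the kernel is the reason why the inverse transform of the left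
side yields the direct transform of g. -/
theorem fourierInv_dyadicKernel {d : ℕ} (g : 𝓢(E d, ℂ)) (k : ℤ) (x ξ : E d) :
    𝓕⁻ (dyadicKernel g k x : E d → ℂ) ξ =
      Complex.exp ((↑(2 * Real.pi * inner ℝ ξ x) : ℂ) * Complex.I) *
        𝓕 g ((2 : ℝ) ^ (-k) • ξ) := by
  have h2 : (0 : ℝ) < 2 ^ k := by positivity
  have h2' : (2 : ℝ) ^ k * (2 : ℝ) ^ (-k) = 1 := by rw [zpow_neg, mul_inv_cancel₀ h2.ne']
  rw [SchwartzMap.fourier_coe, Real.fourier_eq', Real.fourierInv_eq']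
  set G : E d → ℂ := fun w =>
    Complex.exp ((↑(-2 * Real.pi * inner ℝ w ((2 : ℝ) ^ (-k) • ξ)) : ℂ) * Complex.I) • g w
    with hG
  set c : ℂ := Complex.exp ((↑(2 * Real.pi * inner ℝ ξ x) : ℂ) * Complex.I) with hc
  have key : ∀ y : E d,
      Complex.exp ((↑(2 * Real.pi * inner ℝ y ξ) : ℂ) * Complex.I) • dyadicKernel g k x y =
        c * ((2 : ℂ) ^ (k * d) * G ((2 : ℝ) ^ k • (x - y))) := by
    intro y
    have hin : inner ℝ ((2 : ℝ) ^ k • (x - y)) ((2 : ℝ) ^ (-k) • ξ) =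
        inner ℝ ξ x - inner ℝ y ξ := by
      rw [real_inner_smul_left, real_inner_smul_right, ← mul_assoc, h2',
        one_mul, inner_sub_left, real_inner_comm]
    have hexp : Complex.exp ((↑(2 * Real.pi * inner ℝ y ξ) : ℂ) * Complex.I) =
        c * Complex.exp ((↑(-2 * Real.pi * (inner ℝ ξ x - inner ℝ y ξ)) : ℂ) * Complex.I) := by
      rw [hc, ← Complex.exp_add]
      congr 1
      push_cast
      ring
    simp only [hG, dyadicKernel_apply, smul_eq_mul]
    rw [hin, hexp]
    ring
  simp_rw [key]
  rw [integral_const_mul, integral_const_mul,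
    integral_sub_left_eq_self (fun z : E d => G ((2 : ℝ) ^ k • z)) volume x,
    integral_comp_zpow_smul]

/-- Convolution of an inverse Fourier transform with a dilated Schwartz function. -/
theorem integral_fourierInv_mul_dyadicKernel {d : ℕ} {b : E d → ℂ} (hb : Integrable b)
    (g : 𝓢(E d, ℂ)) (k : ℤ) (x : E d) :
    ∫ y, 𝓕⁻ b y * dil k g (x - y) = 𝓕⁻ (fun ξ => b ξ * 𝓕 g ((2 : ℝ) ^ (-k) • ξ)) x := by
  have h := integral_fourierInv_mul_eq hb (dyadicKernel g k x).integrable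
  simp only [← dyadicKernel_eq_dil]
  rw [h, Real.fourierInv_eq']
  refine integral_congr_ae (Filter.Eventually.of_forall fun ξ => ?_)
  simp only [fourierInv_dyadicKernel, smul_eq_mul]
  ring

/-- Convolution of two dilated Schwartz functions. -/
theorem integral_dil_mul_dil {d : ℕ} (g h : 𝓢(E d, ℂ)) (j k : ℤ) (x z : E d) :
    ∫ y, dil j g (x - y) * dil k h (y - z) =
      𝓕⁻ (fun ξ => 𝓕 g ((2 : ℝ) ^ (-j) • ξ) * 𝓕 h ((2 : ℝ) ^ (-k) • ξ)) (x - z) := by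
  -- Fourier inversion presents the second dilate as an inverse transform, which reduces the claim
  -- to `integral_fourierInv_mul_dyadicKernel`.
  set b : 𝓢(E d, ℂ) := 𝓕 (dyadicKernel h k 0) with hb
  have h1 : ∀ y, dil k h (y - z) = 𝓕⁻ (b : E d → ℂ) (z - y) := by
    intro y
    rw [← SchwartzMap.fourierInv_coe, hb, FourierTransform.fourierInv_fourier_eq,
      dyadicKernel_eq_dil]
    congr 1
    abel
  have h2 : ∀ ξ, b ξ = 𝓕 h (-((2 : ℝ) ^ (-k) • ξ)) := by
    intro ξ
    have := fourierInv_dyadicKernel h k 0 (-ξ)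
    rw [Real.fourierInv_eq_fourier_neg, neg_neg, ← SchwartzMap.fourier_coe] at this
    simpa using this
  have h3 : ∫ y, dil j g (x - y) * dil k h (y - z) =
      ∫ y, 𝓕⁻ (b : E d → ℂ) y * dil j g (x - z + y) := by
    rw [← integral_sub_left_eq_self (fun y => 𝓕⁻ (b : E d → ℂ) y * dil j g (x - z + y)) volume z]
    refine integral_congr_ae (Filter.Eventually.of_forall fun y => ?_)
    simp only
    rw [h1, mul_comm, show x - z + (z - y) = x - y by abel]
  rw [h3, ← integral_neg_eq_self]
  have h4 : ∀ y, 𝓕⁻ (b : E d → ℂ) (-y) = 𝓕⁻ (fun ξ => b (-ξ)) y := by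
    intro y
    exact (Real.fourierInv_comp_linearIsometry (LinearIsometryEquiv.neg ℝ) (b : E d → ℂ) y).symm
  simp_rw [h4, ← sub_eq_add_neg]
  rw [integral_fourierInv_mul_dyadicKernel (b := fun ξ => b (-ξ)) b.integrable.comp_neg]
  refine congrFun (congrArg _ (funext fun ξ => ?_)) _
  rw [h2, mul_comm, smul_neg, neg_neg]

/-! ### An auxiliary band-limiting Schwartz function -/

/-- A difference of two bumps on the Fourier side. The annulus 1/4 ≤ |ξ| ≤ 4 contains the supports
of φ and of the dilates of the transform of ϕ by 1/2, 1 and 2. Vanishing near the origin is what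
later permits division by |ξ|^{2n}. -/
theorem exists_bandLimiter (d : ℕ) : ∃ Φ : 𝓢(E d, ℂ), HasCompactSupport (𝓕 Φ : 𝓢(E d, ℂ)) ∧
    (∀ ξ, 1 / 4 ≤ ‖ξ‖ → ‖ξ‖ ≤ 4 → 𝓕 Φ ξ = 1) ∧ ∀ ξ, ‖ξ‖ ≤ 1 / 8 → 𝓕 Φ ξ = 0 := by
  set f : ContDiffBump (0 : E d) := ⟨4, 8, by norm_num, by norm_num⟩
  set g : ContDiffBump (0 : E d) := ⟨1 / 8, 1 / 4, by norm_num, by norm_num⟩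
  set F : E d → ℂ := fun ξ => ((f ξ - g ξ : ℝ) : ℂ) with hF
  have hFc : HasCompactSupport F := by
    have h : HasCompactSupport fun ξ => f ξ - g ξ := f.hasCompactSupport.sub g.hasCompactSupport
    exact h.comp_left (g := ((↑) : ℝ → ℂ)) Complex.ofReal_zero
  have hFs : ContDiff ℝ ((⊤ : ℕ∞) : WithTop ℕ∞) F :=
    Complex.ofRealCLM.contDiff.comp (f.contDiff.sub g.contDiff)
  set Ψ := hFc.toSchwartzMap hFs
  refine ⟨𝓕⁻ Ψ, ?_⟩
  rw [FourierTransform.fourier_fourierInv_eq]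
  refine ⟨hFc, fun ξ h1 h2 => ?_, fun ξ h => ?_⟩
  · have e1 : f ξ = 1 := f.one_of_mem_closedBall (by rw [mem_closedBall_zero_iff]; exact h2)
    have e2 : g ξ = 0 := g.zero_of_le_dist (by rw [dist_zero_right]; exact h1)
    change ((f ξ - g ξ : ℝ) : ℂ) = 1
    rw [e1, e2]
    simp
  · have e1 : f ξ = 1 := f.one_of_mem_closedBall (by
      rw [mem_closedBall_zero_iff]
      change ‖ξ‖ ≤ 4
      linarith)
    have e2 : g ξ = 1 := g.one_of_mem_closedBall (by rw [mem_closedBall_zero_iff]; exact h)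
    change ((f ξ - g ξ : ℝ) : ℂ) = 0
    rw [e1, e2]
    simp

/-! ### The multiplier kernels -/

theorem memLp_top_comp_zpow_smul {d : ℕ} {m : E d → ℂ} (hm : MemLp m ∞ volume) (k : ℤ) :
    MemLp (fun ξ => m ((2 : ℝ) ^ k • ξ)) ∞ volume := by
  have h2 : (2 : ℝ) ^ k ≠ 0 := by positivity
  refine MemLp.comp_of_map (f := fun ξ : E d => (2 : ℝ) ^ k • ξ) (g := m) ?_ (by fun_prop)
  rw [Measure.map_addHaar_smul _ h2]
  exact hm.smul_measure ENNReal.ofReal_ne_top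

theorem hasCompactSupport_cutoff {d : ℕ} (φ : AnnularCutoff d) :
    HasCompactSupport fun ξ => (φ.fn ξ : ℂ) := by
  have h : HasCompactSupport φ.fn := by
    refine HasCompactSupport.of_support_subset_isCompact (isCompact_closedBall (0 : E d) 4) ?_
    intro ξ hξ
    rw [mem_closedBall_zero_iff]
    exact (φ.tsupport_subset (subset_tsupport _ hξ)).2
  exact h.comp_left (g := ((↑) : ℝ → ℂ)) Complex.ofReal_zero

theorem integrable_cutoff {d : ℕ} (φ : AnnularCutoff d) :
    Integrable (fun ξ => (φ.fn ξ : ℂ)) volume :=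
  (Complex.continuous_ofReal.comp φ.contDiff.continuous).integrable_of_hasCompactSupport
    (hasCompactSupport_cutoff φ)

/-- The localized multiplier `m(2^k ·) φ`. -/
def localMultiplier {d : ℕ} (φ : AnnularCutoff d) (m : E d → ℂ) (k : ℤ) (ξ : E d) : ℂ :=
  m ((2 : ℝ) ^ k • ξ) * (φ.fn ξ : ℂ)

theorem integrable_localMultiplier {d : ℕ} (φ : AnnularCutoff d) {m : E d → ℂ}
    (hm : MemLp m ∞ volume) (k : ℤ) : Integrable (localMultiplier φ m k) volume :=
  (integrable_cutoff φ).mul_of_top_right (memLp_top_comp_zpow_smul hm k)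

theorem integrable_mul_cutoff {d : ℕ} (φ : AnnularCutoff d) {m : E d → ℂ}
    (hm : MemLp m ∞ volume) (k : ℤ) :
    Integrable (fun ξ : E d => m ξ * (φ.fn ((2 : ℝ) ^ (-k) • ξ) : ℂ)) volume :=
  (integrable_comp_zpow_smul (-k) (integrable_cutoff φ)).mul_of_top_right hm

/-- The kernel `(m(2^k ·) φ)^∨` at unit scale. -/
def unitKernel {d : ℕ} (φ : AnnularCutoff d) (m : E d → ℂ) (k : ℤ) : E d → ℂ :=
  𝓕⁻ (localMultiplier φ m k)

/-- This reduces the kernels m_k^∨ to unit scale, where the Herz norms are taken. -/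
theorem multiplierKernel_eq_dil {d : ℕ} (φ : AnnularCutoff d) (m : E d → ℂ) (k : ℤ) :
    multiplierKernel φ m k = dil k (unitKernel φ m k) := by
  ext x
  have h2 : (2 : ℝ) ^ (-k) * (2 : ℝ) ^ k = 1 := by
    rw [← zpow_add₀ two_ne_zero, neg_add_cancel, zpow_zero]
  simp only [multiplierKernel, dil, unitKernel, Real.fourierInv_eq']
  rw [← integral_comp_zpow_smul k]
  congr 2
  ext ξ
  simp only [localMultiplier, smul_smul, h2, one_smul, inner_smul_left, inner_smul_right]
  simp

theorem continuous_unitKernel {d : ℕ} (φ : AnnularCutoff d) {m : E d → ℂ}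
    (hm : MemLp m ∞ volume) (k : ℤ) : Continuous (unitKernel φ m k) :=
  continuous_fourierInv (integrable_localMultiplier φ hm k)

theorem continuous_multiplierKernel {d : ℕ} (φ : AnnularCutoff d) {m : E d → ℂ}
    (hm : MemLp m ∞ volume) (k : ℤ) : Continuous (multiplierKernel φ m k) :=
  continuous_fourierInv (integrable_mul_cutoff φ hm k)

theorem unitKernel_reproducing {d : ℕ} (φ : AnnularCutoff d) {m : E d → ℂ}
    (hm : MemLp m ∞ volume) (k : ℤ) {Φ : 𝓢(E d, ℂ)}
    (hΦ : ∀ ξ, 1 / 4 ≤ ‖ξ‖ → ‖ξ‖ ≤ 4 → 𝓕 Φ ξ = 1) (x : E d) :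
    ∫ y, unitKernel φ m k y * Φ (x - y) = unitKernel φ m k x := by
  have h := integral_fourierInv_mul_dyadicKernel (integrable_localMultiplier φ hm k) Φ 0 x
  simp only [dil, zero_mul, zpow_zero, one_mul, one_smul, neg_zero] at h
  rw [unitKernel, h]
  refine congrFun (congrArg _ (funext fun ξ => ?_)) _
  by_cases h0 : φ.fn ξ = 0
  · simp [localMultiplier, h0]
  · have := φ.tsupport_subset (subset_tsupport _ h0)
    rw [hΦ ξ this.1 this.2, mul_one]

/-! ### Extension of functionals that factor through a normed space -/

/-- The bound forces l to vanish on the kernel of B restricted to V, so l descends to a bounded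
functional on B(V), which Hahn-Banach extends to Y. It is used with V the whole Schwartz space to
represent a distribution by finitely many derivatives, and with V = S_∞ to extend a functional to
all of S. -/
theorem exists_clm_comp_eq {M Y : Type*} [AddCommGroup M] [Module ℂ M] [NormedAddCommGroup Y]
    [NormedSpace ℂ Y] (B : M →ₗ[ℂ] Y) (V : Submodule ℂ M) (l : V →ₗ[ℂ] ℂ) {C : ℝ}
    (h : ∀ v : V, ‖l v‖ ≤ C * ‖B v‖) : ∃ L : Y →L[ℂ] ℂ, ∀ v : V, L (B v) = l v := by
  set B' : V →ₗ[ℂ] Y := B.domRestrict V with hB'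
  have hker : B'.ker ≤ l.ker := by
    intro v hv
    have h0 : B (v : M) = 0 := hv
    have := h v
    rw [h0, norm_zero, mul_zero, norm_le_zero_iff] at this
    exact this
  set l' : B'.range →ₗ[ℂ] ℂ :=
    (B'.ker.liftQ l hker).comp B'.quotKerEquivRange.symm.toLinearMap with hl'
  have hl'_apply : ∀ v : V, ∀ hv : B' v ∈ B'.range, l' ⟨B' v, hv⟩ = l v := by
    intro v hv
    simp only [hl', LinearMap.comp_apply, LinearEquiv.coe_coe]
    rw [LinearMap.quotKerEquivRange_symm_apply_image]
    rfl
  obtain ⟨L, hL, -⟩ := exists_extension_norm_eq B'.range (l'.mkContinuous C (by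
    rintro ⟨_, v, rfl⟩
    exact (congrArg norm (hl'_apply v _)).trans_le (h v)))
  refine ⟨L, fun v => ?_⟩
  exact (hL ⟨B' v, v, rfl⟩).trans (hl'_apply v _)

/-! ### Translates of Schwartz functions -/

theorem exists_norm_iteratedFDeriv_le {d : ℕ} (η : 𝓢(E d, ℂ)) (N n : ℕ) :
    ∃ S : ℝ, 0 ≤ S ∧ ∀ x, (1 + ‖x‖) ^ N * ‖iteratedFDeriv ℝ n η x‖ ≤ S :=
  ⟨_, by positivity, fun x => SchwartzMap.one_add_le_sup_seminorm_apply (𝕜 := ℝ) (m := (N, n))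
    le_rfl le_rfl η x⟩

theorem one_add_norm_add_le {d : ℕ} (x y : E d) : 1 + ‖x + y‖ ≤ (1 + ‖x‖) * (1 + ‖y‖) := by
  nlinarith [norm_add_le x y, norm_nonneg x, norm_nonneg y, mul_nonneg (norm_nonneg x)
    (norm_nonneg y)]

/-- Mean value inequality on the segment from x to x + h, whose points w satisfy 1+|x| ≤
(1+|w|)(1+|h|). -/
theorem exists_norm_iteratedFDeriv_add_sub_le {d : ℕ} (η : 𝓢(E d, ℂ)) (N n : ℕ) :
    ∃ S : ℝ, 0 ≤ S ∧ ∀ x h,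
      (1 + ‖x‖) ^ N * ‖iteratedFDeriv ℝ n η (x + h) - iteratedFDeriv ℝ n η x‖ ≤
        S * (1 + ‖h‖) ^ N * ‖h‖ := by
  obtain ⟨S, hS0, hS⟩ := exists_norm_iteratedFDeriv_le η N (n + 1)
  refine ⟨S, hS0, fun x h => ?_⟩
  have hx : 0 < (1 + ‖x‖) ^ N := by positivity
  have hdiff : ∀ w ∈ segment ℝ x (x + h), DifferentiableAt ℝ (iteratedFDeriv ℝ n η) w :=
    fun w _ => ((η.smooth (n + 1)).differentiable_iteratedFDeriv (by exact_mod_cast n.lt_succ_self)) w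
  have hbound : ∀ w ∈ segment ℝ x (x + h),
      ‖fderiv ℝ (iteratedFDeriv ℝ n η) w‖ ≤ S * (1 + ‖h‖) ^ N / (1 + ‖x‖) ^ N := by
    intro w hw
    rw [norm_fderiv_iteratedFDeriv, le_div_iff₀ hx]
    have hwx : ‖x - w‖ ≤ ‖h‖ := by
      rw [segment_eq_image_lineMap] at hw
      obtain ⟨t, ht, rfl⟩ := hw
      have : x - AffineMap.lineMap x (x + h) t = -(t • h) := by
        simp [AffineMap.lineMap_apply]
      rw [this, norm_neg, norm_smul, Real.norm_of_nonneg ht.1]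
      exact mul_le_of_le_one_left (norm_nonneg _) ht.2
    have h1 : 1 + ‖x‖ ≤ (1 + ‖w‖) * (1 + ‖h‖) := by
      have := one_add_norm_add_le w (x - w)
      rw [add_sub_cancel] at this
      exact this.trans (by gcongr)
    calc ‖iteratedFDeriv ℝ (n + 1) η w‖ * (1 + ‖x‖) ^ N
        ≤ ‖iteratedFDeriv ℝ (n + 1) η w‖ * ((1 + ‖w‖) * (1 + ‖h‖)) ^ N := by gcongr
      _ = ((1 + ‖w‖) ^ N * ‖iteratedFDeriv ℝ (n + 1) η w‖) * (1 + ‖h‖) ^ N := by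
          rw [mul_pow]; ring
      _ ≤ _ := by gcongr; exact hS w
  have := Convex.norm_image_sub_le_of_norm_fderiv_le hdiff hbound (convex_segment _ _)
    (left_mem_segment ℝ x (x + h)) (right_mem_segment ℝ x (x + h))
  rw [add_sub_cancel_left] at this
  calc (1 + ‖x‖) ^ N * ‖iteratedFDeriv ℝ n η (x + h) - iteratedFDeriv ℝ n η x‖
      ≤ (1 + ‖x‖) ^ N * (S * (1 + ‖h‖) ^ N / (1 + ‖x‖) ^ N * ‖h‖) := by gcongr
    _ = _ := by field_simp

/-- The translate `η(· - y)`. -/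
abbrev translate {d : ℕ} (η : 𝓢(E d, ℂ)) (y : E d) : 𝓢(E d, ℂ) :=
  SchwartzMap.compSubConstCLM ℂ y η

theorem iteratedFDeriv_translate {d : ℕ} (η : 𝓢(E d, ℂ)) (y z : E d) (n : ℕ) :
    iteratedFDeriv ℝ n (translate η y) z = iteratedFDeriv ℝ n η (z - y) :=
  iteratedFDeriv_comp_sub (f := η) n y z

/-! ### Weighted derivatives as bounded functions -/

/-- The index set for the weighted derivatives up to order `N`: a point and a list of at most `N`
vectors in the unit ball. -/
structure JetIndex (d N : ℕ) : Type where
  /-- the order of the derivative -/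
  order : Fin (N + 1)
  /-- the base point -/
  pt : E d
  /-- the directions -/
  vec : Fin order → Metric.closedBall (0 : E d) 1

/-- With the discrete topology every bounded family is continuous, so `JetSpace` is an ℓ^∞ space. It
provides a Banach space in which translates of Schwartz functions can be integrated. -/
instance (d N : ℕ) : TopologicalSpace (JetIndex d N) := ⊥

instance (d N : ℕ) : DiscreteTopology (JetIndex d N) := ⟨rfl⟩

/-- The space of bounded families indexed by `JetIndex d N`. -/
abbrev JetSpace (d N : ℕ) : Type := BoundedContinuousFunction (JetIndex d N) ℂ

/-- The number `(1 + |z|)^N D^n ψ(z)(v)`. -/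
def jetFun {d N : ℕ} (ψ : 𝓢(E d, ℂ)) (a : JetIndex d N) : ℂ :=
  (1 + ‖a.pt‖) ^ N • iteratedFDeriv ℝ a.order ψ a.pt fun i => (a.vec i : E d)

theorem norm_apply_unit_le {d n : ℕ} (A : ContinuousMultilinearMap ℝ (fun _ : Fin n => E d) ℂ)
    (v : Fin n → Metric.closedBall (0 : E d) 1) : ‖A fun i => (v i : E d)‖ ≤ ‖A‖ := by
  refine (A.le_opNorm _).trans (mul_le_of_le_one_right (norm_nonneg _) ?_)
  exact Finset.prod_le_one (fun _ _ => norm_nonneg _) fun i _ =>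
    mem_closedBall_zero_iff.1 (v i).2

theorem norm_le_of_unit {d n : ℕ} (A : ContinuousMultilinearMap ℝ (fun _ : Fin n => E d) ℂ)
    {M : ℝ} (hM : 0 ≤ M)
    (h : ∀ v : Fin n → Metric.closedBall (0 : E d) 1, ‖A fun i => (v i : E d)‖ ≤ M) :
    ‖A‖ ≤ M := by
  refine ContinuousMultilinearMap.opNorm_le_bound hM fun v => ?_
  have hu : ∀ i, ‖v i‖⁻¹ • v i ∈ Metric.closedBall (0 : E d) 1 := fun i => by
    rw [mem_closedBall_zero_iff, norm_smul, norm_inv, norm_norm]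
    exact inv_mul_le_one
  have hv : v = fun i => ‖v i‖ • (‖v i‖⁻¹ • v i) := by
    ext1 i
    rcases eq_or_ne (v i) 0 with h0 | h0
    · simp [h0]
    · rw [smul_smul, mul_inv_cancel₀ (norm_ne_zero_iff.2 h0), one_smul]
  have h1 : A v = (∏ i, ‖v i‖) • A fun i => ‖v i‖⁻¹ • v i := by
    conv_lhs => rw [hv]
    exact A.map_smul_univ _ _
  rw [h1, norm_smul, Real.norm_of_nonneg (Finset.prod_nonneg fun _ _ => norm_nonneg _), mul_comm]
  gcongr
  exact h fun i => ⟨_, hu i⟩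

theorem exists_norm_jetFun_le {d : ℕ} (N : ℕ) (ψ : 𝓢(E d, ℂ)) :
    ∃ S : ℝ, 0 ≤ S ∧ ∀ a : JetIndex d N, ‖jetFun ψ a‖ ≤ S := by
  choose S hS0 hS using fun n : Fin (N + 1) => exists_norm_iteratedFDeriv_le ψ N n
  refine ⟨∑ n, S n, Finset.sum_nonneg fun n _ => hS0 n, fun a => ?_⟩
  rw [jetFun, norm_smul, Real.norm_of_nonneg (by positivity)]
  calc _ ≤ (1 + ‖a.pt‖) ^ N * ‖iteratedFDeriv ℝ a.order ψ a.pt‖ := by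
        gcongr; exact norm_apply_unit_le _ _
    _ ≤ S a.order := hS _ _
    _ ≤ _ := Finset.single_le_sum (fun i _ => hS0 i) (Finset.mem_univ a.order)

/-- The weighted derivatives up to order `N` of a Schwartz function. -/
def jet {d : ℕ} (N : ℕ) : 𝓢(E d, ℂ) →ₗ[ℂ] JetSpace d N where
  toFun ψ := BoundedContinuousFunction.ofNormedAddCommGroup (jetFun ψ)
    continuous_of_discreteTopology _ (exists_norm_jetFun_le N ψ).choose_spec.2
  map_add' f g := by
    ext1 a
    change jetFun (f + g) a = jetFun f a + jetFun g a
    have : iteratedFDeriv ℝ a.order (f + g : 𝓢(E d, ℂ)) a.pt =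
        iteratedFDeriv ℝ a.order f a.pt + iteratedFDeriv ℝ a.order g a.pt :=
      iteratedFDeriv_add_apply (f.contDiffAt _) (g.contDiffAt _)
    rw [jetFun, this, add_apply, smul_add]
    rfl
  map_smul' c f := by
    ext1 a
    change jetFun (c • f) a = c • jetFun f a
    have : iteratedFDeriv ℝ a.order (c • f : 𝓢(E d, ℂ)) a.pt =
        c • iteratedFDeriv ℝ a.order f a.pt :=
      iteratedFDeriv_const_smul_apply (f.contDiffAt _)
    rw [jetFun, this, smul_apply, smul_comm]
    rfl

theorem jet_apply {d : ℕ} (N : ℕ) (ψ : 𝓢(E d, ℂ)) (a : JetIndex d N) :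
    jet N ψ a = jetFun ψ a := rfl

theorem norm_iteratedFDeriv_le_norm_jet {d N : ℕ} (ψ : 𝓢(E d, ℂ)) {n : ℕ} (hn : n ≤ N)
    (z : E d) : (1 + ‖z‖) ^ N * ‖iteratedFDeriv ℝ n ψ z‖ ≤ ‖jet N ψ‖ := by
  have hz : 0 < (1 + ‖z‖) ^ N := by positivity
  rw [← le_div_iff₀' hz]
  refine norm_le_of_unit _ (by positivity) fun v => ?_
  rw [le_div_iff₀' hz]
  have h := (jet N ψ).norm_coe_le_norm ⟨⟨n, Nat.lt_succ_of_le hn⟩, z, v⟩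
  rwa [jet_apply, jetFun, norm_smul, Real.norm_of_nonneg (by positivity)] at h

/-- A tempered distribution as a linear map. -/
def distLinearMap {d : ℕ} (T : 𝓢'(E d, ℂ)) : 𝓢(E d, ℂ) →ₗ[ℂ] ℂ where
  toFun ψ := T ψ
  map_add' := map_add T
  map_smul' := map_smul T

/-- Every tempered distribution factors through finitely many weighted derivatives. -/
theorem exists_eq_clm_jet {d : ℕ} (T : 𝓢'(E d, ℂ)) :
    ∃ (N : ℕ) (L : JetSpace d N →L[ℂ] ℂ), ∀ ψ, T ψ = L (jet N ψ) := by
  set q : Seminorm ℂ 𝓢(E d, ℂ) := (normSeminorm ℂ ℂ).comp (distLinearMap T) with hq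
  have hqc : Continuous q := by
    have : Continuous fun ψ => ‖T ψ‖ := (map_continuous T).norm
    exact this
  obtain ⟨s, C, -, hC⟩ := Seminorm.bound_of_continuous (schwartz_withSeminorms ℂ (E d) ℂ) q hqc
  obtain ⟨N, hN⟩ : ∃ N : ℕ, ∀ i ∈ s, i.1 ≤ N ∧ i.2 ≤ N := by
    refine ⟨s.sup fun i => max i.1 i.2, fun i hi => ?_⟩
    have := Finset.le_sup (f := fun i : ℕ × ℕ => max i.1 i.2) hi
    exact ⟨(le_max_left _ _).trans this, (le_max_right _ _).trans this⟩
  have hbound : ∀ ψ, ‖T ψ‖ ≤ C * ‖jet N ψ‖ := by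
    intro ψ
    refine (hC ψ).trans ?_
    rw [smul_apply, NNReal.smul_def, smul_eq_mul]
    gcongr
    refine Seminorm.finset_sup_apply_le (norm_nonneg _) fun i hi => ?_
    refine SchwartzMap.seminorm_le_bound ℂ _ _ _ (norm_nonneg _) fun x => ?_
    refine le_trans ?_ (norm_iteratedFDeriv_le_norm_jet ψ (hN i hi).2 x)
    gcongr
    have h2 : (1 : ℝ) ≤ 1 + ‖x‖ := le_add_of_nonneg_right (norm_nonneg x)
    calc ‖x‖ ^ i.1 ≤ (1 + ‖x‖) ^ i.1 := by gcongr; linarith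
      _ ≤ (1 + ‖x‖) ^ N := pow_le_pow_right₀ h2 (hN i hi).1
  obtain ⟨L, hL⟩ := exists_clm_comp_eq (jet N) ⊤ ((distLinearMap T).domRestrict ⊤) (C := C)
    (fun v => hbound v)
  exact ⟨N, L, fun ψ => (hL ⟨ψ, trivial⟩).symm⟩

theorem jetFun_translate {d N : ℕ} (η : 𝓢(E d, ℂ)) (y : E d) (a : JetIndex d N) :
    jetFun (translate η y) a =
      (1 + ‖a.pt‖) ^ N • iteratedFDeriv ℝ a.order η (a.pt - y) fun i => (a.vec i : E d) := by
  rw [jetFun, iteratedFDeriv_translate]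

theorem exists_norm_jet_translate_le {d : ℕ} (N : ℕ) (η : 𝓢(E d, ℂ)) :
    ∃ S : ℝ, 0 ≤ S ∧ ∀ y, ‖jet N (translate η y)‖ ≤ S * (1 + ‖y‖) ^ N := by
  choose S hS0 hS using fun n : Fin (N + 1) => exists_norm_iteratedFDeriv_le η N n
  refine ⟨∑ n, S n, Finset.sum_nonneg fun n _ => hS0 n, fun y => ?_⟩
  rw [BoundedContinuousFunction.norm_le
    (mul_nonneg (Finset.sum_nonneg fun n _ => hS0 n) (by positivity))]
  rintro ⟨n, z, v⟩
  rw [jet_apply, jetFun_translate, norm_smul, Real.norm_of_nonneg (by positivity)]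
  simp only
  have h1 : 1 + ‖z‖ ≤ (1 + ‖z - y‖) * (1 + ‖y‖) := by
    simpa using one_add_norm_add_le (z - y) y
  calc _ ≤ ((1 + ‖z - y‖) * (1 + ‖y‖)) ^ N * ‖iteratedFDeriv ℝ n η (z - y)‖ := by
        gcongr; exact norm_apply_unit_le _ _
    _ = ((1 + ‖z - y‖) ^ N * ‖iteratedFDeriv ℝ n η (z - y)‖) * (1 + ‖y‖) ^ N := by
        rw [mul_pow]; ring
    _ ≤ S n * (1 + ‖y‖) ^ N := by gcongr; exact hS n (z - y)
    _ ≤ _ := by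
        gcongr
        exact Finset.single_le_sum (fun i _ => hS0 i) (Finset.mem_univ n)

/-- Norm continuity of the translates is what gives measurability in the Bochner integral of
`integral_mul_apply_translate`. -/
theorem continuous_jet_translate {d : ℕ} (N : ℕ) (η : 𝓢(E d, ℂ)) :
    Continuous fun y => jet N (translate η y) := by
  refine continuous_iff_continuousAt.2 fun y => ?_
  choose S hS0 hS using fun n : Fin (N + 1) => exists_norm_iteratedFDeriv_add_sub_le η N n
  have hsum : 0 ≤ ∑ n, S n := Finset.sum_nonneg fun n _ => hS0 n
  rw [ContinuousAt, tendsto_iff_norm_sub_tendsto_zero]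
  have hlim : Filter.Tendsto
      (fun y' : E d => (1 + ‖y‖) ^ N * ((∑ n, S n) * (1 + ‖y - y'‖) ^ N * ‖y - y'‖))
      (nhds y) (nhds 0) := by
    have : Continuous
      (fun y' : E d => (1 + ‖y‖) ^ N * ((∑ n, S n) * (1 + ‖y - y'‖) ^ N * ‖y - y'‖)) := by
        fun_prop
    simpa using this.tendsto y
  refine squeeze_zero (fun _ => norm_nonneg _) (fun y' => ?_) hlim
  rw [BoundedContinuousFunction.norm_le (by positivity)]
  rintro ⟨n, z, v⟩
  rw [BoundedContinuousFunction.coe_sub, Pi.sub_apply, jet_apply, jet_apply, jetFun_translate,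
    jetFun_translate, ← smul_sub, ← sub_apply, norm_smul,
    Real.norm_of_nonneg (by positivity)]
  simp only
  have h1 : 1 + ‖z‖ ≤ (1 + ‖z - y‖) * (1 + ‖y‖) := by
    simpa using one_add_norm_add_le (z - y) y
  have h2 := hS n (z - y) (y - y')
  rw [sub_add_sub_cancel] at h2
  calc _ ≤ ((1 + ‖z - y‖) * (1 + ‖y‖)) ^ N *
          ‖iteratedFDeriv ℝ n η (z - y') - iteratedFDeriv ℝ n η (z - y)‖ := by
        gcongr; exact norm_apply_unit_le _ _
    _ = (1 + ‖y‖) ^ N * ((1 + ‖z - y‖) ^ N *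
          ‖iteratedFDeriv ℝ n η (z - y') - iteratedFDeriv ℝ n η (z - y)‖) := by
        rw [mul_pow]; ring
    _ ≤ (1 + ‖y‖) ^ N * (S n * (1 + ‖y - y'‖) ^ N * ‖y - y'‖) := by gcongr
    _ ≤ _ := by
        gcongr
        exact Finset.single_le_sum (fun i _ => hS0 i) (Finset.mem_univ n)

theorem continuous_apply_translate {d : ℕ} (T : 𝓢'(E d, ℂ)) (η : 𝓢(E d, ℂ)) :
    Continuous fun y => T (translate η y) := by
  obtain ⟨N, L, hL⟩ := exists_eq_clm_jet T
  simp_rw [hL]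
  exact L.continuous.comp (continuous_jet_translate N η)

theorem exists_norm_apply_translate_le {d : ℕ} (T : 𝓢'(E d, ℂ)) (η : 𝓢(E d, ℂ)) :
    ∃ (N : ℕ) (S : ℝ), 0 ≤ S ∧ ∀ y, ‖T (translate η y)‖ ≤ S * (1 + ‖y‖) ^ N := by
  obtain ⟨N, L, hL⟩ := exists_eq_clm_jet T
  obtain ⟨S, hS0, hS⟩ := exists_norm_jet_translate_le N η
  refine ⟨N, ‖L‖ * S, by positivity, fun y => ?_⟩
  rw [hL]
  refine (L.le_opNorm _).trans ?_
  rw [mul_assoc]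
  gcongr
  exact hS y

/-! ### Distributions and convolution -/

-- Differentiation under the integral sign. With line derivatives both sides remain values of
-- Schwartz functions, so the statement can be iterated.
open LineDeriv in
theorem lineDerivOp_eq_integral {d : ℕ} {w : E d → ℂ} (hw : Integrable w) {η ζ : 𝓢(E d, ℂ)}
    (hζ : ∀ z, ζ z = ∫ y, w y * η (z - y)) (v z : E d) :
    (∂_{v} ζ : 𝓢(E d, ℂ)) z = ∫ y, w y * (∂_{v} η : 𝓢(E d, ℂ)) (z - y) := by
  obtain ⟨S, -, hS⟩ := exists_norm_iteratedFDeriv_le η 0 1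
  obtain ⟨S', -, hS'⟩ := exists_norm_iteratedFDeriv_le η 0 0
  have hS1 : ∀ x, ‖fderiv ℝ η x‖ ≤ S := fun x => by
    simpa [norm_iteratedFDeriv_one] using hS x
  have hS0 : ∀ x, ‖η x‖ ≤ S' := fun x => by simpa using hS' x
  have hc : Continuous η := η.continuous
  have hc' : Continuous (fderiv ℝ η) := (η.smooth 1).continuous_fderiv (by norm_num)
  have hint : ∀ z, Integrable fun y => w y * η (z - y) := fun z =>
    hw.mul_bdd (c := S') (Continuous.aestronglyMeasurable (by fun_prop))
      (Filter.Eventually.of_forall fun y => hS0 _)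
  have hint' : Integrable fun y => w y • fderiv ℝ η (z - y) :=
    hw.smul_bdd S (Continuous.aestronglyMeasurable (by fun_prop))
      (Filter.Eventually.of_forall fun y => hS1 _)
  have hd : HasFDerivAt (fun z => ∫ y, w y * η (z - y))
      (∫ y, w y • fderiv ℝ η (z - y)) z := by
    refine hasFDerivAt_integral_of_dominated_of_fderiv_le (s := univ)
      (F' := fun z y => w y • fderiv ℝ η (z - y))
      (bound := fun y => ‖w y‖ * S) Filter.univ_mem
      (Filter.Eventually.of_forall fun z => (hint z).aestronglyMeasurable) (hint z)
      hint'.aestronglyMeasurable ?_ (hw.norm.mul_const S) ?_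
    · refine Filter.Eventually.of_forall fun y z _ => ?_
      rw [norm_smul]
      gcongr
      exact hS1 _
    · refine Filter.Eventually.of_forall fun y z _ => ?_
      have h2 := (η.hasFDerivAt (z - y)).comp z ((hasFDerivAt_id z).sub_const y)
      exact h2.const_smul (w y)
  rw [← show (ζ : E d → ℂ) = fun z => ∫ y, w y * η (z - y) from funext hζ] at hd
  rw [SchwartzMap.lineDerivOp_apply_eq_fderiv, hd.fderiv,
    ContinuousLinearMap.integral_apply hint']
  refine integral_congr_ae (Filter.Eventually.of_forall fun y => ?_)
  simp only [SchwartzMap.lineDerivOp_apply_eq_fderiv]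
  rfl

open LineDeriv in
theorem iteratedLineDerivOp_eq_integral {d : ℕ} {w : E d → ℂ} (hw : Integrable w)
    {η ζ : 𝓢(E d, ℂ)} (hζ : ∀ z, ζ z = ∫ y, w y * η (z - y)) {n : ℕ} (v : Fin n → E d) (z : E d) :
    (∂^{v} ζ : 𝓢(E d, ℂ)) z = ∫ y, w y * (∂^{v} η : 𝓢(E d, ℂ)) (z - y) := by
  induction n generalizing z with
  | zero => simpa using hζ z
  | succ n ih =>
    rw [iteratedLineDerivOp_succ_left, iteratedLineDerivOp_succ_left]
    exact lineDerivOp_eq_integral hw (fun z => ih (Fin.tail v) z) (v 0) z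

/-- A tempered distribution commutes with the convolution of Schwartz functions. -/
theorem integral_mul_apply_translate {d : ℕ} (T : 𝓢'(E d, ℂ)) (w η ζ : 𝓢(E d, ℂ))
    (hζ : ∀ z, ζ z = ∫ y, w y * η (z - y)) : ∫ y, w y * T (translate η y) = T ζ := by
  obtain ⟨N, L, hL⟩ := exists_eq_clm_jet T
  have hint : Integrable fun y => w y • jet N (translate η y) := by
    obtain ⟨S, hS0, hS⟩ := exists_norm_jet_translate_le N η
    -- Of the decay of w, order N compensates the growth of the jets of the translates, and order d
    -- + 1 gives integrability.
    obtain ⟨S', hS'0, hS'⟩ := exists_norm_iteratedFDeriv_le w (N + (d + 1)) 0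
    have hJ : Integrable (fun y : E d => S' * S * (1 + ‖y‖) ^ (-((d : ℝ) + 1))) volume :=
      (integrable_one_add_norm (by simp)).const_mul _
    refine hJ.mono' (w.continuous.smul (continuous_jet_translate N η)).aestronglyMeasurable
      (Filter.Eventually.of_forall fun y => ?_)
    have hy : 0 < 1 + ‖y‖ := by positivity
    have h1 : (1 + ‖y‖) ^ (N + (d + 1)) * ‖w y‖ ≤ S' := by simpa using hS' y
    rw [norm_smul, Real.rpow_neg hy.le, ← div_eq_mul_inv,
      show (d : ℝ) + 1 = ((d + 1 : ℕ) : ℝ) by push_cast; rfl, Real.rpow_natCast,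
      le_div_iff₀ (by positivity)]
    calc ‖w y‖ * ‖jet N (translate η y)‖ * (1 + ‖y‖) ^ (d + 1)
        ≤ ‖w y‖ * (S * (1 + ‖y‖) ^ N) * (1 + ‖y‖) ^ (d + 1) := by gcongr; exact hS y
      _ = ((1 + ‖y‖) ^ (N + (d + 1)) * ‖w y‖) * S := by rw [pow_add]; ring
      _ ≤ S' * S := by gcongr
  -- Evaluation at an index is a continuous functional, so the vector identity reduces to
  -- differentiating the convolution under the integral. Applying L to it gives the claim for T.
  have hjet : ∫ y, w y • jet N (translate η y) = jet N ζ := by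
    ext1 a
    have h1 := (BoundedContinuousFunction.evalCLM ℂ a).integral_comp_comm hint
    refine h1.symm.trans ?_
    rw [jet_apply, jetFun, ← SchwartzMap.iteratedLineDerivOp_eq_iteratedFDeriv,
      iteratedLineDerivOp_eq_integral w.integrable hζ, ← integral_smul]
    refine integral_congr_ae (Filter.Eventually.of_forall fun y => ?_)
    simp only [map_smul]
    change w y • jetFun (translate η y) a = _
    rw [jetFun_translate, SchwartzMap.iteratedLineDerivOp_eq_iteratedFDeriv, smul_comm,
      smul_eq_mul]
  rw [hL, ← hjet, ← L.integral_comp_comm hint]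
  refine integral_congr_ae (Filter.Eventually.of_forall fun y => ?_)
  simp only [map_smul, smul_eq_mul, hL]

/-! ### Convolution with integrable functions -/

/-- The convolution of two functions. -/
def conv {d : ℕ} (K G : E d → ℂ) (x : E d) : ℂ := ∫ t, K t * G (x - t)

theorem multiplierPiece_eq_conv {d : ℕ} (φ : AnnularCutoff d) (ϕ : DyadicResolution d)
    (m : E d → ℂ) (f : TemperedModPoly d) (k : ℤ) :
    multiplierPiece φ ϕ m f k = conv (multiplierKernel φ m k) (proj ϕ k f) := rfl

theorem conv_comm {d : ℕ} (K G : E d → ℂ) : conv K G = conv G K := by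
  ext x
  rw [conv, conv, ← integral_sub_left_eq_self _ volume x]
  simp only [sub_sub_cancel, mul_comm]

theorem conv_apply' {d : ℕ} (K G : E d → ℂ) (x : E d) : conv K G x = ∫ y, K (x - y) * G y := by
  rw [conv_comm, conv]
  simp only [mul_comm]

theorem integrable_mul_comp_sub {d : ℕ} {K G : E d → ℂ} (hK : Integrable K) (hG : Continuous G)
    {B : ℝ} (hB : ∀ x, ‖G x‖ ≤ B) (x : E d) : Integrable fun t => K t * G (x - t) :=
  hK.mul_bdd (c := B) (Continuous.aestronglyMeasurable (by fun_prop))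
    (Filter.Eventually.of_forall fun _ => hB _)

theorem norm_conv_le {d : ℕ} {K G : E d → ℂ} (hK : Integrable K)
    {B : ℝ} (hB : ∀ x, ‖G x‖ ≤ B) (x : E d) : ‖conv K G x‖ ≤ (∫ t, ‖K t‖) * B := by
  rw [← integral_mul_const]
  refine norm_integral_le_of_norm_le (hK.norm.mul_const B)
    (Filter.Eventually.of_forall fun t => ?_)
  rw [norm_mul]
  gcongr
  exact hB _

theorem continuous_conv {d : ℕ} {K G : E d → ℂ} (hK : Integrable K) (hG : Continuous G)
    {B : ℝ} (hB : ∀ x, ‖G x‖ ≤ B) : Continuous (conv K G) := by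
  refine continuous_of_dominated (F := fun x t => K t * G (x - t)) (bound := fun t => ‖K t‖ * B)
    (fun x => (integrable_mul_comp_sub hK hG hB x).aestronglyMeasurable) (fun x => ?_)
    (hK.norm.mul_const B) ?_
  · refine Filter.Eventually.of_forall fun t => ?_
    rw [norm_mul]
    gcongr
    exact hB _
  · exact Filter.Eventually.of_forall fun t => by fun_prop

theorem conv_left_comm {d : ℕ} {K L G : E d → ℂ} (hK : Integrable K) (hL : Integrable L)
    (hG : Continuous G) {B : ℝ} (hB : ∀ x, ‖G x‖ ≤ B) :
    conv L (conv K G) = conv K (conv L G) := by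
  ext x
  simp only [conv]
  simp_rw [← integral_const_mul]
  rw [integral_integral_swap]
  · refine integral_congr_ae (Filter.Eventually.of_forall fun t => ?_)
    refine integral_congr_ae (Filter.Eventually.of_forall fun s => ?_)
    simp only
    rw [sub_right_comm]
    ring
  · have h : Integrable (fun q : E d × E d => L q.1 * K q.2) (volume.prod volume) :=
      hL.mul_prod hK
    have := h.mul_bdd (g := fun q : E d × E d => G (x - q.1 - q.2)) (c := B)
      (Continuous.aestronglyMeasurable (by fun_prop)) (Filter.Eventually.of_forall fun _ => hB _)
    refine this.congr (Filter.Eventually.of_forall fun q => ?_)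
    simp only [Function.uncurry]
    ring

theorem enorm_conv_le {d : ℕ} (K G : E d → ℂ) (x : E d) :
    ‖conv K G x‖ₑ ≤ ∫⁻ y, ‖K (x - y)‖ₑ * ‖G y‖ₑ := by
  rw [conv_apply']
  refine (enorm_integral_le_lintegral_enorm _).trans (le_of_eq ?_)
  simp only [enorm_mul]

/-- The function `G` is reproduced by convolution with `2^{kd} Φ(2^k ·)`. -/
def Reproduces {d : ℕ} (Φ : 𝓢(E d, ℂ)) (k : ℤ) (G : E d → ℂ) : Prop := conv (dil k Φ) G = G

theorem integrable_dil_schwartz {d : ℕ} (k : ℤ) (Φ : 𝓢(E d, ℂ)) : Integrable (dil k Φ) :=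
  integrable_dil k Φ.integrable

theorem dil_zero {d : ℕ} (F : E d → ℂ) : dil 0 F = F := by
  ext x
  simp [dil]

theorem Reproduces.conv {d : ℕ} {Φ : 𝓢(E d, ℂ)} {k : ℤ} {K G : E d → ℂ} (h : Reproduces Φ k G)
    (hK : Integrable K) (hG : Continuous G) {B : ℝ} (hB : ∀ x, ‖G x‖ ≤ B) :
    Reproduces Φ k (conv K G) := by
  unfold Reproduces
  rw [conv_left_comm hK (integrable_dil_schwartz k Φ) hG hB, h]

theorem reproduces_unitKernel {d : ℕ} (φ : AnnularCutoff d) {m : E d → ℂ}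
    (hm : MemLp m ∞ volume) (k : ℤ) {Φ : 𝓢(E d, ℂ)}
    (hΦ : ∀ ξ, 1 / 4 ≤ ‖ξ‖ → ‖ξ‖ ≤ 4 → 𝓕 Φ ξ = 1) : Reproduces Φ 0 (unitKernel φ m k) := by
  unfold Reproduces
  rw [dil_zero, conv_comm]
  ext x
  exact unitKernel_reproducing φ hm k hΦ x

/-! ### Littlewood-Paley pieces of a distribution -/

theorem proj_toModPoly {d : ℕ} (ϕ : DyadicResolution d) (k : ℤ) (T : 𝓢'(E d, ℂ)) (x : E d) :
    proj ϕ k (toModPoly T) x = T (translate (dyadicKernel ϕ.fn k 0) x) := by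
  rw [proj, pairing_toModPoly]
  congr 1
  ext y
  rw [SchwartzMap.compSubConstCLM_apply, dyadicKernel_apply, dyadicKernel_apply]
  congr 3
  abel

theorem exists_toModPoly_eq {d : ℕ} (f : TemperedModPoly d) : ∃ T, toModPoly T = f :=
  Submodule.Quotient.mk_surjective _ f

theorem continuous_proj {d : ℕ} (ϕ : DyadicResolution d) (k : ℤ) (f : TemperedModPoly d) :
    Continuous (proj ϕ k f) := by
  obtain ⟨T, rfl⟩ := exists_toModPoly_eq f
  simp_rw [funext (proj_toModPoly ϕ k T)]
  exact continuous_apply_translate T _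

theorem exists_norm_proj_le {d : ℕ} (ϕ : DyadicResolution d) (k : ℤ) (f : TemperedModPoly d) :
    ∃ (N : ℕ) (S : ℝ), 0 ≤ S ∧ ∀ x, ‖proj ϕ k f x‖ ≤ S * (1 + ‖x‖) ^ N := by
  obtain ⟨T, rfl⟩ := exists_toModPoly_eq f
  simp_rw [proj_toModPoly ϕ k T]
  exact exists_norm_apply_translate_le T _

/-- The outer convolution is moved onto the test function. The resulting test function ζ is an
argument, described by its Fourier side, so that it can be recognised as ϕ_k(x - ·) in
`reproduces_proj` and as 0 in `conv_dil_fn_proj_eq_zero`. -/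
theorem conv_dil_proj {d : ℕ} (ϕ : DyadicResolution d) (k j : ℤ) (T : 𝓢'(E d, ℂ))
    (Φ : 𝓢(E d, ℂ)) (x : E d) (ζ : 𝓢(E d, ℂ))
    (hζ : ∀ z, ζ z = 𝓕⁻ (fun ξ => 𝓕 Φ ((2 : ℝ) ^ (-j) • ξ) * 𝓕 ϕ.fn ((2 : ℝ) ^ (-k) • ξ))
      (x - z)) :
    conv (dil j Φ) (proj ϕ k (toModPoly T)) x = T ζ := by
  rw [conv_apply']
  rw [← integral_mul_apply_translate T (dyadicKernel Φ j x) (dyadicKernel ϕ.fn k 0) ζ]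
  · simp only [proj_toModPoly, dyadicKernel_eq_dil]
  · intro z
    rw [hζ, ← integral_dil_mul_dil]
    refine integral_congr_ae (Filter.Eventually.of_forall fun y => ?_)
    simp only [dyadicKernel_eq_dil]
    rw [zero_sub, neg_sub]

theorem fourierInv_comp_zpow_smul {d : ℕ} (g : 𝓢(E d, ℂ)) (k : ℤ) (x : E d) :
    𝓕⁻ (fun ξ => 𝓕 g ((2 : ℝ) ^ (-k) • ξ)) x = dil k g x := by
  have h : (fun ξ => 𝓕 g ((2 : ℝ) ^ (-k) • ξ)) = 𝓕⁻ (dyadicKernel g k 0 : E d → ℂ) := by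
    ext ξ
    rw [fourierInv_dyadicKernel]
    simp
  rw [h, Real.fourierInv_eq_fourier_neg, ← SchwartzMap.fourierInv_coe, ← SchwartzMap.fourier_coe,
    FourierTransform.fourier_fourierInv_eq, dyadicKernel_eq_dil, zero_sub, neg_neg]

theorem fourier_fn_eq_zero {d : ℕ} (ϕ : DyadicResolution d) {ξ : E d}
    (h : ¬(1 / 2 ≤ ‖ξ‖ ∧ ‖ξ‖ ≤ 2)) : 𝓕 ϕ.fn ξ = 0 := by
  by_contra hne
  exact h (ϕ.tsupport_fourier (subset_tsupport _ (Function.mem_support.mpr hne)))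

theorem reproduces_proj {d : ℕ} (ϕ : DyadicResolution d) (k : ℤ) (f : TemperedModPoly d)
    {Φ : 𝓢(E d, ℂ)} (hΦ : ∀ ξ, 1 / 4 ≤ ‖ξ‖ → ‖ξ‖ ≤ 4 → 𝓕 Φ ξ = 1) :
    Reproduces Φ k (proj ϕ k f) := by
  obtain ⟨T, rfl⟩ := exists_toModPoly_eq f
  ext x
  rw [conv_dil_proj ϕ k k T Φ x (dyadicKernel ϕ.fn k x), proj, pairing_toModPoly]
  intro z
  rw [dyadicKernel_eq_dil, ← fourierInv_comp_zpow_smul]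
  refine congrFun (congrArg _ (funext fun ξ => ?_)) _
  by_cases h : 1 / 2 ≤ ‖(2 : ℝ) ^ (-k) • ξ‖ ∧ ‖(2 : ℝ) ^ (-k) • ξ‖ ≤ 2
  · rw [hΦ _ (by linarith [h.1]) (by linarith [h.2]), one_mul]
  · rw [fourier_fn_eq_zero ϕ h, mul_zero]

/-- The two spectral annuli are disjoint, except that for |j - k| = 2 they share a sphere. There the
product still vanishes, because the transform of ϕ is continuous and is zero for |ξ| > 2. -/
theorem conv_dil_fn_proj_eq_zero {d : ℕ} (ϕ : DyadicResolution d) {j k : ℤ}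
    (hjk : 2 ≤ (j - k).natAbs) (f : TemperedModPoly d) :
    conv (dil j ϕ.fn) (proj ϕ k f) = 0 := by
  obtain ⟨T, rfl⟩ := exists_toModPoly_eq f
  ext x
  rw [conv_dil_proj ϕ k j T ϕ.fn x 0]
  · simp
  intro z
  have key : ∀ {a b : ℤ} (ξ : E d), a + 2 ≤ b →
      𝓕 ϕ.fn ((2 : ℝ) ^ (-a) • ξ) * 𝓕 ϕ.fn ((2 : ℝ) ^ (-b) • ξ) = 0 := by
    intro a b ξ hab
    by_cases h : 1 / 2 ≤ ‖(2 : ℝ) ^ (-a) • ξ‖ ∧ ‖(2 : ℝ) ^ (-a) • ξ‖ ≤ 2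
    swap
    · rw [fourier_fn_eq_zero ϕ h, zero_mul]
    by_cases h' : 1 / 2 ≤ ‖(2 : ℝ) ^ (-b) • ξ‖ ∧ ‖(2 : ℝ) ^ (-b) • ξ‖ ≤ 2
    swap
    · rw [fourier_fn_eq_zero ϕ h', mul_zero]
    have hz : ∀ n : ℤ, ‖(2 : ℝ) ^ n • ξ‖ = 2 ^ n * ‖ξ‖ := fun n => by
      rw [norm_smul, Real.norm_of_nonneg (by positivity)]
    have h4 : (2 : ℝ) ^ (-b) * 4 ≤ 2 ^ (-a) := by
      rw [show (4 : ℝ) = 2 ^ (2 : ℤ) by norm_num, ← zpow_add₀ two_ne_zero]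
      exact zpow_le_zpow_right₀ one_le_two (by omega)
    have h5 : ‖(2 : ℝ) ^ (-b) • ξ‖ * 4 ≤ ‖(2 : ℝ) ^ (-a) • ξ‖ := by
      rw [hz, hz]
      nlinarith [norm_nonneg ξ]
    -- Only the common boundary sphere is left; it is approached from outside along t ↦ t • η, t >
    -- 1.
    have h6 : ‖(2 : ℝ) ^ (-a) • ξ‖ = 2 := le_antisymm h.2 (by linarith [h'.1])
    have h7 : 𝓕 ϕ.fn ((2 : ℝ) ^ (-a) • ξ) = 0 := by
      by_contra hne
      set η := (2 : ℝ) ^ (-a) • ξ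
      have hcont : Continuous fun t : ℝ => 𝓕 ϕ.fn (t • η) :=
        (𝓕 ϕ.fn).continuous.comp (by fun_prop)
      have hev : ∀ᶠ t in nhds (1 : ℝ), 𝓕 ϕ.fn (t • η) ≠ 0 :=
        hcont.continuousAt.eventually_ne (by simpa using hne)
      obtain ⟨t, ht, ht1⟩ := ((hev.filter_mono nhdsWithin_le_nhds).and
        (self_mem_nhdsWithin (s := Ioi (1 : ℝ)))).exists
      refine ht (fourier_fn_eq_zero ϕ fun hcon => ?_)
      have ht1' : (1 : ℝ) < t := ht1
      have h8 := hcon.2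
      rw [norm_smul, h6, Real.norm_of_nonneg (by linarith)] at h8
      linarith
    rw [h7, zero_mul]
  have hzero : (fun ξ : E d => 𝓕 ϕ.fn ((2 : ℝ) ^ (-j) • ξ) * 𝓕 ϕ.fn ((2 : ℝ) ^ (-k) • ξ)) = 0 := by
    ext ξ
    rcases le_total j k with h | h
    · exact key ξ (by omega)
    · rw [mul_comm]
      exact key ξ (by omega)
  rw [hzero, Real.fourierInv_eq]
  simp

/-! ### Norm inequalities for reproduced functions -/

theorem exists_enorm_schwartz_le {d : ℕ} (Φ : 𝓢(E d, ℂ)) (a : ℝ) :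
    ∃ A : ℝ≥0∞, A ≠ ∞ ∧ ∀ x, ‖Φ x‖ₑ ≤ A * wt x ^ (-a) := by
  obtain ⟨N, hN⟩ := exists_nat_ge a
  obtain ⟨S, hS0, hS⟩ := exists_norm_iteratedFDeriv_le Φ N 0
  refine ⟨ENNReal.ofReal S, ENNReal.ofReal_ne_top, fun x => ?_⟩
  have h1 : wt x ^ a * ‖Φ x‖ₑ ≤ ENNReal.ofReal S := by
    calc wt x ^ a * ‖Φ x‖ₑ ≤ wt x ^ (N : ℝ) * ‖Φ x‖ₑ := by
          gcongr
          exact one_le_wt x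
      _ = ENNReal.ofReal ((1 + ‖x‖) ^ N * ‖Φ x‖) := by
          rw [ENNReal.ofReal_mul (by positivity), ENNReal.ofReal_pow (by positivity),
            ofReal_one_add_norm, ofReal_norm, ENNReal.rpow_natCast]
      _ ≤ _ := ENNReal.ofReal_le_ofReal (by simpa using hS x)
  calc ‖Φ x‖ₑ = (wt x ^ a * ‖Φ x‖ₑ) * wt x ^ (-a) := by
        rw [mul_right_comm, wt_rpow_mul_rpow_neg, one_mul]
    _ ≤ _ := by gcongr

theorem exists_enorm_le_lintegral {d : ℕ} (Φ : 𝓢(E d, ℂ)) (a : ℝ) :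
    ∃ A : ℝ≥0∞, A ≠ ∞ ∧ ∀ g : E d → ℂ, Reproduces Φ 0 g → ∀ x,
      ‖g x‖ₑ ≤ ∫⁻ z, ‖g z‖ₑ * (A * wt (x - z) ^ (-a)) := by
  obtain ⟨A, hA, h⟩ := exists_enorm_schwartz_le Φ a
  refine ⟨A, hA, fun g hg x => ?_⟩
  have hg' : conv Φ g x = g x := by
    have := congrFun hg x
    rwa [dil_zero] at this
  rw [← hg']
  refine (enorm_conv_le _ _ x).trans (lintegral_mono fun y => ?_)
  rw [mul_comm]
  gcongr
  exact h _

/-- Peetre's argument with a = N/u, so that the exponent a u in the average is N. The constant A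
depends on Φ, u and N only, not on the growth constant S of g. -/
theorem exists_enorm_rpow_le_lintegral {d : ℕ} (Φ : 𝓢(E d, ℂ)) {u N : ℝ} (hu : 0 < u)
    (hu1 : u ≤ 1) (hN : 0 ≤ N) :
    ∃ A : ℝ≥0∞, A ≠ ∞ ∧ ∀ g : E d → ℂ, Continuous g → Reproduces Φ 0 g →
      (∃ S : ℝ, ∀ x, ‖g x‖ ≤ S * (1 + ‖x‖) ^ (N / u)) → ∀ x,
      ‖g x‖ₑ ^ u ≤ A * ∫⁻ z, ‖g z‖ₑ ^ u * wt (x - z) ^ (-N) := by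
  obtain ⟨A, hA, h⟩ := exists_enorm_le_lintegral Φ (N / u)
  refine ⟨A, hA, fun g hgc hg ⟨S, hS⟩ x => ?_⟩
  have := rpow_le_of_le_lintegral (f := fun x => ‖g x‖ₑ) (by fun_prop) (A := A)
    (B := ENNReal.ofReal S) ENNReal.ofReal_ne_top (a := N / u) (by positivity) hu hu1 (h g hg)
    (fun y => by
      rw [← ofReal_norm, ← ofReal_one_add_norm, ENNReal.ofReal_rpow_of_pos (by positivity),
        ← ENNReal.ofReal_mul' (by positivity)]
      exact ENNReal.ofReal_le_ofReal (hS y)) x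
  rwa [div_mul_cancel₀ _ hu.ne'] at this

/-- Nikolskii's inequality at unit scale. -/
theorem exists_enorm_le_eLpNorm_unit {d : ℕ} (Φ : 𝓢(E d, ℂ)) {p : ℝ≥0∞} (hp : p ≠ 0) :
    ∃ C : ℝ≥0∞, C ≠ ∞ ∧ ∀ g : E d → ℂ, Continuous g → Reproduces Φ 0 g →
      (∃ (N : ℕ) (S : ℝ), 0 ≤ S ∧ ∀ x, ‖g x‖ ≤ S * (1 + ‖x‖) ^ N) → ∀ x,
      ‖g x‖ₑ ≤ C * eLpNorm g p volume := by
  have hwt := measurable_wt (d := d)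
  have hd : (d : ℝ) < d + 1 := lt_add_one _
  set c : ℝ≥0∞ := ∫⁻ z : E d, wt z ^ (-((d : ℝ) + 1)) with hc
  have hctop : c ≠ ∞ := lintegral_wt_ne_top hd
  obtain ⟨A, hA, h⟩ := exists_enorm_le_lintegral Φ ((d : ℝ) + 1)
  rcases eq_or_ne p ∞ with rfl | hpt
  · refine ⟨A * c, ENNReal.mul_ne_top hA hctop, fun g hgc hg _ x => (h g hg x).trans ?_⟩
    calc ∫⁻ z, ‖g z‖ₑ * (A * wt (x - z) ^ (-((d : ℝ) + 1)))
        ≤ ∫⁻ z, eLpNorm g ∞ volume * (A * wt (x - z) ^ (-((d : ℝ) + 1))) := by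
          refine lintegral_mono_ae ?_
          filter_upwards [enorm_ae_le_eLpNormEssSup g volume] with z hz
          rw [eLpNorm_exponent_top]
          gcongr
      _ = _ := by
          rw [lintegral_const_mul _ (by fun_prop), lintegral_const_mul _ (by fun_prop),
            lintegral_wt_sub_left]
          ring
  have hp' : 0 < p.toReal := ENNReal.toReal_pos hp hpt
  rcases le_or_gt 1 p.toReal with h1 | h1
  · set B := (A * c) ^ (p.toReal - 1) * A with hB
    refine ⟨B ^ p.toReal⁻¹, ?_, fun g hgc hg _ x => le_mul_of_rpow_le hp' ?_⟩
    · exact ENNReal.rpow_ne_top_of_nonneg (by positivity) (ENNReal.mul_ne_top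
        (ENNReal.rpow_ne_top_of_nonneg (by linarith) (ENNReal.mul_ne_top hA hctop)) hA)
    rw [eLpNorm_rpow_eq_lintegral hp hpt]
    refine (ENNReal.rpow_le_rpow (h g hg x) hp'.le).trans ?_
    refine (lintegral_mul_rpow_le (by fun_prop) (by fun_prop) h1).trans ?_
    rw [lintegral_const_mul _ (by fun_prop), lintegral_wt_sub_left, hB, mul_assoc,
      ← lintegral_const_mul (μ := volume) A (f := fun x => ‖g x‖ₑ ^ p.toReal) (by fun_prop)]
    refine mul_le_mul' le_rfl (lintegral_mono fun z => ?_)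
    rw [mul_comm A (_ ^ p.toReal)]
    exact mul_le_mul' le_rfl
      (mul_le_of_le_one_right zero_le (wt_rpow_neg_le_one _ (a := (d : ℝ) + 1) (by positivity)))
  · obtain ⟨A₀, hA₀, h₀⟩ := exists_enorm_rpow_le_lintegral Φ hp' h1.le le_rfl
    -- The added 1 keeps the constant nonzero, so that its product with an infinite norm is
    -- infinite.
    refine ⟨(A₀ + 1) ^ p.toReal⁻¹,
      ENNReal.rpow_ne_top_of_nonneg (by positivity) (by simp [hA₀]), fun g hgc hg hgrowth x => ?_⟩
    rcases eq_or_ne (eLpNorm g p volume) ∞ with htop | htop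
    · rw [htop, ENNReal.mul_top]
      · exact le_top
      · exact (ENNReal.rpow_pos (by simp) (by simp [hA₀])).ne'
    obtain ⟨N, S, hS0, hS⟩ := hgrowth
    -- The degree of growth of g is arbitrary and would enter the constant. A first pass with that
    -- degree only shows that g is bounded; a second pass with exponent 0 then gives a constant
    -- independent of g.
    have hbdd : ∃ S : ℝ, ∀ x, ‖g x‖ ≤ S := by
      obtain ⟨A₁, hA₁, h₁⟩ := exists_enorm_rpow_le_lintegral Φ hp' h1.le
        (N := N * p.toReal) (by positivity)
      refine ⟨((A₁ ^ p.toReal⁻¹) * eLpNorm g p volume).toReal, fun x => ?_⟩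
      have hle : ‖g x‖ₑ ≤ (A₁ ^ p.toReal⁻¹) * eLpNorm g p volume := by
        refine le_mul_of_rpow_le hp' ?_
        rw [eLpNorm_rpow_eq_lintegral hp hpt]
        refine (h₁ g hgc hg ⟨S, fun y => ?_⟩ x).trans ?_
        · rw [mul_div_cancel_right₀ _ hp'.ne', Real.rpow_natCast]
          exact hS y
        · gcongr with z
          exact mul_le_of_le_one_right zero_le (wt_rpow_neg_le_one _ (by positivity))
      rw [← toReal_enorm]
      exact ENNReal.toReal_mono (ENNReal.mul_ne_top
        (ENNReal.rpow_ne_top_of_nonneg (by positivity) hA₁) htop) hle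
    obtain ⟨S', hS'⟩ := hbdd
    refine le_mul_of_rpow_le hp' ?_
    rw [eLpNorm_rpow_eq_lintegral hp hpt]
    refine (h₀ g hgc hg ⟨S', fun y => by simpa using hS' y⟩ x).trans ?_
    simp only [neg_zero, ENNReal.rpow_zero, mul_one]
    gcongr
    exact le_self_add

/-- The basic convolution inequality at unit scale. -/
theorem exists_eLpNorm_conv_le_unit {d : ℕ} (Φ : 𝓢(E d, ℂ)) {p : ℝ≥0∞} (hp : p ≠ 0) :
    ∃ C : ℝ≥0∞, C ≠ ∞ ∧ ∀ K G : E d → ℂ, Continuous K → Continuous G → Reproduces Φ 0 K →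
      Reproduces Φ 0 G → (∃ S : ℝ, ∀ x, ‖K x‖ ≤ S) → (∃ S : ℝ, ∀ x, ‖G x‖ ≤ S) →
      eLpNorm (conv K G) p volume ≤ C * eLpNorm K (min 1 p) volume * eLpNorm G p volume := by
  rcases le_or_gt 1 p with h1 | h1
  · refine ⟨1, ENNReal.one_ne_top, fun K G hK hG _ _ _ _ => ?_⟩
    rw [min_eq_left h1, one_mul]
    rcases eq_or_ne p ∞ with rfl | hpt
    · rw [eLpNorm_exponent_top, eLpNorm_exponent_top]
      refine eLpNormEssSup_le_of_ae_enorm_bound (Filter.Eventually.of_forall fun x => ?_)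
      refine (enorm_conv_le K G x).trans ?_
      rw [eLpNorm_one_eq_lintegral_enorm, ← lintegral_mul_const _ (by fun_prop),
        ← lintegral_sub_left_eq_self (fun z => ‖K z‖ₑ * eLpNormEssSup G volume) x]
      refine lintegral_mono_ae ?_
      filter_upwards [enorm_ae_le_eLpNormEssSup G volume] with z hz
      gcongr
    have hp1 : 1 ≤ p.toReal := by
      simpa using ENNReal.toReal_mono hpt h1
    have hp' : 0 < p.toReal := by linarith
    have key := lintegral_lconv_rpow_le_of_one_le (k := fun x => ‖K x‖ₑ) (g := fun x => ‖G x‖ₑ)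
      (by fun_prop) (by fun_prop) hp1
    suffices h : eLpNorm (conv K G) p volume ≤
        1 ^ p.toReal⁻¹ * (eLpNorm K 1 volume * eLpNorm G p volume) by
      simpa only [ENNReal.one_rpow, one_mul] using h
    refine le_mul_of_rpow_le hp' ?_
    rw [one_mul, ENNReal.mul_rpow_of_nonneg _ _ hp'.le, eLpNorm_rpow_eq_lintegral hp hpt,
      eLpNorm_rpow_eq_lintegral hp hpt, eLpNorm_one_eq_lintegral_enorm]
    refine le_trans (lintegral_mono fun x => ?_) key
    exact ENNReal.rpow_le_rpow (enorm_conv_le K G x) hp'.le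
  · have hpt : p ≠ ∞ := h1.ne_top
    have hp' : 0 < p.toReal := ENNReal.toReal_pos hp hpt
    have hp1 : p.toReal ≤ 1 := by
      simpa using ENNReal.toReal_mono ENNReal.one_ne_top h1.le
    -- Decay of order d + 1 makes the averaging weight integrable.
    obtain ⟨A, hA, hΦ⟩ := exists_enorm_rpow_le_lintegral Φ hp' hp1 (N := d + 1) (by positivity)
    obtain ⟨C, hC, h⟩ := exists_lintegral_lconv_rpow_le (d := d) hp' hp1 (lt_add_one (d : ℝ)) hA
    refine ⟨C ^ p.toReal⁻¹, ENNReal.rpow_ne_top_of_nonneg (by positivity) hC,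
      fun K G hK hG hKr hGr hKb hGb => ?_⟩
    have hgrow : ∀ F : E d → ℂ, (∃ S : ℝ, ∀ x, ‖F x‖ ≤ S) →
        ∃ S : ℝ, ∀ x, ‖F x‖ ≤ S * (1 + ‖x‖) ^ (((d : ℝ) + 1) / p.toReal) := by
      rintro F ⟨S, hS⟩
      refine ⟨S, fun x => (hS x).trans ?_⟩
      have hS0 : 0 ≤ S := (norm_nonneg _).trans (hS x)
      exact le_mul_of_one_le_right hS0
        (Real.one_le_rpow (le_add_of_nonneg_right (norm_nonneg x)) (by positivity))
    rw [min_eq_right h1.le, mul_assoc]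
    refine le_mul_of_rpow_le hp' ?_
    rw [ENNReal.mul_rpow_of_nonneg _ _ hp'.le, eLpNorm_rpow_eq_lintegral hp hpt,
      eLpNorm_rpow_eq_lintegral hp hpt, eLpNorm_rpow_eq_lintegral hp hpt, ← mul_assoc]
    refine le_trans (lintegral_mono fun x => ?_) (h (fun x => ‖K x‖ₑ) (fun x => ‖G x‖ₑ)
      (by fun_prop) (by fun_prop) (hΦ K hK hKr (hgrow K hKb)) (hΦ G hG hGr (hgrow G hGb)))
    exact ENNReal.rpow_le_rpow (enorm_conv_le K G x) hp'.le

/-! ### Scaling -/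

theorem eLpNorm_comp_zpow_smul {d : ℕ} (k : ℤ) {F : E d → ℂ} (hF : Continuous F) (p : ℝ≥0∞) :
    eLpNorm (fun x => F ((2 : ℝ) ^ k • x)) p volume =
      2 ^ (-(k * d) * (1 / p).toReal : ℝ) * eLpNorm F p volume := by
  have h2 : (0 : ℝ) < (2 : ℝ) ^ k := by positivity
  have hmap := Measure.map_addHaar_smul (volume : Measure (E d)) h2.ne'
  have h := eLpNorm_map_measure (f := fun x : E d => (2 : ℝ) ^ k • x) (μ := volume) (g := F)
    (p := p) hF.aestronglyMeasurable (by fun_prop)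
  rw [hmap, eLpNorm_smul_measure_of_ne_zero (by simp; positivity)] at h
  change eLpNorm (F ∘ fun x => (2 : ℝ) ^ k • x) p volume = _
  rw [← h, smul_eq_mul, ENNReal.rpow_mul]
  congr 2
  simp only [finrank_euclideanSpace, Fintype.card_fin]
  rw [abs_of_pos (by positivity), show (2 : ℝ≥0∞) = ENNReal.ofReal 2 by simp,
    ENNReal.ofReal_rpow_of_pos (by norm_num), Real.rpow_neg (by norm_num), Real.rpow_mul (by norm_num),
    Real.rpow_intCast, Real.rpow_natCast]

theorem zpow_neg_smul_zpow_smul {d : ℕ} (k : ℤ) (x : E d) :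
    (2 : ℝ) ^ (-k) • (2 : ℝ) ^ k • x = x := by
  rw [smul_smul, ← zpow_add₀ two_ne_zero, neg_add_cancel, zpow_zero, one_smul]

theorem conv_dil_comp {d : ℕ} (k : ℤ) (K G : E d → ℂ) (x : E d) :
    conv (dil k K) G ((2 : ℝ) ^ (-k) • x) = conv K (fun y => G ((2 : ℝ) ^ (-k) • y)) x := by
  rw [conv, conv, ← integral_comp_zpow_smul k (fun t => K t * G ((2 : ℝ) ^ (-k) • (x - t))),
    ← integral_const_mul]
  refine integral_congr_ae (Filter.Eventually.of_forall fun t => ?_)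
  simp only [dil]
  rw [smul_sub, zpow_neg_smul_zpow_smul]
  ring

theorem Reproduces.comp_zpow_smul {d : ℕ} {Φ : 𝓢(E d, ℂ)} {k : ℤ} {G : E d → ℂ}
    (h : Reproduces Φ k G) : Reproduces Φ 0 (fun y => G ((2 : ℝ) ^ (-k) • y)) := by
  unfold Reproduces
  ext x
  rw [dil_zero, ← conv_dil_comp, h]

theorem two_rpow_ne_zero (s : ℝ) : (2 : ℝ≥0∞) ^ s ≠ 0 := by simp [ENNReal.rpow_eq_zero_iff]

theorem two_rpow_ne_top (s : ℝ) : (2 : ℝ≥0∞) ^ s ≠ ∞ :=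
  ENNReal.rpow_ne_top_of_ne_zero two_ne_zero ENNReal.ofNat_ne_top

/-- Nikolskii's inequality. -/
theorem exists_enorm_le_eLpNorm {d : ℕ} (Φ : 𝓢(E d, ℂ)) {p : ℝ≥0∞} (hp : p ≠ 0) :
    ∃ C : ℝ≥0∞, C ≠ ∞ ∧ ∀ (k : ℤ) (G : E d → ℂ), Continuous G → Reproduces Φ k G →
      (∃ (N : ℕ) (S : ℝ), 0 ≤ S ∧ ∀ x, ‖G x‖ ≤ S * (1 + ‖x‖) ^ N) → ∀ x,
      ‖G x‖ₑ ≤ C * (2 ^ (k * d * (1 / p).toReal : ℝ) * eLpNorm G p volume) := by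
  obtain ⟨C, hC, h⟩ := exists_enorm_le_eLpNorm_unit Φ hp
  refine ⟨C, hC, fun k G hG hGr ⟨N, S, hS0, hS⟩ x => ?_⟩
  have h1 := h (fun y => G ((2 : ℝ) ^ (-k) • y)) (by fun_prop) hGr.comp_zpow_smul
    ⟨N, S * (1 + (2 : ℝ) ^ (-k)) ^ N, by positivity, fun y => ?_⟩ ((2 : ℝ) ^ k • x)
  · rw [zpow_neg_smul_zpow_smul, eLpNorm_comp_zpow_smul (-k) hG] at h1
    convert h1 using 5
    push_cast
    ring
  · refine (hS _).trans ?_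
    rw [mul_assoc, ← mul_pow, norm_smul, Real.norm_of_nonneg (by positivity)]
    gcongr
    have : (0 : ℝ) < 2 ^ (-k) := by positivity
    nlinarith [norm_nonneg y]

/-- The basic convolution inequality. -/
theorem exists_eLpNorm_conv_dil_le {d : ℕ} (Φ : 𝓢(E d, ℂ)) {p : ℝ≥0∞} (hp : p ≠ 0) :
    ∃ C : ℝ≥0∞, C ≠ ∞ ∧ ∀ (k : ℤ) (K G : E d → ℂ), Continuous K → Continuous G → Integrable K →
      Reproduces Φ 0 K → Reproduces Φ k G → (∃ S : ℝ, ∀ x, ‖K x‖ ≤ S) →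
      (∃ S : ℝ, ∀ x, ‖G x‖ ≤ S) →
      eLpNorm (conv (dil k K) G) p volume ≤
        C * eLpNorm K (min 1 p) volume * eLpNorm G p volume := by
  obtain ⟨C, hC, h⟩ := exists_eLpNorm_conv_le_unit Φ hp
  refine ⟨C, hC, fun k K G hK hG hKi hKr hGr hKb ⟨S, hS⟩ => ?_⟩
  have h1 := h K (fun y => G ((2 : ℝ) ^ (-k) • y)) hK (by fun_prop) hKr hGr.comp_zpow_smul hKb
    ⟨S, fun x => hS _⟩
  rw [← funext (conv_dil_comp k K G),
    eLpNorm_comp_zpow_smul (-k) (continuous_conv (integrable_dil k hKi) hG hS),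
    eLpNorm_comp_zpow_smul (-k) hG, mul_left_comm] at h1
  -- Rescaling puts the same power of 2 on both sides, so the unit-scale constant serves every
  -- scale.
  exact (ENNReal.mul_le_mul_iff_right (two_rpow_ne_zero _) (two_rpow_ne_top _)).1 h1

/-! ### The multiplier operator on Schwartz functions -/

/-- The Schwartz function `\hat h \hat{ϕ_k}`. -/
def fourierProj {d : ℕ} (ϕ : DyadicResolution d) (k : ℤ) (h : 𝓢(E d, ℂ)) : 𝓢(E d, ℂ) :=
  SchwartzMap.smulLeftCLM ℂ ⇑(𝓕 h : 𝓢(E d, ℂ)) (𝓕⁻ (dyadicKernel ϕ.fn k 0))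

theorem fourierProj_apply {d : ℕ} (ϕ : DyadicResolution d) (k : ℤ) (h : 𝓢(E d, ℂ)) (ξ : E d) :
    fourierProj ϕ k h ξ = 𝓕 h ξ * 𝓕 ϕ.fn ((2 : ℝ) ^ (-k) • ξ) := by
  rw [fourierProj, SchwartzMap.smulLeftCLM_apply_apply (by fun_prop), SchwartzMap.fourierInv_coe,
    fourierInv_dyadicKernel]
  simp

theorem proj_schwartz {d : ℕ} (ϕ : DyadicResolution d) (k : ℤ) (h : 𝓢(E d, ℂ)) :
    proj ϕ k (toModPoly (h : 𝓢'(E d, ℂ))) = (𝓕⁻ (fourierProj ϕ k h) : 𝓢(E d, ℂ)) := by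
  ext x
  rw [proj, pairing_toModPoly, SchwartzMap.coe_apply]
  have h1 := integral_fourierInv_mul_dyadicKernel (𝓕 h : 𝓢(E d, ℂ)).integrable ϕ.fn k x
  rw [← SchwartzMap.fourierInv_coe, FourierTransform.fourierInv_fourier_eq] at h1
  rw [SchwartzMap.fourierInv_coe, funext (fourierProj_apply ϕ k h), ← h1]
  refine integral_congr_ae (Filter.Eventually.of_forall fun y => ?_)
  simp only [smul_eq_mul, dyadicKernel_eq_dil]
  ring

theorem integrable_mul_fourierProj {d : ℕ} (ϕ : DyadicResolution d) {m : E d → ℂ}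
    (hm : MemLp m ∞ volume) (k : ℤ) (h : 𝓢(E d, ℂ)) :
    Integrable (fun ξ => m ξ * fourierProj ϕ k h ξ) volume :=
  (fourierProj ϕ k h).integrable.mul_of_top_right hm

theorem cutoff_mul_fourier_fn {d : ℕ} (φ : AnnularCutoff d) (ϕ : DyadicResolution d) (ξ : E d) :
    (φ.fn ξ : ℂ) * 𝓕 ϕ.fn ξ = 𝓕 ϕ.fn ξ := by
  by_cases h : 1 / 2 ≤ ‖ξ‖ ∧ ‖ξ‖ ≤ 2
  · rw [φ.eq_one ξ h.1 h.2]
    simp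
  · rw [fourier_fn_eq_zero ϕ h, mul_zero]

theorem conv_multiplierKernel_schwartz {d : ℕ} (φ : AnnularCutoff d) (ϕ : DyadicResolution d)
    {m : E d → ℂ} (hm : MemLp m ∞ volume) (k : ℤ) (h : 𝓢(E d, ℂ)) :
    conv (multiplierKernel φ m k) (𝓕⁻ (fourierProj ϕ k h) : 𝓢(E d, ℂ)) =
      𝓕⁻ (fun ξ => m ξ * fourierProj ϕ k h ξ) := by
  ext x
  have h1 := integral_fourierInv_mul_dyadicKernel (integrable_mul_cutoff φ hm k)
    (𝓕⁻ (fourierProj ϕ k h) : 𝓢(E d, ℂ)) 0 x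
  rw [dil_zero] at h1
  rw [conv, multiplierKernel, h1]
  refine congrFun (congrArg _ (funext fun ξ => ?_)) x
  rw [FourierTransform.fourier_fourierInv_eq, neg_zero, zpow_zero, one_smul, fourierProj_apply]
  linear_combination (m ξ * 𝓕 h ξ) * cutoff_mul_fourier_fn φ ϕ ((2 : ℝ) ^ (-k) • ξ)

/-- Finite overlap: with k₀ the integer part of log₂|ξ|, at most three dyadic annuli contain ξ. -/
theorem exists_natAbs_sub_le {d : ℕ} (ξ : E d) : ∃ k₀ : ℤ, ∀ (ϕ : DyadicResolution d) (k : ℤ),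
    k ∉ Finset.Icc (k₀ - 1) (k₀ + 1) → 𝓕 ϕ.fn ((2 : ℝ) ^ (-k) • ξ) = 0 := by
  rcases eq_or_ne ξ 0 with rfl | hξ
  · refine ⟨0, fun ϕ k _ => fourier_fn_eq_zero ϕ ?_⟩
    norm_num
  have hpos : 0 < ‖ξ‖ := norm_pos_iff.2 hξ
  have hlo := Int.zpow_log_le_self (b := 2) (r := ‖ξ‖) one_lt_two hpos
  have hhi := Int.lt_zpow_succ_log_self (b := 2) one_lt_two ‖ξ‖
  refine ⟨Int.log 2 ‖ξ‖, fun ϕ k hk => fourier_fn_eq_zero ϕ ?_⟩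
  rintro ⟨h1, h2⟩
  have hk0 : (0 : ℝ) < 2 ^ k := by positivity
  rw [norm_smul, Real.norm_of_nonneg (by positivity), zpow_neg, inv_mul_eq_div] at h1 h2
  rw [le_div_iff₀ hk0] at h1
  rw [div_le_iff₀ hk0] at h2
  have h1' : (2 : ℝ) ^ (k - 1) < 2 ^ (Int.log 2 ‖ξ‖ + 1) := by
    rw [zpow_sub_one₀ two_ne_zero]
    push_cast at hhi
    linarith
  have h2' : (2 : ℝ) ^ (Int.log 2 ‖ξ‖) ≤ 2 ^ (k + 1) := by
    rw [zpow_add_one₀ two_ne_zero]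
    push_cast at hlo
    linarith
  have h1'' := (zpow_lt_zpow_iff_right₀ (one_lt_two (α := ℝ))).1 h1'
  have h2'' := (zpow_le_zpow_iff_right₀ (one_lt_two (α := ℝ))).1 h2'
  refine hk (Finset.mem_Icc.2 ⟨by omega, by omega⟩)

theorem exists_tsum_enorm_fourier_fn_le {d : ℕ} (ϕ : DyadicResolution d) :
    ∃ A : ℝ≥0∞, A ≠ ∞ ∧ ∀ ξ : E d, ∑' k : ℤ, ‖𝓕 ϕ.fn ((2 : ℝ) ^ (-k) • ξ)‖ₑ ≤ A := by
  obtain ⟨A, hA, h⟩ := exists_enorm_schwartz_le (𝓕 ϕ.fn : 𝓢(E d, ℂ)) 0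
  refine ⟨3 * A, ENNReal.mul_ne_top (by simp) hA, fun ξ => ?_⟩
  obtain ⟨k₀, hk₀⟩ := exists_natAbs_sub_le ξ
  rw [tsum_eq_sum (s := Finset.Icc (k₀ - 1) (k₀ + 1)) fun k hk => by rw [hk₀ ϕ k hk, enorm_zero]]
  refine (Finset.sum_le_card_nsmul _ _ A fun k _ => by simpa using h _).trans (le_of_eq ?_)
  rw [Int.card_Icc, show (k₀ + 1 + 1 - (k₀ - 1)).toNat = 3 by omega, nsmul_eq_mul]
  norm_num

/-- By finite overlap the sum of the absolute values is at most A |m ĥ ψ|, which is integrable, so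
sum and integral may be exchanged. -/
theorem hasSum_integral_mul_fourierProj {d : ℕ} (hd : 0 < d) (ϕ : DyadicResolution d)
    {m : E d → ℂ} (hm : MemLp m ∞ volume) (h ψ : 𝓢(E d, ℂ)) :
    HasSum (fun k : ℤ => ∫ ξ, m ξ * fourierProj ϕ k h ξ * ψ ξ) (∫ ξ, m ξ * 𝓕 h ξ * ψ ξ) := by
  obtain ⟨A, hA, hsum⟩ := exists_tsum_enorm_fourier_fn_le ϕ
  have hbound : ∀ χ : 𝓢(E d, ℂ), MemLp χ ∞ volume := fun χ => χ.memLp ∞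
  have hint : ∀ χ : 𝓢(E d, ℂ), Integrable (fun ξ => m ξ * χ ξ * ψ ξ) volume := fun χ =>
    (χ.integrable.mul_of_top_right hm).mul_of_top_left (hbound ψ)
  have hs : Summable fun k : ℤ => ∫ ξ, ‖m ξ * fourierProj ϕ k h ξ * ψ ξ‖ := by
    simp_rw [integral_norm_eq_lintegral_enorm (hint _).aestronglyMeasurable]
    refine ENNReal.summable_toReal (ne_top_of_le_ne_top
      (ENNReal.mul_ne_top hA (hint (𝓕 h : 𝓢(E d, ℂ))).2.ne) ?_)
    rw [← lintegral_tsum fun k => (hint _).aestronglyMeasurable.enorm]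
    rw [← lintegral_const_mul'' _ (hint _).aestronglyMeasurable.enorm]
    refine lintegral_mono fun ξ => ?_
    calc ∑' k : ℤ, ‖m ξ * fourierProj ϕ k h ξ * ψ ξ‖ₑ
        = (∑' k : ℤ, ‖𝓕 ϕ.fn ((2 : ℝ) ^ (-k) • ξ)‖ₑ) * ‖m ξ * 𝓕 h ξ * ψ ξ‖ₑ := by
          rw [← ENNReal.tsum_mul_right]
          congr 1
          ext k
          rw [fourierProj_apply]
          simp only [enorm_mul]
          ring
      _ ≤ _ := by
          gcongr
          exact hsum ξ
  have hmain := hasSum_integral_of_summable_integral_norm (fun k => hint (fourierProj ϕ k h)) hs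
  -- The resolution of unity fails at the origin, which is a null set because d > 0.
  have : Nontrivial (E d) := by
    have : Nonempty (Fin d) := ⟨⟨0, hd⟩⟩
    infer_instance
  have h0 : ∀ᵐ ξ : E d, ξ ≠ 0 := by
    simp [ae_iff]
  have heq : ∫ ξ, m ξ * 𝓕 h ξ * ψ ξ = ∫ ξ, ∑' k : ℤ, m ξ * fourierProj ϕ k h ξ * ψ ξ := ?_
  · rwa [heq]
  refine integral_congr_ae ?_
  filter_upwards [h0] with ξ hξ
  have := ((ϕ.hasSum_one ξ hξ).mul_left (m ξ * 𝓕 h ξ * ψ ξ)).tsum_eq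
  rw [mul_one] at this
  rw [← this]
  congr 1
  ext k
  rw [fourierProj_apply]
  ring

theorem schwartzMultiplier_apply {d : ℕ} {m : E d → ℂ} (hm : MemLp m ∞ volume)
    (h ψ : 𝓢(E d, ℂ)) :
    schwartzMultiplier hm h ψ = ∫ ξ, m ξ * 𝓕 h ξ * 𝓕⁻ ψ ξ := by
  rw [schwartzMultiplier, TemperedDistribution.fourierInv_apply,
    TemperedDistribution.smulLeftCLM_apply_apply, Lp.toTemperedDistribution_apply]
  refine integral_congr_ae ?_
  filter_upwards [hm.coeFn_toLp] with ξ hξ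
  rw [hξ, SchwartzMap.smulLeftCLM_apply_apply (by fun_prop)]
  simp only [smul_eq_mul]
  ring

theorem integrable_mul_schwartz {d : ℕ} {H : E d → ℂ} (hH : Continuous H) {B : ℝ}
    (hB : ∀ x, ‖H x‖ ≤ B) (ψ : 𝓢(E d, ℂ)) : Integrable (fun x => H x * ψ x) volume :=
  ψ.integrable.bdd_mul hH.aestronglyMeasurable (Filter.Eventually.of_forall hB)

/-- Since φ = 1 on the support of the transform of ϕ, the k-th piece is the inverse transform of m ĥ
times that of ϕ_k. The multiplication formula moves the inverse transform onto ψ, and summation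
takes place on the Fourier side. -/
theorem isMultiplierImage_schwartz {d : ℕ} (hd : 0 < d) (φ : AnnularCutoff d)
    (ϕ : DyadicResolution d) {m : E d → ℂ} (hm : MemLp m ∞ volume) (h : 𝓢(E d, ℂ)) :
    IsMultiplierImage φ ϕ m (toModPoly (h : 𝓢'(E d, ℂ)))
      (toModPoly (schwartzMultiplier hm h)) := by
  have hpiece : ∀ k, multiplierPiece φ ϕ m (toModPoly (h : 𝓢'(E d, ℂ))) k =
      𝓕⁻ (fun ξ => m ξ * fourierProj ϕ k h ξ) := fun k => by
    rw [multiplierPiece_eq_conv, proj_schwartz, conv_multiplierKernel_schwartz φ ϕ hm]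
  refine ⟨fun k x => ?_, fun k ψ => ?_, fun ψ => ?_⟩
  -- For general bounded m the kernel is only known to be bounded; the integrable factor is Π_k h.
  · rw [proj_schwartz]
    change Integrable (fun t => multiplierKernel φ m k t *
      (𝓕⁻ (fourierProj ϕ k h) : 𝓢(E d, ℂ)) (x - t)) volume
    exact ((𝓕⁻ (fourierProj ϕ k h) : 𝓢(E d, ℂ)).integrable.comp_sub_left x).bdd_mul
      (continuous_multiplierKernel φ hm k).aestronglyMeasurable
      (Filter.Eventually.of_forall (norm_fourierInv_le _))
  · rw [hpiece]
    exact integrable_mul_schwartz (continuous_fourierInv (integrable_mul_fourierProj ϕ hm k h))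
      (norm_fourierInv_le _) ψ
  · rw [pairing_toModPoly, schwartzMultiplier_apply]
    simp_rw [hpiece, integral_fourierInv_mul_eq (integrable_mul_fourierProj ϕ hm _ h)
      (ψ : 𝓢(E d, ℂ)).integrable, ← SchwartzMap.fourierInv_coe]
    exact hasSum_integral_mul_fourierProj hd ϕ hm h _

/-! ### Convergence in the sense of distributions -/

theorem integral_conv_mul {d : ℕ} {K H ψ : E d → ℂ} (hK : Integrable K) (hψ : Integrable ψ)
    (hH : Continuous H) {B : ℝ} (hB : ∀ x, ‖H x‖ ≤ B) :
    ∫ x, conv K H x * ψ x = ∫ y, H y * ∫ x, K (x - y) * ψ x := by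
  simp_rw [conv_apply', ← integral_mul_const, ← integral_const_mul]
  have h : Integrable (fun q : E d × E d => K (q.1 - q.2) * ψ q.1) (volume.prod volume) := by
    have := (hψ.convolution_integrand (ContinuousLinearMap.mul ℂ ℂ) hK.comp_neg).swap
    refine this.congr (Filter.Eventually.of_forall fun q => ?_)
    simp only [Function.comp_apply, Prod.swap, ContinuousLinearMap.mul_apply', neg_sub]
    ring
  rw [integral_integral_swap]
  · refine integral_congr_ae (Filter.Eventually.of_forall fun y => ?_)
    refine integral_congr_ae (Filter.Eventually.of_forall fun x => ?_)
    simp only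
    ring
  · refine (h.mul_bdd (g := fun q : E d × E d => H q.2) (c := B)
      (Continuous.aestronglyMeasurable (by fun_prop))
      (Filter.Eventually.of_forall fun _ => hB _)).congr
      (Filter.Eventually.of_forall fun q => ?_)
    simp only [Function.uncurry]
    ring

theorem lintegral_enorm_integral_mul_le {d : ℕ} {A : E d → E d → ℂ} {ψ : E d → ℂ}
    (hA : Continuous (Function.uncurry A)) (hψ : Continuous ψ) :
    ∫⁻ y, ‖∫ x, A x y * ψ x‖ₑ ≤ ∫⁻ x, (∫⁻ y, ‖A x y‖ₑ) * ‖ψ x‖ₑ := by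
  calc ∫⁻ y, ‖∫ x, A x y * ψ x‖ₑ ≤ ∫⁻ y, ∫⁻ x, ‖A x y‖ₑ * ‖ψ x‖ₑ := by
        refine lintegral_mono fun y => (enorm_integral_le_lintegral_enorm _).trans (le_of_eq ?_)
        simp only [enorm_mul]
    _ = ∫⁻ x, ∫⁻ y, ‖A x y‖ₑ * ‖ψ x‖ₑ := by
        refine lintegral_lintegral_swap (Measurable.aemeasurable ?_)
        have h1 : Measurable fun q : E d × E d => Function.uncurry A q.swap :=
          (hA.comp continuous_swap).measurable
        have h2 : Measurable fun q : E d × E d => ψ q.2 := (hψ.comp continuous_snd).measurable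
        exact h1.enorm.mul h2.enorm
    _ = _ := by
        refine lintegral_congr fun x => ?_
        rw [lintegral_mul_const]
        have h1 : Continuous fun y => Function.uncurry A (x, y) := by fun_prop
        exact h1.measurable.enorm

theorem enorm_integral_mul_le_of_bound {d : ℕ} {H Ψ : E d → ℂ} {B : ℝ≥0∞}
    (hB : ∀ x, ‖H x‖ₑ ≤ B) (hB' : B ≠ ∞) : ‖∫ y, H y * Ψ y‖ₑ ≤ B * ∫⁻ y, ‖Ψ y‖ₑ := by
  rw [← lintegral_const_mul' _ _ hB']
  refine (enorm_integral_le_lintegral_enorm _).trans (lintegral_mono fun y => ?_)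
  rw [enorm_mul]
  gcongr
  exact hB y

theorem lintegral_enorm_dil {d : ℕ} (k : ℤ) {F : E d → ℂ} (hF : Continuous F) :
    ∫⁻ x, ‖dil k F x‖ₑ = ∫⁻ x, ‖F x‖ₑ := by
  have h := eLpNorm_comp_zpow_smul k hF 1
  rw [eLpNorm_one_eq_lintegral_enorm, eLpNorm_one_eq_lintegral_enorm] at h
  simp only [dil, enorm_mul]
  rw [lintegral_const_mul' _ _ enorm_ne_top, h, ← mul_assoc]
  have h2 : ‖(2 : ℂ) ^ (k * d)‖ₑ = 2 ^ ((k * d : ℤ) : ℝ) := by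
    rw [← ofReal_norm, norm_zpow, Complex.norm_ofNat, ← Real.rpow_intCast,
      ← ENNReal.ofReal_rpow_of_pos (by norm_num)]
    simp
  rw [h2, ← ENNReal.rpow_add _ _ two_ne_zero ENNReal.ofNat_ne_top]
  simp

theorem exists_lintegral_enorm_translate_sub_le {d : ℕ} (Φ : 𝓢(E d, ℂ)) :
    ∃ S : ℝ, 0 ≤ S ∧ ∀ h, ∫⁻ y, ‖Φ (h - y) - Φ (-y)‖ₑ ≤
      ENNReal.ofReal (S * (1 + ‖h‖) ^ (d + 1) * ‖h‖) := by
  obtain ⟨S, hS0, hS⟩ := exists_norm_iteratedFDeriv_add_sub_le Φ (d + 1) 0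
  have hc : ∫⁻ z : E d, wt z ^ (-((d : ℝ) + 1)) ≠ ∞ := lintegral_wt_ne_top (lt_add_one _)
  refine ⟨S * (∫⁻ z : E d, wt z ^ (-((d : ℝ) + 1))).toReal, by positivity, fun h => ?_⟩
  rw [← lintegral_neg_eq_self]
  simp only [sub_neg_eq_add, neg_neg]
  calc ∫⁻ z, ‖Φ (h + z) - Φ z‖ₑ
      ≤ ∫⁻ z, ENNReal.ofReal (S * (1 + ‖h‖) ^ (d + 1) * ‖h‖) * wt z ^ (-((d : ℝ) + 1)) := by
        refine lintegral_mono fun z => ?_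
        have h1 := hS z h
        rw [iteratedFDeriv_zero_eq_comp, Function.comp_apply, Function.comp_apply, ← map_sub,
          LinearIsometryEquiv.norm_map, add_comm z h] at h1
        have h2 := ENNReal.ofReal_le_ofReal h1
        rw [ENNReal.ofReal_mul (by positivity), ENNReal.ofReal_pow (by positivity),
          ofReal_one_add_norm, ofReal_norm, ← ENNReal.rpow_natCast] at h2
        calc ‖Φ (h + z) - Φ z‖ₑ
            = (wt z ^ ((d + 1 : ℕ) : ℝ) * ‖Φ (h + z) - Φ z‖ₑ) * wt z ^ (-((d : ℝ) + 1)) := by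
              rw [mul_right_comm]
              push_cast
              rw [wt_rpow_mul_rpow_neg, one_mul]
          _ ≤ _ := by gcongr
    _ = _ := by
        rw [lintegral_const_mul' _ _ ENNReal.ofReal_ne_top,
          show S * (∫⁻ z : E d, wt z ^ (-((d : ℝ) + 1))).toReal * (1 + ‖h‖) ^ (d + 1) * ‖h‖ =
            S * (1 + ‖h‖) ^ (d + 1) * ‖h‖ * (∫⁻ z : E d, wt z ^ (-((d : ℝ) + 1))).toReal by ring,
          ENNReal.ofReal_mul (p := S * (1 + ‖h‖) ^ (d + 1) * ‖h‖) (by positivity),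
          ENNReal.ofReal_toReal hc]

/-! ### Decay of the pairings at low and high frequencies. -/

theorem hasTemperateGrowth_one_add_norm_sq_pow (d n : ℕ) :
    (fun x : E d => (((1 + ‖x‖ ^ 2) ^ n : ℝ) : ℂ)).HasTemperateGrowth := by
  have h1 : (fun x : E d => (1 + ‖x‖ ^ 2) ^ n).HasTemperateGrowth :=
    ((Function.HasTemperateGrowth.const 1).add
      (Function.hasTemperateGrowth_norm_sq (E d))).pow n
  exact Complex.ofRealCLM.hasTemperateGrowth.comp h1

theorem hasTemperateGrowth_norm_sq_pow (d n : ℕ) :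
    (fun x : E d => (((‖x‖ ^ 2) ^ n : ℝ) : ℂ)).HasTemperateGrowth :=
  Complex.ofRealCLM.hasTemperateGrowth.comp ((Function.hasTemperateGrowth_norm_sq (E d)).pow n)

/-- Multiplication by `(1 + |x|^2)^n`. -/
def growthWeight {d : ℕ} (n : ℕ) : 𝓢(E d, ℂ) →L[ℂ] 𝓢(E d, ℂ) :=
  SchwartzMap.smulLeftCLM ℂ fun x : E d => (((1 + ‖x‖ ^ 2) ^ n : ℝ) : ℂ)

theorem growthWeight_apply {d : ℕ} (n : ℕ) (ψ : 𝓢(E d, ℂ)) (x : E d) :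
    growthWeight n ψ x = (((1 + ‖x‖ ^ 2) ^ n : ℝ) : ℂ) * ψ x :=
  SchwartzMap.smulLeftCLM_apply_apply (hasTemperateGrowth_one_add_norm_sq_pow d n) ψ x

/-- The Fourier multiplier with symbol `|ξ|^{2n}`. -/
def laplacePow {d : ℕ} (n : ℕ) : 𝓢(E d, ℂ) →L[ℂ] 𝓢(E d, ℂ) :=
  FourierTransform.fourierCLM ℂ 𝓢(E d, ℂ) ∘L
    SchwartzMap.smulLeftCLM ℂ (fun x : E d => (((‖x‖ ^ 2) ^ n : ℝ) : ℂ)) ∘L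
    FourierTransform.fourierInvCLM ℂ 𝓢(E d, ℂ)

theorem fourierInv_laplacePow_apply {d : ℕ} (n : ℕ) (ψ : 𝓢(E d, ℂ)) (ξ : E d) :
    𝓕⁻ (laplacePow n ψ) ξ = (((‖ξ‖ ^ 2) ^ n : ℝ) : ℂ) * 𝓕⁻ ψ ξ := by
  change 𝓕⁻ (𝓕 (SchwartzMap.smulLeftCLM ℂ (fun x : E d => (((‖x‖ ^ 2) ^ n : ℝ) : ℂ)) (𝓕⁻ ψ)))
    ξ = _
  rw [FourierTransform.fourierInv_fourier_eq,
    SchwartzMap.smulLeftCLM_apply_apply (hasTemperateGrowth_norm_sq_pow d n), smul_eq_mul]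

theorem integral_dil_sub_mul {d : ℕ} (g ψ : 𝓢(E d, ℂ)) (k : ℤ) (y : E d) :
    ∫ x, dil k g (x - y) * ψ x =
      𝓕⁻ (fun ξ => 𝓕⁻ ψ ξ * 𝓕 g ((2 : ℝ) ^ (-k) • ξ)) (-y) := by
  rw [← integral_fourierInv_mul_dyadicKernel (𝓕⁻ ψ : 𝓢(E d, ℂ)).integrable g k (-y),
    ← integral_neg_eq_self]
  refine integral_congr_ae (Filter.Eventually.of_forall fun x => ?_)
  simp only
  rw [Real.fourierInv_eq_fourier_neg, ← SchwartzMap.fourier_coe,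
    FourierTransform.fourier_fourierInv_eq, mul_comm,
    show -x - y = -y - x by abel]

/-- Division of a function with Fourier transform supported in an annulus by powers of the
Laplacian. -/
theorem exists_fourier_eq_norm_pow_mul {d : ℕ} {Φ : 𝓢(E d, ℂ)}
    (hΦc : HasCompactSupport (𝓕 Φ : 𝓢(E d, ℂ))) (hΦ0 : ∀ ξ, ‖ξ‖ ≤ 1 / 8 → 𝓕 Φ ξ = 0) (n : ℕ) :
    ∃ Ω : 𝓢(E d, ℂ), ∀ ξ, 𝓕 Φ ξ = (((‖ξ‖ ^ 2) ^ n : ℝ) : ℂ) * 𝓕 Ω ξ := by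
  set F : E d → ℂ := fun ξ => (𝓕 Φ : 𝓢(E d, ℂ)) ξ * (((‖ξ‖ ^ 2) ^ n)⁻¹ : ℝ) with hF
  have hFc : HasCompactSupport F := hΦc.mul_right
  have hFs : ContDiff ℝ ((⊤ : ℕ∞) : WithTop ℕ∞) F := by
    rw [contDiff_iff_contDiffAt]
    intro ξ
    -- Near the origin the numerator vanishes identically, so the singularity of |ξ|^{-2n} does no
    -- harm.
    rcases eq_or_ne ξ 0 with rfl | hξ
    · have h0 : F =ᶠ[nhds 0] fun _ => 0 := by
        filter_upwards [Metric.closedBall_mem_nhds (0 : E d) (by norm_num : (0 : ℝ) < 1 / 8)]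
          with ξ hξ
        rw [mem_closedBall_zero_iff] at hξ
        simp only [hF, hΦ0 ξ hξ, zero_mul]
      exact contDiffAt_const.congr_of_eventuallyEq h0
    · have hn : ContDiffAt ℝ ((⊤ : ℕ∞) : WithTop ℕ∞) (fun ξ : E d => ((‖ξ‖ ^ 2) ^ n)⁻¹) ξ :=
        ((contDiff_norm_sq ℝ).pow n).contDiffAt.inv (by positivity)
      exact ((𝓕 Φ : 𝓢(E d, ℂ)).smooth _).contDiffAt.mul
        (Complex.ofRealCLM.contDiff.contDiffAt.comp ξ hn)
  refine ⟨𝓕⁻ (hFc.toSchwartzMap hFs), fun ξ => ?_⟩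
  rw [FourierTransform.fourier_fourierInv_eq]
  change _ = _ * F ξ
  rcases eq_or_ne ξ 0 with rfl | hξ
  · simp [hF, hΦ0 0 (by simp)]
  · have h2 : (((‖ξ‖ ^ 2) ^ n : ℝ) : ℂ) ≠ 0 := by
      have : ‖ξ‖ ≠ 0 := norm_ne_zero_iff.2 hξ
      exact_mod_cast pow_ne_zero _ (pow_ne_zero _ this)
    simp only [hF]
    push_cast at h2 ⊢
    field_simp

theorem ofReal_norm_toLp_one {d : ℕ} (ψ : 𝓢(E d, ℂ)) :
    ENNReal.ofReal ‖ψ.toLp 1 (volume : Measure (E d))‖ = ∫⁻ x, ‖ψ x‖ₑ := by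
  rw [SchwartzMap.norm_toLp, ENNReal.ofReal_toReal (ψ.memLp 1 volume).2.ne, eLpNorm_one_eq_lintegral_enorm]

/-- Because ∫ψ = 0, the value of the kernel at x = 0 may be subtracted. The L^1 norm in y of the
difference is at most S (1+2^k|x|)^{d+1} 2^k|x|; for k ≤ 0 this is 2^k times a polynomial weight
that ψ absorbs. -/
theorem exists_lintegral_enorm_low_le {d : ℕ} (Φ : 𝓢(E d, ℂ)) :
    ∃ C : ℝ, 0 ≤ C ∧ ∀ (k : ℤ) (ψ : 𝓢(E d, ℂ)), k ≤ 0 → ∫ x, ψ x = 0 →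
      ∫⁻ y, ‖∫ x, dil k Φ (x - y) * ψ x‖ₑ ≤
        ENNReal.ofReal (C * 2 ^ k * ‖(growthWeight (d + 2) ψ).toLp 1 (volume : Measure (E d))‖) := by
  obtain ⟨S, hS0, hS⟩ := exists_lintegral_enorm_translate_sub_le Φ
  -- The factor 2^{d+2} comes from 1 + |x| ≤ 2(1 + |x|²), raised to the power d + 2.
  refine ⟨S * 2 ^ (d + 2), by positivity, fun k ψ hk hψ => ?_⟩
  have hsplit : ∀ y, ∫ x, dil k Φ (x - y) * ψ x =
      ∫ x, dil k (fun z => Φ ((2 : ℝ) ^ k • x - z) - Φ (-z)) y * ψ x := by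
    intro y
    obtain ⟨B, -, hB⟩ := exists_norm_iteratedFDeriv_le Φ 0 0
    have hi : Integrable (fun x => dil k Φ (x - y) * ψ x) volume :=
      integrable_mul_schwartz ((continuous_dil k Φ.continuous).comp (continuous_sub_right y))
        (B := ‖(2 : ℂ) ^ (k * d)‖ * B) (fun x => by
          rw [Function.comp_apply, dil, norm_mul]
          gcongr
          simpa using hB _) ψ
    have : ∀ x, dil k (fun z => Φ ((2 : ℝ) ^ k • x - z) - Φ (-z)) y * ψ x =
        dil k Φ (x - y) * ψ x - dil k Φ (-y) * ψ x := fun x => by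
      simp only [dil, smul_sub, smul_neg]
      ring
    simp_rw [this]
    rw [integral_sub hi (ψ.integrable.const_mul _), integral_const_mul, hψ, mul_zero, sub_zero]
  simp_rw [hsplit]
  refine (lintegral_enorm_integral_mul_le
    (A := fun x y => dil k (fun z => Φ ((2 : ℝ) ^ k • x - z) - Φ (-z)) y) ?_ ψ.continuous).trans ?_
  · simp only [dil]
    fun_prop
  rw [ENNReal.ofReal_mul (by positivity), ofReal_norm_toLp_one,
    ← lintegral_const_mul' _ _ ENNReal.ofReal_ne_top]
  refine lintegral_mono fun x => ?_
  rw [lintegral_enorm_dil k (by fun_prop), growthWeight_apply, enorm_mul, ← mul_assoc]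
  gcongr
  refine (hS _).trans ?_
  rw [← ofReal_norm, Complex.norm_real, Real.norm_of_nonneg (by positivity),
    ← ENNReal.ofReal_mul (by positivity)]
  refine ENNReal.ofReal_le_ofReal ?_
  rw [norm_smul, Real.norm_of_nonneg (by positivity)]
  have h2 : (0 : ℝ) < 2 ^ k := by positivity
  have h21 : (2 : ℝ) ^ k ≤ 1 := zpow_le_one_of_nonpos₀ one_le_two hk
  have hx := norm_nonneg x
  calc S * (1 + 2 ^ k * ‖x‖) ^ (d + 1) * (2 ^ k * ‖x‖)
      ≤ S * (1 + ‖x‖) ^ (d + 1) * (2 ^ k * (1 + ‖x‖)) := by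
        gcongr
        · exact mul_le_of_le_one_left hx h21
        · linarith
    _ = S * 2 ^ k * (1 + ‖x‖) ^ (d + 2) := by ring
    _ ≤ S * 2 ^ k * (2 * (1 + ‖x‖ ^ 2)) ^ (d + 2) := by
        gcongr
        nlinarith [sq_nonneg (‖x‖ - 1)]
    _ = _ := by
        rw [mul_pow]
        ring

theorem fourierInv_const_mul {d : ℕ} (c : ℂ) (f : E d → ℂ) (x : E d) :
    𝓕⁻ (fun ξ => c * f ξ) x = c * 𝓕⁻ f x := by
  rw [Real.fourierInv_eq', Real.fourierInv_eq', ← integral_const_mul]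
  refine integral_congr_ae (Filter.Eventually.of_forall fun ξ => ?_)
  simp only [smul_eq_mul]
  ring

/-- Factor the transform of Φ as |ξ|^{2n} times that of Ω. At scale k this produces 2^{-2nk}
|ξ|^{2n}, and |ξ|^{2n} is moved to ψ. -/
theorem exists_lintegral_enorm_high_le {d : ℕ} {Φ : 𝓢(E d, ℂ)}
    (hΦc : HasCompactSupport (𝓕 Φ : 𝓢(E d, ℂ))) (hΦ0 : ∀ ξ, ‖ξ‖ ≤ 1 / 8 → 𝓕 Φ ξ = 0) (n : ℕ) :
    ∃ C : ℝ, 0 ≤ C ∧ ∀ (k : ℤ) (ψ : 𝓢(E d, ℂ)),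
      ∫⁻ y, ‖∫ x, dil k Φ (x - y) * ψ x‖ₑ ≤
        ENNReal.ofReal (C * (((2 : ℝ) ^ (-k)) ^ 2) ^ n *
          ‖(laplacePow n ψ).toLp 1 (volume : Measure (E d))‖) := by
  obtain ⟨Ω, hΩ⟩ := exists_fourier_eq_norm_pow_mul hΦc hΦ0 n
  refine ⟨‖Ω.toLp 1 (volume : Measure (E d))‖, norm_nonneg _, fun k ψ => ?_⟩
  set c : ℝ := (((2 : ℝ) ^ (-k)) ^ 2) ^ n with hc
  have h1 : ∀ y, ∫ x, dil k Φ (x - y) * ψ x =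
      (c : ℂ) * ∫ x, dil k Ω (x - y) * laplacePow n ψ x := fun y => by
    rw [integral_dil_sub_mul, integral_dil_sub_mul, ← fourierInv_const_mul]
    refine congrFun (congrArg _ (funext fun ξ => ?_)) _
    rw [fourierInv_laplacePow_apply, hΩ, norm_smul, Real.norm_of_nonneg (by positivity), hc]
    push_cast
    ring
  simp_rw [h1, enorm_mul]
  rw [lintegral_const_mul' _ _ enorm_ne_top]
  have hce : ‖(c : ℂ)‖ₑ = ENNReal.ofReal c := by
    rw [← ofReal_norm, Complex.norm_real, Real.norm_of_nonneg (by positivity)]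
  rw [hce, mul_comm ‖_‖ c, mul_assoc, ENNReal.ofReal_mul (by positivity),
    ENNReal.ofReal_mul (norm_nonneg _), ofReal_norm_toLp_one, ofReal_norm_toLp_one]
  gcongr
  refine (lintegral_enorm_integral_mul_le ?_ (laplacePow n ψ).continuous).trans (le_of_eq ?_)
  · simp only [dil]
    fun_prop
  · rw [← lintegral_const_mul' _ _ (by
      rw [← ofReal_norm_toLp_one]
      exact ENNReal.ofReal_ne_top)]
    refine lintegral_congr fun x => ?_
    rw [lintegral_sub_left_eq_self (fun y => ‖dil k Ω y‖ₑ) x, lintegral_enorm_dil k Ω.continuous]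

theorem summable_half_pow_natAbs : Summable fun k : ℤ => (1 / 2 : ℝ) ^ k.natAbs := by
  rw [summable_int_iff_summable_nat_and_neg]
  simp only [Int.natAbs_natCast, Int.natAbs_neg, and_self]
  exact summable_geometric_two

/-- The pair of weighted integrable functions that controls the Littlewood-Paley pieces. -/
def controlMap (d n : ℕ) : 𝓢(E d, ℂ) →L[ℂ]
    Lp ℂ 1 (volume : Measure (E d)) × Lp ℂ 1 (volume : Measure (E d)) :=
  (SchwartzMap.toLpCLM ℂ ℂ 1 volume ∘L growthWeight (d + 2)).prod
    (SchwartzMap.toLpCLM ℂ ℂ 1 volume ∘L laplacePow n)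

theorem SInfty.integral_eq_zero {d : ℕ} (ψ : SInfty d) : ∫ x, (ψ : 𝓢(E d, ℂ)) x = 0 := by
  have := ψ.2 0
  simpa [monomial] using this

/-- Replace H by its convolution with Φ_k and move that convolution to ψ: the pairing is at most sup
|H| times an L^1 norm with the low- or high-frequency gain. For k ≤ 0 the factor 2^{ka} is at most
1, so the vanishing of ∫ψ is the only moment condition used. -/
theorem exists_norm_integral_mul_le {d : ℕ} {Φ : 𝓢(E d, ℂ)}
    (hΦc : HasCompactSupport (𝓕 Φ : 𝓢(E d, ℂ))) (hΦ0 : ∀ ξ, ‖ξ‖ ≤ 1 / 8 → 𝓕 Φ ξ = 0) {a S : ℝ}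
    (ha : 0 ≤ a) (hS : 0 ≤ S) :
    ∃ (n : ℕ) (C : ℝ), 0 ≤ C ∧ ∀ (k : ℤ) (H : E d → ℂ) (ψ : SInfty d), Continuous H →
      Reproduces Φ k H → (∀ x, ‖H x‖ ≤ S * (2 : ℝ) ^ ((k : ℝ) * a)) →
      ‖∫ x, H x * (ψ : 𝓢(E d, ℂ)) x‖ ≤ (1 / 2) ^ k.natAbs * (C * ‖controlMap d n ψ‖) := by
  -- Then ka - 2nk ≤ -k for k ≥ 0, so the high frequencies also decay like 2^{-|k|}.
  obtain ⟨n, hn⟩ := exists_nat_ge (a + 1)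
  obtain ⟨C₁, hC₁, h₁⟩ := exists_lintegral_enorm_low_le Φ
  obtain ⟨C₂, hC₂, h₂⟩ := exists_lintegral_enorm_high_le hΦc hΦ0 n
  refine ⟨n, S * C₁ + S * C₂, by positivity, fun k H ψ hHc hHr hHb => ?_⟩
  have hB := norm_nonneg (controlMap d n ψ)
  have key : ∀ R : ℝ, ∫⁻ y, ‖∫ x, dil k Φ (x - y) * (ψ : 𝓢(E d, ℂ)) x‖ₑ ≤ ENNReal.ofReal R →
      0 ≤ R → ‖∫ x, H x * (ψ : 𝓢(E d, ℂ)) x‖ ≤ S * (2 : ℝ) ^ ((k : ℝ) * a) * R := by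
    intro R hR hR0
    rw [← ENNReal.ofReal_le_ofReal_iff (by positivity), ofReal_norm]
    have heq : ∫ x, H x * (ψ : 𝓢(E d, ℂ)) x = ∫ x, conv (dil k Φ) H x * (ψ : 𝓢(E d, ℂ)) x := by
      rw [hHr]
    rw [heq, integral_conv_mul (integrable_dil_schwartz k Φ) (ψ : 𝓢(E d, ℂ)).integrable hHc hHb,
      ENNReal.ofReal_mul (by positivity)]
    refine (enorm_integral_mul_le_of_bound (B := ENNReal.ofReal (S * (2 : ℝ) ^ ((k : ℝ) * a)))
      (fun x => ?_) ENNReal.ofReal_ne_top).trans (by gcongr)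
    rw [← ofReal_norm]
    exact ENNReal.ofReal_le_ofReal (hHb x)
  rcases le_total k 0 with hk | hk
  · have hfst : ‖(growthWeight (d + 2) (ψ : 𝓢(E d, ℂ))).toLp 1 (volume : Measure (E d))‖ ≤
        ‖controlMap d n ψ‖ := norm_fst_le (controlMap d n ψ)
    have hk2 : (2 : ℝ) ^ k = (1 / 2) ^ k.natAbs := by
      obtain ⟨j, hj⟩ := Int.eq_ofNat_of_zero_le (neg_nonneg.2 hk)
      have : k = -(j : ℤ) := by omega
      subst this
      rw [zpow_neg, zpow_natCast, Int.natAbs_neg, Int.natAbs_natCast, one_div, inv_pow]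
    refine (key _ (h₁ k ψ hk (SInfty.integral_eq_zero ψ)) (by positivity)).trans ?_
    have h1 : (2 : ℝ) ^ ((k : ℝ) * a) ≤ 1 :=
      Real.rpow_le_one_of_one_le_of_nonpos one_le_two
        (mul_nonpos_of_nonpos_of_nonneg (by exact_mod_cast hk) ha)
    rw [hk2]
    calc S * (2 : ℝ) ^ ((k : ℝ) * a) * (C₁ * (1 / 2) ^ k.natAbs *
          ‖(growthWeight (d + 2) (ψ : 𝓢(E d, ℂ))).toLp 1 (volume : Measure (E d))‖)
        ≤ S * 1 * (C₁ * (1 / 2) ^ k.natAbs * ‖controlMap d n ψ‖) := by gcongr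
      _ = (1 / 2) ^ k.natAbs * ((S * C₁ + 0) * ‖controlMap d n ψ‖) := by ring
      _ ≤ _ := by
        gcongr
        positivity
  · have hsnd : ‖(laplacePow n (ψ : 𝓢(E d, ℂ))).toLp 1 (volume : Measure (E d))‖ ≤
        ‖controlMap d n ψ‖ := norm_snd_le (controlMap d n ψ)
    have hk2 : (2 : ℝ) ^ ((k : ℝ) * a) * (((2 : ℝ) ^ (-k)) ^ 2) ^ n ≤ (1 / 2) ^ k.natAbs := by
      obtain ⟨j, rfl⟩ := Int.eq_ofNat_of_zero_le hk
      rw [Int.natAbs_natCast, one_div, inv_pow, ← Real.rpow_natCast 2 j,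
        ← Real.rpow_neg zero_le_two, ← pow_mul, ← Real.rpow_intCast, ← Real.rpow_natCast,
        ← Real.rpow_mul zero_le_two, ← Real.rpow_add zero_lt_two]
      refine Real.rpow_le_rpow_of_exponent_le one_le_two ?_
      push_cast
      have hj : (0 : ℝ) ≤ j := Nat.cast_nonneg j
      nlinarith
    refine (key _ (h₂ k ψ) (by positivity)).trans ?_
    calc S * (2 : ℝ) ^ ((k : ℝ) * a) * (C₂ * (((2 : ℝ) ^ (-k)) ^ 2) ^ n *
          ‖(laplacePow n (ψ : 𝓢(E d, ℂ))).toLp 1 (volume : Measure (E d))‖)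
        ≤ S * (2 : ℝ) ^ ((k : ℝ) * a) * (C₂ * (((2 : ℝ) ^ (-k)) ^ 2) ^ n *
            ‖controlMap d n ψ‖) := by gcongr
      _ = (2 : ℝ) ^ ((k : ℝ) * a) * (((2 : ℝ) ^ (-k)) ^ 2) ^ n *
            ((0 + S * C₂) * ‖controlMap d n ψ‖) := by ring
      _ ≤ _ := by
        gcongr
        positivity

/-- A series of functions with frequencies in dyadic annuli and of moderate growth converges
in the duality with `S_∞`. -/
theorem exists_hasSum_integral_mul {d : ℕ} {Φ : 𝓢(E d, ℂ)}
    (hΦc : HasCompactSupport (𝓕 Φ : 𝓢(E d, ℂ))) (hΦ0 : ∀ ξ, ‖ξ‖ ≤ 1 / 8 → 𝓕 Φ ξ = 0) {a S : ℝ}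
    (ha : 0 ≤ a) (hS : 0 ≤ S) {H : ℤ → E d → ℂ} (hHc : ∀ k, Continuous (H k))
    (hHr : ∀ k, Reproduces Φ k (H k))
    (hHb : ∀ k x, ‖H k x‖ ≤ S * (2 : ℝ) ^ ((k : ℝ) * a)) :
    ∃ g : 𝓢'(E d, ℂ), ∀ ψ : SInfty d,
      HasSum (fun k : ℤ => ∫ x, H k x * (ψ : 𝓢(E d, ℂ)) x) (g (ψ : 𝓢(E d, ℂ))) := by
  obtain ⟨n, C, hC, h⟩ := exists_norm_integral_mul_le hΦc hΦ0 ha hS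
  have hb := fun (ψ : SInfty d) k => h k (H k) ψ (hHc k) (hHr k) (hHb k)
  have hsb := fun ψ : SInfty d =>
    summable_half_pow_natAbs.mul_right (C * ‖controlMap d n (ψ : 𝓢(E d, ℂ))‖)
  have hs : ∀ ψ : SInfty d, Summable fun k : ℤ => ∫ x, H k x * (ψ : 𝓢(E d, ℂ)) x :=
    fun ψ => Summable.of_norm_bounded (hsb ψ) (hb ψ)
  let l : SInfty d →ₗ[ℂ] ℂ :=
    { toFun := fun ψ => ∑' k : ℤ, ∫ x, H k x * (ψ : 𝓢(E d, ℂ)) x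
      map_add' := fun ψ χ => by
        rw [← (hs ψ).tsum_add (hs χ)]
        refine tsum_congr fun k => ?_
        rw [← integral_add (integrable_mul_schwartz (hHc k) (hHb k) _)
          (integrable_mul_schwartz (hHc k) (hHb k) _)]
        refine integral_congr_ae (Filter.Eventually.of_forall fun x => ?_)
        exact mul_add _ _ _
      map_smul' := fun c ψ => by
        rw [RingHom.id_apply, smul_eq_mul, ← tsum_mul_left]
        refine tsum_congr fun k => ?_
        rw [← integral_const_mul]
        refine integral_congr_ae (Filter.Eventually.of_forall fun x => ?_)
        exact mul_left_comm _ _ _ }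
  have hl : ∀ ψ : SInfty d, ‖l ψ‖ ≤ (∑' k : ℤ, (1 / 2 : ℝ) ^ k.natAbs) * C *
      ‖(controlMap d n).toLinearMap (ψ : 𝓢(E d, ℂ))‖ := fun ψ => by
    rw [mul_assoc]
    exact tsum_of_norm_bounded (summable_half_pow_natAbs.hasSum.mul_right _) (hb ψ)
  -- The sum is so far defined on S_∞ only. Being bounded by the norm of `controlMap`, it extends
  -- through that map, whose continuity makes the extension tempered.
  obtain ⟨L, hL⟩ := exists_clm_comp_eq (controlMap d n).toLinearMap (SInfty d) l hl
  refine ⟨ContinuousLinearMap.toPointwiseConvergenceCLM _ _ _ _ (L ∘L controlMap d n),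
    fun ψ => ?_⟩
  have : (ContinuousLinearMap.toPointwiseConvergenceCLM _ _ _ _ (L ∘L controlMap d n) :
      𝓢'(E d, ℂ)) (ψ : 𝓢(E d, ℂ)) = l ψ := hL ψ
  rw [this]
  exact (hs ψ).hasSum

/-! ### Existence of the multiplier image -/

theorem le_eLpNorm_count {ι : Type*} [MeasurableSpace ι] [MeasurableSingletonClass ι]
    (f : ι → ℝ≥0∞) {q : ℝ≥0∞} (hq : q ≠ 0) (i : ι) : f i ≤ eLpNorm f q Measure.count := by
  rcases eq_or_ne q ∞ with rfl | hqt
  · simpa using le_iSup f i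
  · have hq' : 0 < q.toReal := ENNReal.toReal_pos hq hqt
    rw [eLpNorm_eq_lintegral_rpow_enorm_toReal hq hqt, one_div,
      ENNReal.le_rpow_inv_iff hq']
    rw [lintegral_count]
    exact ENNReal.le_tsum (f := fun i => ‖f i‖ₑ ^ q.toReal) i

/-- Interpolation: ∫|g| ≤ (sup |g|)^{1-r} ∫|g|^r, with the supremum bounded by Nikolskii's
inequality. -/
theorem exists_lintegral_enorm_le {d : ℕ} (Φ : 𝓢(E d, ℂ)) {r : ℝ≥0∞} (hr0 : r ≠ 0)
    (hr1 : r ≤ 1) :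
    ∃ C : ℝ≥0∞, C ≠ ∞ ∧ ∀ g : E d → ℂ, Continuous g → Reproduces Φ 0 g →
      (∃ S : ℝ, ∀ x, ‖g x‖ ≤ S) → ∫⁻ x, ‖g x‖ₑ ≤ C * eLpNorm g r volume := by
  obtain ⟨C, hC, h⟩ := exists_enorm_le_eLpNorm_unit Φ hr0
  have hrt : r ≠ ∞ := ne_top_of_le_ne_top ENNReal.one_ne_top hr1
  have hr' : 0 < r.toReal := ENNReal.toReal_pos hr0 hrt
  have hr1' : r.toReal ≤ 1 := by simpa using ENNReal.toReal_mono ENNReal.one_ne_top hr1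
  have hr1'' : 0 ≤ 1 - r.toReal := sub_nonneg.2 hr1'
  refine ⟨C ^ (1 - r.toReal), ENNReal.rpow_ne_top_of_nonneg (by linarith) hC,
    fun g hgc hgr ⟨S, hS⟩ => ?_⟩
  have hS0 : 0 ≤ S := (norm_nonneg _).trans (hS 0)
  set N := eLpNorm g r volume with hN
  calc ∫⁻ x, ‖g x‖ₑ ≤ ∫⁻ x, (C * N) ^ (1 - r.toReal) * ‖g x‖ₑ ^ r.toReal := by
        refine lintegral_mono fun x => ?_
        calc ‖g x‖ₑ = ‖g x‖ₑ ^ (1 - r.toReal) * ‖g x‖ₑ ^ r.toReal := by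
              rw [← ENNReal.rpow_add_of_nonneg _ _ (by linarith) hr'.le, sub_add_cancel,
                ENNReal.rpow_one]
          _ ≤ _ := by
              gcongr
              exact h g hgc hgr ⟨0, S, hS0, by simpa using hS⟩ x
    _ = C ^ (1 - r.toReal) * N := by
        rw [lintegral_const_mul _ (by fun_prop), ← eLpNorm_rpow_eq_lintegral hr0 hrt, ← hN,
          ENNReal.mul_rpow_of_nonneg _ _ (by linarith), mul_assoc,
          ← ENNReal.rpow_add_of_nonneg _ _ (by linarith) hr'.le, sub_add_cancel,
          ENNReal.rpow_one]

/-- One term of the ℓ^q norm combined with Nikolskii's inequality. It gives both the boundedness of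
each Π_k f and the growth rate a = d/p in k. -/
theorem exists_norm_proj_le_of_besovNorm_ne_top {d : ℕ} (ϕ : DyadicResolution d) {p q : ℝ≥0∞}
    (hp : p ≠ 0) (hq : q ≠ 0) {f : TemperedModPoly d} (hf : besovNorm ϕ p q f ≠ ∞) :
    ∃ S : ℝ, 0 ≤ S ∧ ∀ k x, ‖proj ϕ k f x‖ ≤ S * (2 : ℝ) ^ ((k : ℝ) * (d * (1 / p).toReal)) := by
  obtain ⟨Φ, -, hΦ, -⟩ := exists_bandLimiter d
  obtain ⟨C, hC, h⟩ := exists_enorm_le_eLpNorm Φ hp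
  have hCB : C * besovNorm ϕ p q f ≠ ∞ := ENNReal.mul_ne_top hC hf
  refine ⟨(C * besovNorm ϕ p q f).toReal, by positivity, fun k x => ?_⟩
  rw [← ENNReal.ofReal_le_ofReal_iff (by positivity), ofReal_norm,
    ENNReal.ofReal_mul (by positivity), ENNReal.ofReal_toReal hCB,
    ← ENNReal.ofReal_rpow_of_pos zero_lt_two, ENNReal.ofReal_ofNat]
  refine (h k _ (continuous_proj ϕ k f) (reproduces_proj ϕ k f hΦ)
    (exists_norm_proj_le ϕ k f) x).trans ?_
  rw [mul_assoc k.cast, mul_assoc C, mul_comm (besovNorm ϕ p q f)]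
  gcongr
  exact le_eLpNorm_count (fun k => eLpNorm (proj ϕ k f) p volume) hq k

theorem integrable_of_lintegral_enorm_ne_top {d : ℕ} {K : E d → ℂ} (hK : Continuous K)
    (h : ∫⁻ x, ‖K x‖ₑ ≠ ∞) : Integrable K volume :=
  ⟨hK.aestronglyMeasurable, h.lt_top⟩

theorem integral_norm_dil {d : ℕ} (k : ℤ) {K : E d → ℂ} (hK : Continuous K) :
    ∫ x, ‖dil k K x‖ = ∫ x, ‖K x‖ := by
  rw [integral_norm_eq_lintegral_enorm (continuous_dil k hK).aestronglyMeasurable,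
    integral_norm_eq_lintegral_enorm hK.aestronglyMeasurable, lintegral_enorm_dil k hK]

theorem norm_unitKernel_le {d : ℕ} (φ : AnnularCutoff d) (m : E d → ℂ) (k : ℤ) :
    ∃ S : ℝ, ∀ x, ‖unitKernel φ m k x‖ ≤ S :=
  ⟨_, norm_fourierInv_le _⟩

/-- The kernels `(m(2^k ·) φ)^∨` are uniformly integrable if they are uniformly bounded in
`L^r`. -/
theorem exists_lintegral_enorm_unitKernel_le {d : ℕ} (φ : AnnularCutoff d) {m : E d → ℂ}
    (hm : MemLp m ∞ volume) {r : ℝ≥0∞} (hr0 : r ≠ 0) (hr1 : r ≤ 1) {A : ℝ≥0∞} (hA : A ≠ ∞)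
    (hK : ∀ k, eLpNorm (unitKernel φ m k) r volume ≤ A) :
    ∃ C : ℝ≥0∞, C ≠ ∞ ∧ ∀ k, ∫⁻ x, ‖unitKernel φ m k x‖ₑ ≤ C := by
  obtain ⟨Φ, -, hΦ, -⟩ := exists_bandLimiter d
  obtain ⟨C, hC, h⟩ := exists_lintegral_enorm_le Φ hr0 hr1
  refine ⟨C * A, ENNReal.mul_ne_top hC hA, fun k => ?_⟩
  refine (h _ (continuous_unitKernel φ hm k) (reproduces_unitKernel φ hm k hΦ)
    (norm_unitKernel_le φ m k)).trans ?_
  gcongr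
  exact hK k

/-- The kernels have uniformly bounded L^1 norms, which dilation preserves. Hence the pieces inherit
from Π_k f the continuity, the reproducing property and the growth 2^{kd/p} that
`exists_hasSum_integral_mul` requires. -/
theorem exists_isMultiplierImage {d : ℕ} (φ : AnnularCutoff d) (ϕ : DyadicResolution d)
    {p q : ℝ≥0∞} (hp : p ≠ 0) (hq : q ≠ 0) {m : E d → ℂ} (hm : MemLp m ∞ volume) {r : ℝ≥0∞}
    (hr0 : r ≠ 0) (hr1 : r ≤ 1) {A : ℝ≥0∞} (hA : A ≠ ∞)
    (hK : ∀ k, eLpNorm (unitKernel φ m k) r volume ≤ A)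
    {f : TemperedModPoly d} (hf : besovNorm ϕ p q f ≠ ∞) : ∃ g, IsMultiplierImage φ ϕ m f g := by
  obtain ⟨Φ, hΦc, hΦ, hΦ0⟩ := exists_bandLimiter d
  obtain ⟨S, hS0, hS⟩ := exists_norm_proj_le_of_besovNorm_ne_top ϕ hp hq hf
  obtain ⟨C, hC, hκ⟩ := exists_lintegral_enorm_unitKernel_le φ hm hr0 hr1 hA hK
  have hκc := continuous_unitKernel φ hm
  have hκi : ∀ k, Integrable (unitKernel φ m k) volume := fun k =>
    integrable_of_lintegral_enorm_ne_top (hκc k) (ne_top_of_le_ne_top hC (hκ k))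
  have hKi : ∀ k, Integrable (multiplierKernel φ m k) volume := fun k => by
    rw [multiplierKernel_eq_dil]
    exact integrable_dil k (hκi k)
  have hGc := fun k => continuous_proj ϕ k f
  have hHc : ∀ k, Continuous (multiplierPiece φ ϕ m f k) := fun k =>
    continuous_conv (hKi k) (hGc k) (hS k)
  have hHb : ∀ k x, ‖multiplierPiece φ ϕ m f k x‖ ≤
      C.toReal * S * (2 : ℝ) ^ ((k : ℝ) * (d * (1 / p).toReal)) := fun k x => by
    refine (norm_conv_le (hKi k) (hS k) x).trans ?_
    rw [multiplierKernel_eq_dil, integral_norm_dil k (hκc k), mul_assoc,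
      integral_norm_eq_lintegral_enorm (hκc k).aestronglyMeasurable]
    gcongr
    exact hκ k
  have hHr : ∀ k, Reproduces Φ k (multiplierPiece φ ϕ m f k) := fun k =>
    (reproduces_proj ϕ k f hΦ).conv (hKi k) (hGc k) (hS k)
  obtain ⟨g, hg⟩ := exists_hasSum_integral_mul hΦc hΦ0 (by positivity) (by positivity)
    hHc hHr hHb
  exact ⟨toModPoly g, fun k x => integrable_mul_comp_sub (hKi k) (hGc k) (hS k) x,
    fun k ψ => integrable_mul_schwartz (hHc k) (hHb k) ψ, hg⟩

/-! ### The norm inequality -/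

theorem conv_multiplierPiece_eq_zero {d : ℕ} (φ : AnnularCutoff d) (ϕ : DyadicResolution d)
    {m : E d → ℂ} {j k : ℤ} (hjk : 2 ≤ (j - k).natAbs) {f : TemperedModPoly d}
    (hK : Integrable (multiplierKernel φ m k) volume) {B : ℝ} (hB : ∀ x, ‖proj ϕ k f x‖ ≤ B) :
    conv (dil j ϕ.fn) (multiplierPiece φ ϕ m f k) = 0 := by
  rw [multiplierPiece_eq_conv, conv_left_comm hK (integrable_dil_schwartz j ϕ.fn)
    (continuous_proj ϕ k f) hB, conv_dil_fn_proj_eq_zero ϕ hjk]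
  ext x
  simp [conv]

/-- The Littlewood-Paley pieces of `T_m f` are sums of three terms. -/
theorem IsMultiplierImage.proj_eq {d : ℕ} {φ : AnnularCutoff d} {ϕ : DyadicResolution d}
    {m : E d → ℂ} {f g : TemperedModPoly d} (h : IsMultiplierImage φ ϕ m f g)
    (hK : ∀ k, Integrable (multiplierKernel φ m k) volume)
    (hB : ∀ k, ∃ B, ∀ x, ‖proj ϕ k f x‖ ≤ B) (j : ℤ) :
    proj ϕ j g = conv (dil j ϕ.fn) (multiplierPiece φ ϕ m f (j + -1)) +
      conv (dil j ϕ.fn) (multiplierPiece φ ϕ m f (j + 0)) +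
      conv (dil j ϕ.fn) (multiplierPiece φ ϕ m f (j + 1)) := by
  ext x
  -- Testing the defining series against ϕ_j(x - ·) computes Π_j g(x).
  have h1 := h.hasSum ⟨dyadicKernel ϕ.fn j x, dyadicKernel_mem_SInfty ϕ j x⟩
  have h2 : ∀ k, ∫ y, multiplierPiece φ ϕ m f k y * dyadicKernel ϕ.fn j x y =
      conv (dil j ϕ.fn) (multiplierPiece φ ϕ m f k) x := fun k => by
    rw [conv_comm, conv]
    rfl
  simp only [h2] at h1
  have h3 := hasSum_sum_of_ne_finset_zero (L := .unconditional ℤ) (f := fun k =>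
    conv (dil j ϕ.fn) (multiplierPiece φ ϕ m f k) x) (s := {j + -1, j + 0, j + 1}) fun k hk => by
      simp only [Finset.mem_insert, Finset.mem_singleton, not_or] at hk
      obtain ⟨B, hB⟩ := hB k
      rw [conv_multiplierPiece_eq_zero φ ϕ (by omega) (hK k) hB, Pi.zero_apply]
  rw [proj, h1.unique h3, Finset.sum_insert (by simp), Finset.sum_insert (by simp),
    Finset.sum_singleton]
  simp only [Pi.add_apply]
  ring

theorem dil_dil {d : ℕ} (j k : ℤ) (F : E d → ℂ) : dil j (dil k F) = dil (j + k) F := by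
  ext x
  simp only [dil]
  rw [smul_smul, ← zpow_add₀ two_ne_zero, add_comm k j, ← mul_assoc, ← zpow_add₀ two_ne_zero,
    add_mul]

/-- For |i| ≤ 1 the spectrum 2^{i-1} ≤ |ξ| ≤ 2^{i+1} lies in the annulus where the transform of Φ is
1. -/
theorem reproduces_dil_fn {d : ℕ} (ϕ : DyadicResolution d) {i : ℤ} (hi : i.natAbs ≤ 1)
    {Φ : 𝓢(E d, ℂ)} (hΦ : ∀ ξ, 1 / 4 ≤ ‖ξ‖ → ‖ξ‖ ≤ 4 → 𝓕 Φ ξ = 1) :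
    Reproduces Φ 0 (dil i ϕ.fn) := by
  ext x
  have h := integral_dil_mul_dil Φ ϕ.fn 0 i x 0
  simp only [sub_zero] at h
  rw [conv_apply', h, ← fourierInv_comp_zpow_smul]
  refine congrFun (congrArg _ (funext fun ξ => ?_)) x
  by_cases hξ : 1 / 2 ≤ ‖(2 : ℝ) ^ (-i) • ξ‖ ∧ ‖(2 : ℝ) ^ (-i) • ξ‖ ≤ 2
  · obtain ⟨h1, h2⟩ := hξ
    rw [neg_zero, zpow_zero, one_smul]
    rw [norm_smul, Real.norm_of_nonneg (by positivity)] at h1 h2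
    have hi' : i = -1 ∨ i = 0 ∨ i = 1 := by omega
    rw [hΦ ξ, one_mul]
    all_goals
      rcases hi' with rfl | rfl | rfl <;> norm_num at h1 h2 <;> linarith
  · rw [fourier_fn_eq_zero ϕ hξ, mul_zero]

theorem eLpNorm_dil_schwartz_ne_top {d : ℕ} (g : 𝓢(E d, ℂ)) (k : ℤ) (r : ℝ≥0∞) :
    eLpNorm (dil k g) r volume ≠ ∞ := by
  have h1 : MemLp (fun x => g ((2 : ℝ) ^ k • x)) r volume := by
    refine ⟨Continuous.aestronglyMeasurable (by fun_prop), ?_⟩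
    rw [eLpNorm_comp_zpow_smul k g.continuous]
    exact ENNReal.mul_lt_top (two_rpow_ne_top _).lt_top (g.memLp r volume).2
  exact (h1.const_mul ((2 : ℂ) ^ (k * d))).2.ne

/-- The convolution inequality wants both factors at one scale, so ϕ_j is viewed as the dilate at
scale j + i of the fixed function 2^{-id} ϕ(2^{-i}·). -/
theorem exists_eLpNorm_conv_dil_fn_le {d : ℕ} (ϕ : DyadicResolution d) {Φ : 𝓢(E d, ℂ)}
    (hΦ : ∀ ξ, 1 / 4 ≤ ‖ξ‖ → ‖ξ‖ ≤ 4 → 𝓕 Φ ξ = 1) {p : ℝ≥0∞} (hp : p ≠ 0) {i : ℤ}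
    (hi : i.natAbs ≤ 1) :
    ∃ C : ℝ≥0∞, C ≠ ∞ ∧ ∀ (j : ℤ) (H : E d → ℂ), Continuous H → Reproduces Φ (j + i) H →
      (∃ S : ℝ, ∀ x, ‖H x‖ ≤ S) →
      eLpNorm (conv (dil j ϕ.fn) H) p volume ≤ C * eLpNorm H p volume := by
  obtain ⟨C, hC, h⟩ := exists_eLpNorm_conv_dil_le Φ hp
  obtain ⟨S, -, hS⟩ := exists_norm_iteratedFDeriv_le ϕ.fn 0 0
  refine ⟨C * eLpNorm (dil (-i) ϕ.fn) (min 1 p) volume,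
    ENNReal.mul_ne_top hC (eLpNorm_dil_schwartz_ne_top _ _ _), fun j H hH hHr hHb => ?_⟩
  have h1 := h (j + i) (dil (-i) ϕ.fn) H (continuous_dil _ ϕ.fn.continuous) hH
    (integrable_dil_schwartz _ _) (reproduces_dil_fn ϕ (by rwa [Int.natAbs_neg]) hΦ) hHr
    ⟨‖(2 : ℂ) ^ (-i * d)‖ * S, fun x => by
      rw [dil, norm_mul]
      gcongr
      simpa using hS _⟩ hHb
  rwa [dil_dil, add_neg_cancel_right] at h1

theorem eLpNorm_add_add_le {α ε : Type*} [MeasurableSpace α] [TopologicalSpace ε]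
    [ESeminormedAddMonoid ε] [ContinuousAdd ε] {μ : Measure α} {f g h : α → ε}
    (hf : AEStronglyMeasurable f μ) (hg : AEStronglyMeasurable g μ)
    (hh : AEStronglyMeasurable h μ) (p : ℝ≥0∞) :
    eLpNorm (f + g + h) p μ ≤
      ENNReal.LpAddConst p * (ENNReal.LpAddConst p * (eLpNorm f p μ + eLpNorm g p μ) + eLpNorm h p μ) :=
  (eLpNorm_add_le' (hf.add hg) hh p).trans (by gcongr; exact eLpNorm_add_le' hf hg p)

theorem eLpNorm_count_add_right (a : ℤ → ℝ≥0∞) (i : ℤ) (q : ℝ≥0∞) :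
    eLpNorm (fun j => a (j + i)) q Measure.count = eLpNorm a q Measure.count :=
  eLpNorm_comp_measurePreserving (g := a) (f := fun j => j + i)
    StronglyMeasurable.of_discrete.aestronglyMeasurable (measurePreserving_add_right _ i)

theorem lpAddConst_ne_top (p : ℝ≥0∞) : ENNReal.LpAddConst p ≠ ∞ := (ENNReal.LpAddConst_lt_top p).ne

theorem exists_eLpNorm_proj_le {d : ℕ} (φ : AnnularCutoff d) (ϕ : DyadicResolution d)
    {p : ℝ≥0∞} (hp : p ≠ 0) :
    ∃ D : ℝ≥0∞, D ≠ ∞ ∧ ∀ m : E d → ℂ, MemLp m ∞ volume → ∀ A : ℝ≥0∞,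
      (∀ k, eLpNorm (unitKernel φ m k) (min 1 p) volume ≤ A) →
      (∀ k, Integrable (unitKernel φ m k) volume) →
      ∀ f g : TemperedModPoly d, (∀ k, ∃ B, ∀ x, ‖proj ϕ k f x‖ ≤ B) →
      IsMultiplierImage φ ϕ m f g → ∀ j, eLpNorm (proj ϕ j g) p volume ≤
        D * A * (eLpNorm (proj ϕ (j + -1) f) p volume + eLpNorm (proj ϕ (j + 0) f) p volume +
          eLpNorm (proj ϕ (j + 1) f) p volume) := by
  obtain ⟨Φ, -, hΦ, -⟩ := exists_bandLimiter d
  obtain ⟨C, hC, h⟩ := exists_eLpNorm_conv_dil_le Φ hp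
  -- The index i stands for the shift i - 1 ∈ {-1, 0, 1}.
  have hi : ∀ i : Fin 3, ((i : ℤ) - 1).natAbs ≤ 1 := fun i => by omega
  choose C' hC' h' using fun i : Fin 3 => exists_eLpNorm_conv_dil_fn_le ϕ hΦ hp (hi i)
  set L := ENNReal.LpAddConst p
  set M := C' 0 + C' 1 + C' 2 with hM
  -- Enlarging the quasi-triangle constant by 1 makes it at least 1 at once, so the third summand
  -- can carry the same factor as the other two.
  have hL1 : 1 ≤ L + 1 := le_add_self
  refine ⟨(L + 1) * ((L + 1) * (M * C)), ?_, fun m hm A hA hκi f g hB hg j => ?_⟩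
  · have hL : L + 1 ≠ ∞ := ENNReal.add_ne_top.2 ⟨lpAddConst_ne_top p, ENNReal.one_ne_top⟩
    have hM : M ≠ ∞ :=
      ENNReal.add_ne_top.2 ⟨ENNReal.add_ne_top.2 ⟨hC' 0, hC' 1⟩, hC' 2⟩
    exact ENNReal.mul_ne_top hL (ENNReal.mul_ne_top hL (ENNReal.mul_ne_top hM hC))
  have hKi : ∀ k, Integrable (multiplierKernel φ m k) volume := fun k => by
    rw [multiplierKernel_eq_dil]
    exact integrable_dil k (hκi k)
  have hHc : ∀ k, Continuous (multiplierPiece φ ϕ m f k) := fun k => by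
    obtain ⟨B, hB⟩ := hB k
    exact continuous_conv (hKi k) (continuous_proj ϕ k f) hB
  have hHb : ∀ k, ∃ S, ∀ x, ‖multiplierPiece φ ϕ m f k x‖ ≤ S := fun k => by
    obtain ⟨B, hB⟩ := hB k
    exact ⟨_, norm_conv_le (hKi k) hB⟩
  have hHr : ∀ k, Reproduces Φ k (multiplierPiece φ ϕ m f k) := fun k => by
    obtain ⟨B, hB⟩ := hB k
    exact (reproduces_proj ϕ k f hΦ).conv (hKi k) (continuous_proj ϕ k f) hB
  have hH : ∀ k, eLpNorm (multiplierPiece φ ϕ m f k) p volume ≤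
      C * A * eLpNorm (proj ϕ k f) p volume := fun k => by
    rw [multiplierPiece_eq_conv, multiplierKernel_eq_dil]
    refine (h k (unitKernel φ m k) (proj ϕ k f) (continuous_unitKernel φ hm k)
      (continuous_proj ϕ k f) (hκi k) (reproduces_unitKernel φ hm k hΦ)
      (reproduces_proj ϕ k f hΦ) (norm_unitKernel_le φ m k) (hB k)).trans ?_
    gcongr
    exact hA k
  have hR : ∀ i : Fin 3, ∀ k, k = j + ((i : ℤ) - 1) →
      eLpNorm (conv (dil j ϕ.fn) (multiplierPiece φ ϕ m f k)) p volume ≤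
        M * (C * A * eLpNorm (proj ϕ k f) p volume) := by
    rintro i k rfl
    refine (h' i j _ (hHc _) (hHr _) (hHb _)).trans ?_
    have hle : C' i ≤ M := by
      rw [hM]
      fin_cases i
      · exact le_add_right le_self_add
      · exact le_add_right le_add_self
      · exact le_add_self
    gcongr
    exact hH _
  have hRm : ∀ k, AEStronglyMeasurable (conv (dil j ϕ.fn) (multiplierPiece φ ϕ m f k)) volume :=
    fun k => by
      obtain ⟨S, hS⟩ := hHb k
      exact (continuous_conv (integrable_dil_schwartz j ϕ.fn) (hHc k) hS).aestronglyMeasurable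
  rw [hg.proj_eq hKi hB j]
  refine (eLpNorm_add_add_le (hRm _) (hRm _) (hRm _) p).trans ?_
  set a := eLpNorm (proj ϕ (j + -1) f) p volume
  set b := eLpNorm (proj ϕ (j + 0) f) p volume
  set c := eLpNorm (proj ϕ (j + 1) f) p volume
  calc _ ≤ (L + 1) * ((L + 1) * (M * (C * A * a) + M * (C * A * b)) +
        (L + 1) * (M * (C * A * c))) := by
        gcongr
        · exact le_self_add
        · exact le_self_add
        · exact hR 0 _ (by simp)
        · exact hR 1 _ (by simp)
        · exact (hR 2 _ (by simp)).trans (le_mul_of_one_le_left zero_le hL1)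
    _ = _ := by ring

theorem exists_besovNorm_le {d : ℕ} (φ : AnnularCutoff d) (ϕ : DyadicResolution d)
    {p q : ℝ≥0∞} (hp : p ≠ 0) (hq : q ≠ 0) :
    ∃ D : ℝ≥0∞, D ≠ ∞ ∧ ∀ m : E d → ℂ, MemLp m ∞ volume → ∀ A : ℝ≥0∞, A ≠ ∞ →
      (∀ k, eLpNorm (unitKernel φ m k) (min 1 p) volume ≤ A) →
      ∀ f g : TemperedModPoly d, besovNorm ϕ p q f ≠ ∞ → IsMultiplierImage φ ϕ m f g →
        besovNorm ϕ p q g ≤ D * A * besovNorm ϕ p q f := by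
  obtain ⟨D, hD, h⟩ := exists_eLpNorm_proj_le φ ϕ hp
  set L := ENNReal.LpAddConst q
  have hL : L ≠ ∞ := lpAddConst_ne_top q
  have hr0 : min 1 p ≠ 0 := (lt_min one_pos (pos_iff_ne_zero.2 hp)).ne'
  refine ⟨D * (L * (L * 2 + 1)), ENNReal.mul_ne_top hD (ENNReal.mul_ne_top hL
    (ENNReal.add_ne_top.2 ⟨ENNReal.mul_ne_top hL (by simp), by simp⟩)),
    fun m hm A hA hK f g hf hg => ?_⟩
  obtain ⟨C, hC, hκ⟩ := exists_lintegral_enorm_unitKernel_le φ hm hr0 (min_le_left _ _) hA hK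
  obtain ⟨S, -, hS⟩ := exists_norm_proj_le_of_besovNorm_ne_top ϕ hp hq hf
  have hproj := h m hm A hK (fun k => integrable_of_lintegral_enorm_ne_top
    (continuous_unitKernel φ hm k) (ne_top_of_le_ne_top hC (hκ k))) f g
    (fun k => ⟨_, hS k⟩) hg
  set a : ℤ → ℝ≥0∞ := fun k => eLpNorm (proj ϕ k f) p volume with ha
  have hDA : D * A ≠ ∞ := ENNReal.mul_ne_top hD hA
  have hmeas : ∀ b : ℤ → ℝ≥0∞, AEStronglyMeasurable b Measure.count := fun b =>
    StronglyMeasurable.of_discrete.aestronglyMeasurable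
  calc besovNorm ϕ p q g
      ≤ (D * A).toNNReal • eLpNorm
          ((fun j => a (j + -1)) + (fun j => a (j + 0)) + fun j => a (j + 1)) q
          Measure.count := by
        refine eLpNorm_le_nnreal_smul_eLpNorm_of_ae_le_mul'
          (Filter.Eventually.of_forall fun j => ?_) q
        rw [ENNReal.coe_toNNReal hDA, enorm_eq_self, enorm_eq_self]
        exact hproj j
    _ ≤ (D * A).toNNReal • (L * (L * (eLpNorm a q Measure.count + eLpNorm a q Measure.count) +
          eLpNorm a q Measure.count)) := by
        gcongr
        refine (eLpNorm_add_add_le (hmeas _) (hmeas _) (hmeas _) q).trans (le_of_eq ?_)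
        simp only [eLpNorm_count_add_right]
        rfl
    _ = _ := by
        rw [ENNReal.smul_def, smul_eq_mul, ENNReal.coe_toNNReal hDA, besovNorm, ← ha]
        ring

/-- Both parts of the theorem share this reduction; they differ only in how the L^r norm of the unit
kernels is bounded by a Herz norm. -/
theorem exists_isMultiplierImage_and_besovNorm_le {d : ℕ} (φ : AnnularCutoff d)
    (ϕ : DyadicResolution d) {p q : ℝ≥0∞} (hp : 0 < p) (hq : 0 < q) {u : ℝ≥0∞} {s : ℝ} {C : ℝ≥0∞}
    (hC : C ≠ ∞)
    (h : ∀ m : E d → ℂ, MemLp m ∞ volume → ∀ k, eLpNorm (unitKernel φ m k) (min 1 p) volume ≤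
      C * herzNorm u s (min 1 p) (unitKernel φ m k)) :
    ∃ C : ℝ≥0, ∀ m : E d → ℂ, MemLp m ∞ volume → herzMultiplierNorm φ u s (min 1 p) m < ∞ →
      ∀ f : TemperedModPoly d, besovNorm ϕ p q f < ∞ →
        (∃ g, IsMultiplierImage φ ϕ m f g) ∧ ∀ g, IsMultiplierImage φ ϕ m f g →
          besovNorm ϕ p q g ≤ C * herzMultiplierNorm φ u s (min 1 p) m * besovNorm ϕ p q f := by
  obtain ⟨D, hD, hbound⟩ := exists_besovNorm_le φ ϕ hp.ne' hq.ne'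
  refine ⟨(D * C).toNNReal, fun m hm hfin f hf => ?_⟩
  have hA : C * herzMultiplierNorm φ u s (min 1 p) m ≠ ∞ := ENNReal.mul_ne_top hC hfin.ne
  have hK : ∀ k, eLpNorm (unitKernel φ m k) (min 1 p) volume ≤
      C * herzMultiplierNorm φ u s (min 1 p) m := fun k => by
    refine (h m hm k).trans ?_
    gcongr
    exact le_iSup (fun k => herzNorm u s (min 1 p) (unitKernel φ m k)) k
  refine ⟨exists_isMultiplierImage φ ϕ hp.ne' hq.ne' hm (lt_min one_pos hp).ne'
    (min_le_left _ _) hA hK hf.ne, fun g hg => ?_⟩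
  rw [ENNReal.coe_toNNReal (ENNReal.mul_ne_top hD hC), mul_assoc D]
  exact hbound m hm _ hA hK f g hf.ne hg

theorem exists_eLpNorm_unitKernel_le_of_le {d : ℕ} (φ : AnnularCutoff d) {r u : ℝ≥0∞} (hu : 0 < u)
    (hur : u ≤ r) (hr : r ≤ 1) :
    ∃ C : ℝ≥0∞, C ≠ ∞ ∧ ∀ m : E d → ℂ, MemLp m ∞ volume → ∀ k,
      eLpNorm (unitKernel φ m k) r volume ≤ C * herzNorm u 0 r (unitKernel φ m k) := by
  obtain ⟨Φ, -, hΦ, -⟩ := exists_bandLimiter d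
  have hut : u ≠ ∞ := ne_top_of_le_ne_top ENNReal.one_ne_top (hur.trans hr)
  have hu' : 0 < u.toReal := ENNReal.toReal_pos hu.ne' hut
  have hu1 : u.toReal ≤ 1 := by simpa using ENNReal.toReal_mono ENNReal.one_ne_top (hur.trans hr)
  obtain ⟨A, hA, h⟩ := exists_enorm_rpow_le_lintegral Φ hu' hu1 zero_le_one
  obtain ⟨C, hC, h'⟩ := exists_eLpNorm_le_herzNorm_of_le (d := d) hu.ne' hur
    (ne_top_of_le_ne_top ENNReal.one_ne_top hr) le_rfl hA
  refine ⟨C, hC, fun m hm k => h' _ (continuous_unitKernel φ hm k).measurable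
    (h _ (continuous_unitKernel φ hm k) (reproduces_unitKernel φ hm k hΦ) ?_)⟩
  obtain ⟨S, hS⟩ := norm_unitKernel_le φ m k
  refine ⟨S, fun x => (hS x).trans ?_⟩
  exact le_mul_of_one_le_right ((norm_nonneg _).trans (hS x))
    (Real.one_le_rpow (le_add_of_nonneg_right (norm_nonneg x)) (by positivity))

end BesovMultiplier

end

/-! ### The theorem. -/

open BesovMultiplier in
theorem mainTheorem6 (d : ℕ) (hd : 0 < d) (φ : AnnularCutoff d) (ϕ : DyadicResolution d) :
    -- `T_m` on `S'/𝒫` extends the operator `h ↦ (m \hat h)^∨` on Schwartz functions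
    (∀ (m : E d → ℂ) (hm : MemLp m ⊤ volume) (h : 𝓢(E d, ℂ)),
      IsMultiplierImage φ ϕ m (toModPoly (h : 𝓢'(E d, ℂ)))
        (toModPoly (schwartzMultiplier hm h))) ∧
    ∀ p q u : ℝ≥0∞, 0 < p → 0 < q → 0 < u →
      (u ≤ min 1 p →
        ∃ C : ℝ≥0, ∀ m : E d → ℂ, MemLp m ⊤ volume →
          herzMultiplierNorm φ u 0 (min 1 p) m < ⊤ →
          ∀ f : TemperedModPoly d, besovNorm ϕ p q f < ⊤ →
            (∃ g, IsMultiplierImage φ ϕ m f g) ∧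
            ∀ g, IsMultiplierImage φ ϕ m f g →
              besovNorm ϕ p q g ≤
                C * herzMultiplierNorm φ u 0 (min 1 p) m * besovNorm ϕ p q f) ∧
      (min 1 p < u →
        ∃ C : ℝ≥0, ∀ m : E d → ℂ, MemLp m ⊤ volume →
          herzMultiplierNorm φ u (d * ((min 1 p)⁻¹).toReal - d * (u⁻¹).toReal) (min 1 p) m < ⊤ →
          ∀ f : TemperedModPoly d, besovNorm ϕ p q f < ⊤ →
            (∃ g, IsMultiplierImage φ ϕ m f g) ∧
            ∀ g, IsMultiplierImage φ ϕ m f g →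
              besovNorm ϕ p q g ≤
                C * herzMultiplierNorm φ u
                    (d * ((min 1 p)⁻¹).toReal - d * (u⁻¹).toReal) (min 1 p) m *
                  besovNorm ϕ p q f) := by
  refine ⟨fun m hm h => isMultiplierImage_schwartz hd φ ϕ hm h, fun p q u hp hq hu =>
    ⟨fun hur => ?_, fun hru => ?_⟩⟩
  · obtain ⟨C, hC, h⟩ := exists_eLpNorm_unitKernel_le_of_le φ hu hur (min_le_left _ _)
    exact exists_isMultiplierImage_and_besovNorm_le φ ϕ hp hq hC h
  · obtain ⟨C, hC, h⟩ := exists_eLpNorm_le_herzNorm_of_lt (d := d) (lt_min one_pos hp).ne'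
      (ne_top_of_le_ne_top ENNReal.one_ne_top (min_le_left 1 p)) hru
    exact exists_isMultiplierImage_and_besovNorm_le φ ϕ hp hq hC fun m hm k =>
      h _ (continuous_unitKernel φ hm k).aestronglyMeasurable
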